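/- Let $g\ge 0$. A \emph{Jacobi diagram} is a finite uni-trivalent graph (loops and multiple edges allowed) with a cyclic order of the three half-edges at each trivalent vertex and with each univalent vertex labelled by an element of $\{1^+,\dots,g^+,1^-,\dots,g^-\}$, considered up to isomorphism. For $n,l\ge 0$ let $\mathcal{A}^c_{n,l}$ be the $\mathbb{Z}$-module generated by the connected Jacobi diagrams with $n$ trivalent vertices and first Betti number $l$, subject to the following relations: AS (reversing the cyclic order at one trivalent vertex changes the sign), IHX (the local relation $I-H+X=0$ at an edge joining two distinct trivalent vertices), and self-loop (a diagram with an edge joining a trivalent vertex to itself is $0$). In planar pictures all cyclic orders are counterclockwise. For $m\ge 1$ let $O(x_1,\dots,x_m)$ be a circle with $m$ outward legs labelled $x_1,\dots,x_m$ in clockwise order. Let $\theta(a_1,\dots,a_p;b_1,\dots,b_q;c_1,\dots,c_r)$ be the theta graph, two trivalent vertices on the left and on the right joined by an upper, a middle and a lower edge, with legs attached from left to right, labelled $a_1,\dots,a_p$ on the upper edge (pointing upwards), $b_1,\dots,b_q$ on the middle edge (pointing upwards) and $c_1,\dots,c_r$ on the lower edge (pointing downwards). Let $\langle\Theta_n^{\ge1}\rangle\subset\mathcal{A}^c_{n,2}$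 be the submodule generated by all $\theta(a_1,\dots,a_p;b_1,\dots,b_q;c_1,\dots,c_r)$ with $p,q,r\ge1$ and $p+q+r+2=n$. The blow-up of a Jacobi diagram at a trivalent vertex $v$ with half-edges $h_0,h_1,h_2$ in cyclic order replaces $v$ by a triangle with vertices $v_0,v_1,v_2$, where $h_i$ is attached to $v_i$ and the cyclic order at $v_i$ is: $h_i$, the side towards $v_{i+1}$, the side towards $v_{i+2}$ (indices mod $3$). \textbf{Theorem.} Let $n\ge 3$. There is a well-defined homomorphism $\mathfrak{bu}\colon\mathcal{A}^c_{n-2,1}\to\mathcal{A}^c_{n,2}$ that sends the class of each diagram $J$ to the class of the blow-up of $J$ at any of its trivalent vertices, and the induced map \[ \mathfrak{bu}\colon\mathcal{A}^c_{n-2,1}\to\mathcal{A}^c_{n,2}/\langle\Theta_n^{\ge1}\rangle \] is an isomorphism. Its inverse satisfies \[ \theta(a_1,\dots,a_p;\,;c_1,\dots,c_r)\mapsto O(a_1,\dots,a_p,c_r,\dots,c_1)\quad(p,r\ge1,\ p+r=n-2), \] \[ \theta(a_1,\dots,a_{n-2};\,;\,)\mapsto 2\,O(a_1,\dots,a_{n-2}).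 \] -/

import Mathlib

open Finsupp

/-- A Jacobi diagram with legs labelled by `L`: a finite uni-trivalent graph, possibly with loops and
multiple edges, with set `V` of trivalent vertices and set `U` of univalent vertices.
The half-edges are `(v, 0), (v, 1), (v, 2)` for `v : V`, in this cyclic order around `v`, and one
half-edge for every `u : U`; the edges are the orbits of the fixed-point free involution `α`. -/
structure JacobiDiagram (L : Type) where
  V : Type
  U : Type
  finV : Finite V
  finU : Finite U
  α : (V × Fin 3) ⊕ U → (V × Fin 3) ⊕ U
  α_α : ∀ h, α (α h) = h
  α_ne : ∀ h, α h ≠ h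
  label : U → L

namespace JacobiDiagram

variable {L : Type}

instance (J : JacobiDiagram L) : Finite J.V := J.finV
instance (J : JacobiDiagram L) : Finite J.U := J.finU

/-- Half-edges. -/
abbrev H (J : JacobiDiagram L) : Type := (J.V × Fin 3) ⊕ J.U

/-- The vertex at which a half-edge is based. -/
def vert (J : JacobiDiagram L) : J.H → J.V ⊕ J.U
  | .inl (v, _) => .inl v
  | .inr u => .inr u

/-- The simple graph underlying a diagram (loops and multiplicities forgotten). -/
def graph (J : JacobiDiagram L) : SimpleGraph (J.V ⊕ J.U) :=
  SimpleGraph.fromRel fun x y => ∃ h, J.vert h = x ∧ J.vert (J.α h) = y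

def Connected (J : JacobiDiagram L) : Prop := J.graph.Connected

/-- The internal degree: the number of trivalent vertices. -/
noncomputable def iDeg (J : JacobiDiagram L) : ℕ := Nat.card J.V

/-- The number of edges; each edge consists of two half-edges. -/
noncomputable def numEdges (J : JacobiDiagram L) : ℕ := Nat.card J.H / 2

/-- The first Betti number of a connected diagram: edges minus vertices plus one. -/
noncomputable def loopNumber (J : JacobiDiagram L) : ℤ :=
  (J.numEdges : ℤ) - (Nat.card (J.V ⊕ J.U) : ℤ) + 1

/-- Isomorphisms: bijections of the vertices and half-edges that preserve the edges, the labels and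
the cyclic orders; around `v` the half-edges are rotated by `rot v`. -/
structure Iso (J K : JacobiDiagram L) where
  eV : J.V ≃ K.V
  eU : J.U ≃ K.U
  rot : J.V → Fin 3
  α_comm : ∀ h, K.α (Sum.map (fun x => (eV x.1, x.2 + rot x.1)) eU h) =
    Sum.map (fun x => (eV x.1, x.2 + rot x.1)) eU (J.α h)
  label_comm : ∀ u, K.label (eU u) = J.label u

/-- Reattach: what was attached at the half-edge `h` becomes attached at `ρ h`. -/
def permute (J : JacobiDiagram L) (ρ : Equiv.Perm J.H) : JacobiDiagram L where
  V := J.V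
  U := J.U
  finV := J.finV
  finU := J.finU
  α h := ρ (J.α (ρ.symm h))
  α_α h := by simp [J.α_α]
  α_ne h := by
    intro e
    exact J.α_ne (ρ.symm h) (by rw [Equiv.eq_symm_apply, e])
  label := J.label

open Classical in
/-- Interchanging the second and third half-edge at `v` reverses the cyclic order at `v`. -/
noncomputable def asPerm (J : JacobiDiagram L) (v : J.V) : Equiv.Perm J.H :=
  Equiv.swap (.inl (v, 1)) (.inl (v, 2))

open Classical in
/-- The cyclic permutation `(v, i + 1) ↦ (v, i + 2) ↦ (w, j + 1) ↦ (v, i + 1)`. -/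
noncomputable def ihxPerm (J : JacobiDiagram L) (v w : J.V) (i j : Fin 3) : Equiv.Perm J.H :=
  Equiv.swap (.inl (v, i + 1)) (.inl (v, i + 2)) * Equiv.swap (.inl (v, i + 2)) (.inl (w, j + 1))

section blowUp

variable (J : JacobiDiagram L) (v : J.V)

open Classical in
/-- Half-edges of `J` as half-edges of the blow-up at `v`: the half-edge `(v, i)` becomes the
outer half-edge at the `i`-th vertex of the new triangle. -/
noncomputable def blowUpEmb : J.H → (({w : J.V // w ≠ v} ⊕ Fin 3) × Fin 3) ⊕ J.U
  | .inl (w, i) => if h : w = v then .inl (.inr i, 0) else .inl (.inl ⟨w, h⟩, i)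
  | .inr u => .inr u

/-- The edges of the blow-up: the edges of `J`, and the sides of the triangle; the cyclic order at
the `i`-th vertex of the triangle is: outwards, towards `i + 1`, towards `i + 2`. -/
noncomputable def blowUpα : (({w : J.V // w ≠ v} ⊕ Fin 3) × Fin 3) ⊕ J.U →
    (({w : J.V // w ≠ v} ⊕ Fin 3) × Fin 3) ⊕ J.U
  | .inl (.inl w, i) => J.blowUpEmb v (J.α (.inl (w.1, i)))
  | .inl (.inr i, 0) => J.blowUpEmb v (J.α (.inl (v, i)))
  | .inl (.inr i, 1) => .inl (.inr (i + 1), 2)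
  | .inl (.inr i, 2) => .inl (.inr (i + 2), 1)
  | .inr u => J.blowUpEmb v (J.α (.inr u))

theorem blowUpα_emb (h : J.H) : J.blowUpα v (J.blowUpEmb v h) = J.blowUpEmb v (J.α h) := by
  rcases h with ⟨w, i⟩ | u
  · by_cases hw : w = v
    · subst hw; simp [blowUpEmb, blowUpα]
    · simp [blowUpEmb, blowUpα, hw]
  · simp [blowUpEmb, blowUpα]

theorem blowUpEmb_injective : Function.Injective (J.blowUpEmb v) := by
  rintro (⟨w, i⟩ | u) (⟨w', i'⟩ | u') h
  · by_cases hw : w = v <;> by_cases hw' : w' = v <;> simp_all [blowUpEmb]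
  · by_cases hw : w = v <;> simp_all [blowUpEmb]
  · by_cases hw : w' = v <;> simp_all [blowUpEmb]
  · simp_all [blowUpEmb]

theorem blowUp_cases (h : (({w : J.V // w ≠ v} ⊕ Fin 3) × Fin 3) ⊕ J.U) :
    (∃ k, h = J.blowUpEmb v k) ∨ (∃ i, h = .inl (.inr i, 1)) ∨ ∃ i, h = .inl (.inr i, 2) := by
  rcases h with ⟨w | i, j⟩ | u
  · exact .inl ⟨.inl (w.1, j), by simp [blowUpEmb, w.2]⟩
  · fin_cases j
    · exact .inl ⟨.inl (v, i), by simp [blowUpEmb]⟩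
    · exact .inr (.inl ⟨i, rfl⟩)
    · exact .inr (.inr ⟨i, rfl⟩)
  · exact .inl ⟨.inr u, rfl⟩

/-- The blow-up of `J` at the trivalent vertex `v`: the vertex `v` is replaced by a triangle. -/
noncomputable def blowUp : JacobiDiagram L where
  V := {w : J.V // w ≠ v} ⊕ Fin 3
  U := J.U
  finV := inferInstance
  finU := J.finU
  α := J.blowUpα v
  α_α h := by
    rcases J.blowUp_cases v h with ⟨k, rfl⟩ | ⟨i, rfl⟩ | ⟨i, rfl⟩
    · rw [blowUpα_emb, blowUpα_emb, J.α_α]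
    · simp [blowUpα, add_assoc]
    · simp [blowUpα, add_assoc]
  α_ne h := by
    rcases J.blowUp_cases v h with ⟨k, rfl⟩ | ⟨i, rfl⟩ | ⟨i, rfl⟩
    · rw [blowUpα_emb]; exact fun e => J.α_ne k (J.blowUpEmb_injective v e)
    · simp [blowUpα]
    · simp [blowUpα]
  label := J.label

end blowUp

/-- The wheel `O(x₁, …, xₘ)`: a circle with `m` outward legs, labelled `x₁, …, xₘ` in clockwise
order, all cyclic orders being counterclockwise: leg, previous vertex, next vertex. -/
def wheel {m : ℕ} (x : Fin m → L) : JacobiDiagram L where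
  V := Fin m
  U := Fin m
  finV := inferInstance
  finU := inferInstance
  α
    | .inl (j, 0) => .inr j
    | .inl (j, 1) => .inl ((finRotate m).symm j, 2)
    | .inl (j, 2) => .inl (finRotate m j, 1)
    | .inr j => .inl (j, 0)
  α_α h := by
    rcases h with ⟨j, i⟩ | j
    · fin_cases i
      · rfl
      · exact congrArg (fun k => Sum.inl (k, 1)) ((finRotate m).apply_symm_apply j)
      · exact congrArg (fun k => Sum.inl (k, 2)) ((finRotate m).symm_apply_apply j)
    · rfl
  α_ne h := by
    rcases h with ⟨j, i⟩ | j
    · fin_cases i <;> simp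
    · simp
  label := x

section theta

/-- The position, in the cyclic order at an interior vertex of the strand `k` of a theta graph, of
the half-edge towards the left; position `0` is the leg. The legs of the upper strand `0` and of the
middle strand `1` point upwards, those of the lower strand `2` point downwards, and all cyclic
orders are counterclockwise. -/
def leftPos (k : Fin 3) : Fin 3 := if k = 2 then 2 else 1

/-- As `leftPos`, for the half-edge towards the right. -/
def rightPos (k : Fin 3) : Fin 3 := if k = 2 then 1 else 2

variable (m : Fin 3 → ℕ)

/-- Trivalent vertices of a theta graph with `m k` legs on the strand `k`, with `inr false` and
`inr true` for the left and right common endpoints of the strands. -/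
abbrev ThetaV : Type := (Σ k : Fin 3, Fin (m k)) ⊕ Bool

/-- Half-edges of a theta graph. -/
abbrev ThetaH : Type := (ThetaV m × Fin 3) ⊕ (Σ k : Fin 3, Fin (m k))

/-- The half-edge of the strand `k` that points to the left at the `j`-th of its `m k + 1`
vertices other than the left endpoint of the strand. -/
def thetaL (k : Fin 3) (j : ℕ) : ThetaH m :=
  if h : j < m k then .inl (.inl ⟨k, ⟨j, h⟩⟩, leftPos k) else .inl (.inr true, k)

/-- The half-edge of the strand `k` that points to the right at the `j`-th of its `m k + 1`
vertices other than the right endpoint of the strand. At the left endpoint the strands have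
the counterclockwise order `0, 2, 1`. -/
def thetaR (k : Fin 3) : ℕ → ThetaH m
  | 0 => .inl (.inr false, -k)
  | j + 1 => if h : j < m k then .inl (.inl ⟨k, ⟨j, h⟩⟩, rightPos k) else .inl (.inr false, -k)

/-- The edges of the theta graph: the legs, and for every `j ≤ m k` an edge that joins
`thetaR m k j` and `thetaL m k j`. -/
def thetaα : ThetaH m → ThetaH m
  | .inl (.inl ⟨k, j⟩, i) =>
    if i = 0 then .inr ⟨k, j⟩ else if i = leftPos k then thetaR m k j else thetaL m k (j + 1)
  | .inl (.inr false, i) => thetaL m (-i) 0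
  | .inl (.inr true, i) => thetaR m i (m i)
  | .inr u => .inl (.inl u, 0)

theorem leftPos_ne (k : Fin 3) : leftPos k ≠ 0 ∧ rightPos k ≠ 0 ∧ rightPos k ≠ leftPos k := by
  revert k; decide

theorem thetaα_R (k : Fin 3) (j : ℕ) (hj : j ≤ m k) : thetaα m (thetaR m k j) = thetaL m k j := by
  have := leftPos_ne k
  rcases j with _ | j
  · simp [thetaR, thetaα]
  · have h : j < m k := hj
    simp [thetaR, thetaα, h, this]

theorem thetaα_L (k : Fin 3) (j : ℕ) (hj : j ≤ m k) : thetaα m (thetaL m k j) = thetaR m k j := by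
  have := leftPos_ne k
  by_cases h : j < m k
  · simp [thetaL, thetaα, h, this]
  · obtain rfl : j = m k := by omega
    simp [thetaL, thetaα]

theorem theta_cases (h : ThetaH m) :
    (∃ u, h = .inr u) ∨ (∃ u, h = .inl (.inl u, 0)) ∨
      ∃ k j, j ≤ m k ∧ (h = thetaL m k j ∨ h = thetaR m k j) := by
  rcases h with ⟨⟨k, j⟩ | b, i⟩ | u
  · by_cases h0 : i = 0
    · subst h0; exact .inr (.inl ⟨_, rfl⟩)
    · have : i = leftPos k ∨ i = rightPos k := by
        clear j; revert i k; decide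
      rcases this with rfl | rfl
      · exact .inr (.inr ⟨k, j, j.2.le, .inl (by simp [thetaL])⟩)
      · exact .inr (.inr ⟨k, j + 1, j.2, .inr (by simp [thetaR])⟩)
  · cases b
    · exact .inr (.inr ⟨-i, 0, by omega, .inr (by simp [thetaR])⟩)
    · exact .inr (.inr ⟨i, m i, le_rfl, .inl (by simp [thetaL])⟩)
  · exact .inl ⟨u, rfl⟩

theorem thetaR_ne_thetaL (k : Fin 3) (j : ℕ) : thetaR m k j ≠ thetaL m k j := by
  rcases j with _ | j <;> simp only [thetaR, thetaL] <;> split_ifs <;> simp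

/-- The theta graph `θ(a₁, …, a_p; b₁, …, b_q; c₁, …, c_r)`: two trivalent vertices, on the left and
on the right, joined by an upper, a middle and a lower strand, which carry, from left to right, legs
labelled by the `aᵢ` (upwards), by the `bᵢ` (upwards) and by the `cᵢ` (downwards). -/
def theta {p q r : ℕ} (a : Fin p → L) (b : Fin q → L) (c : Fin r → L) : JacobiDiagram L where
  V := ThetaV ![p, q, r]
  U := Σ k : Fin 3, Fin (![p, q, r] k)
  finV := inferInstance
  finU := inferInstance
  α := thetaα ![p, q, r]
  α_α h := by
    rcases theta_cases _ h with ⟨u, rfl⟩ | ⟨u, rfl⟩ | ⟨k, j, hj, rfl | rfl⟩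
    · simp [thetaα]
    · simp [thetaα]
    · rw [thetaα_L _ _ _ hj, thetaα_R _ _ _ hj]
    · rw [thetaα_R _ _ _ hj, thetaα_L _ _ _ hj]
  α_ne h := by
    rcases theta_cases _ h with ⟨u, rfl⟩ | ⟨u, rfl⟩ | ⟨k, j, hj, rfl | rfl⟩
    · simp [thetaα]
    · simp [thetaα]
    · rw [thetaα_L _ _ _ hj]; exact thetaR_ne_thetaL _ _ _
    · rw [thetaα_R _ _ _ hj]; exact (thetaR_ne_thetaL _ _ _).symm
  label
    | ⟨0, j⟩ => a j
    | ⟨1, j⟩ => b j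
    | ⟨2, j⟩ => c j

end theta

/-! Connectedness and loop numbers of the diagrams constructed above. -/

theorem reachable_α (J : JacobiDiagram L) (h : J.H) :
    J.graph.Reachable (J.vert h) (J.vert (J.α h)) := by
  by_cases e : J.vert h = J.vert (J.α h)
  · rw [← e]
  · exact SimpleGraph.Adj.reachable ((SimpleGraph.fromRel_adj _ _ _).2 ⟨e, .inl ⟨h, rfl, rfl⟩⟩)

theorem Connected.transfer {J K : JacobiDiagram L} (hJ : J.Connected)
    (f : J.V ⊕ J.U → K.V ⊕ K.U)
    (hf : ∀ h, K.graph.Reachable (f (J.vert h)) (f (J.vert (J.α h))))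
    (hK : ∀ y, ∃ x, K.graph.Reachable (f x) y) : K.Connected := by
  have hJ' : J.graph.Connected := hJ
  have key : ∀ x y, J.graph.Reachable x y → K.graph.Reachable (f x) (f y) := by
    intro x y hxy
    obtain ⟨p⟩ := hxy
    induction p with
    | nil => exact .refl _
    | cons hadj _ ih =>
      refine SimpleGraph.Reachable.trans ?_ ih
      rcases ((SimpleGraph.fromRel_adj _ _ _).1 hadj).2 with ⟨h, rfl, rfl⟩ | ⟨h, rfl, rfl⟩
      · exact hf h
      · exact (hf h).symm
  have : Nonempty (K.V ⊕ K.U) := hJ'.nonempty.map f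
  refine SimpleGraph.Connected.mk fun y y' => ?_
  obtain ⟨x, hx⟩ := hK y
  obtain ⟨x', hx'⟩ := hK y'
  exact hx.symm.trans ((key _ _ (hJ'.preconnected x x')).trans hx')

theorem connected_of_root {K : JacobiDiagram L} (x : K.V ⊕ K.U)
    (h : ∀ y, K.graph.Reachable x y) : K.Connected := by
  have : Nonempty (K.V ⊕ K.U) := ⟨x⟩
  exact SimpleGraph.Connected.mk fun y y' => (h y).symm.trans (h y')

theorem loopNumber_eq (J : JacobiDiagram L) :
    J.loopNumber = (((Nat.card J.V * 3 + Nat.card J.U) / 2 : ℕ) : ℤ)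
      - (Nat.card J.V + Nat.card J.U) + 1 := by
  simp [loopNumber, numEdges, H, Nat.card_sum, Nat.card_prod]

/-- Connected diagrams of internal degree `n` and loop number `l`. -/
def IsConn (J : JacobiDiagram L) (n : ℕ) (l : ℤ) : Prop :=
  J.Connected ∧ J.iDeg = n ∧ J.loopNumber = l

theorem IsConn.permute {J : JacobiDiagram L} {n : ℕ} {l : ℤ} (hJ : J.IsConn n l)
    (ρ : Equiv.Perm J.H)
    (hρ : ∀ h, (J.permute ρ).graph.Reachable (J.vert h) (J.vert (ρ h))) :
    (J.permute ρ).IsConn n l := by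
  refine ⟨hJ.1.transfer (K := J.permute ρ) id (fun h => ?_) (fun y => ⟨y, .refl _⟩), hJ.2⟩
  refine (hρ h).trans (.trans ?_ (hρ (J.α h)).symm)
  have := (J.permute ρ).reachable_α (ρ h)
  have e : (J.permute ρ).α (ρ h) = ρ (J.α h) := by simp [JacobiDiagram.permute]
  have e' : ∀ k : J.H, (J.permute ρ).vert k = J.vert k := by rintro (⟨_, _⟩ | _) <;> rfl
  rw [e, e', e'] at this
  exact this

theorem IsConn.asPerm {J : JacobiDiagram L} {n : ℕ} {l : ℤ} (hJ : J.IsConn n l) (v : J.V) :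
    (J.permute (J.asPerm v)).IsConn n l := by
  refine hJ.permute _ fun h => ?_
  have : J.vert (J.asPerm v h) = J.vert h := by
    classical
    unfold JacobiDiagram.asPerm
    rw [Equiv.swap_apply_def]
    split_ifs with h1 h2 <;> simp [*, vert]
  rw [this]; exact .refl _

theorem ihxPerm_cases (J : JacobiDiagram L) (v w : J.V) (i j : Fin 3) (h : J.H) :
    J.vert (J.ihxPerm v w i j h) = J.vert h ∨
      ((J.vert h = .inl v ∨ J.vert h = .inl w) ∧
        (J.vert (J.ihxPerm v w i j h) = .inl v ∨ J.vert (J.ihxPerm v w i j h) = .inl w)) := by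
  classical
  have key : ∀ x y h : J.H, (J.vert x = .inl v ∨ J.vert x = .inl w) →
      (J.vert y = .inl v ∨ J.vert y = .inl w) → Equiv.swap x y h = h ∨
        ((J.vert h = .inl v ∨ J.vert h = .inl w) ∧
          (J.vert (Equiv.swap x y h) = .inl v ∨ J.vert (Equiv.swap x y h) = .inl w)) := by
    intro x y h hx hy
    rw [Equiv.swap_apply_def]
    split_ifs with h1 h2
    · subst h1; exact .inr ⟨hx, hy⟩
    · subst h2; exact .inr ⟨hy, hx⟩
    · exact .inl rfl
  have e : J.ihxPerm v w i j h = Equiv.swap (.inl (v, i + 1)) (.inl (v, i + 2))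
      (Equiv.swap (.inl (v, i + 2)) (.inl (w, j + 1)) h) := by
    unfold ihxPerm
    rw [Equiv.Perm.mul_apply]
  have k1 := key (.inl (v, i + 2)) (.inl (w, j + 1)) h (.inl rfl) (.inr rfl)
  have k2 := key (.inl (v, i + 1)) (.inl (v, i + 2))
    (Equiv.swap (.inl (v, i + 2)) (.inl (w, j + 1)) h) (.inl rfl) (.inl rfl)
  rw [e]
  rcases k1 with k1 | ⟨k1, k1'⟩ <;> rcases k2 with k2 | ⟨k2, k2'⟩
  · left; rw [k2, k1]
  · right; rw [k1] at k2; exact ⟨k2, k2'⟩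
  · right; rw [k2]; exact ⟨k1, k1'⟩
  · exact .inr ⟨k1, k2'⟩

theorem ihxPerm_fix (J : JacobiDiagram L) {v w : J.V} (hvw : v ≠ w) (i j : Fin 3) :
    J.ihxPerm v w i j (.inl (v, i)) = .inl (v, i) ∧
      J.ihxPerm v w i j (.inl (w, j)) = .inl (w, j) := by
  simp [ihxPerm, Equiv.Perm.mul_apply, Equiv.swap_apply_def, hvw, hvw.symm]

theorem IsConn.ihxPerm {J : JacobiDiagram L} {n : ℕ} {l : ℤ} (hJ : J.IsConn n l) {v w : J.V}
    {i j : Fin 3} (hvw : v ≠ w) (he : J.α (.inl (v, i)) = .inl (w, j)) :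
    (J.permute (J.ihxPerm v w i j)).IsConn n l ∧
      (J.permute (J.ihxPerm v w i j)⁻¹).IsConn n l := by
  obtain ⟨f1, f2⟩ := J.ihxPerm_fix hvw i j
  have f1' : (J.ihxPerm v w i j).symm (.inl (v, i)) = .inl (v, i) := by
    rw [Equiv.symm_apply_eq, f1]
  have f2' : (J.ihxPerm v w i j).symm (.inl (w, j)) = .inl (w, j) := by
    rw [Equiv.symm_apply_eq, f2]
  have main : ∀ ρ : Equiv.Perm J.H, ρ (.inl (w, j)) = .inl (w, j) →
      ρ.symm (.inl (v, i)) = .inl (v, i) →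
      (∀ h, J.vert (ρ h) = J.vert h ∨ ((J.vert h = .inl v ∨ J.vert h = .inl w) ∧
        (J.vert (ρ h) = .inl v ∨ J.vert (ρ h) = .inl w))) → (J.permute ρ).IsConn n l := by
    intro ρ h1 h2 h3
    refine hJ.permute _ fun h => ?_
    have e : (J.permute ρ).graph.Reachable (.inl v) (.inl w) := by
      have := (J.permute ρ).reachable_α (.inl (v, i))
      simpa [JacobiDiagram.permute, h2, he, h1, vert] using this
    rcases h3 h with h | ⟨a | a, b | b⟩
    · rw [h]; exact .refl _
    · rw [a, b]; exact .refl _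
    · rw [a, b]; exact e
    · rw [a, b]; exact e.symm
    · rw [a, b]; exact .refl _
  refine ⟨main _ f2 f1' (J.ihxPerm_cases v w i j), main _ f2' f1 fun h => ?_⟩
  have := J.ihxPerm_cases v w i j ((J.ihxPerm v w i j)⁻¹ h)
  have e : J.ihxPerm v w i j ((J.ihxPerm v w i j)⁻¹ h) = h := Equiv.apply_symm_apply _ _
  rw [e] at this
  rcases this with h | ⟨a, b⟩
  · exact .inl h.symm
  · exact .inr ⟨b, a⟩

theorem IsConn.blowUp {J : JacobiDiagram L} {n : ℕ} {l : ℤ} (hJ : J.IsConn n l) (v : J.V) :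
    (J.blowUp v).IsConn (n + 2) (l + 1) := by
  classical
  have hcard : Nat.card (J.blowUp v).V = Nat.card J.V + 2 := by
    have : Fintype J.V := Fintype.ofFinite _
    have h : 0 < Nat.card J.V := Nat.card_pos_iff.2 ⟨⟨v⟩, inferInstance⟩
    change Nat.card ({w : J.V // w ≠ v} ⊕ Fin 3) = _
    have h' : Nat.card {w : J.V // w ≠ v} = Nat.card J.V - 1 := by
      simp [Nat.card_eq_fintype_card, Fintype.card_subtype_compl]
    rw [Nat.card_sum, h', Nat.card_fin]
    omega
  have hU : Nat.card (J.blowUp v).U = Nat.card J.U := rfl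
  have tri : ∀ i : Fin 3, (J.blowUp v).graph.Reachable (.inl (.inr 0)) (.inl (.inr i)) := by
    have h1 := (J.blowUp v).reachable_α (.inl (.inr 0, 1))
    have h2 := (J.blowUp v).reachable_α (.inl (.inr 0, 2))
    intro i
    fin_cases i
    · exact .refl _
    · exact h1
    · exact h2
  let f : J.V ⊕ J.U → (J.blowUp v).V ⊕ (J.blowUp v).U
    | .inl w => if h : w = v then .inl (.inr 0) else .inl (.inl ⟨w, h⟩)
    | .inr u => .inr u
  have hf : ∀ h : J.H, (J.blowUp v).graph.Reachable (f (J.vert h))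
      ((J.blowUp v).vert (J.blowUpEmb v h)) := by
    rintro (⟨w, i⟩ | u)
    · by_cases hw : w = v
      · subst hw
        simpa [f, vert, blowUpEmb] using tri i
      · simp [f, vert, blowUpEmb, hw]
    · simp [f, vert, blowUpEmb]
  refine ⟨hJ.1.transfer f (fun h => ?_) ?_, ?_, ?_⟩
  · refine (hf h).trans (.trans ?_ (hf (J.α h)).symm)
    rw [← blowUpα_emb]
    exact (J.blowUp v).reachable_α _
  · rintro ((w | i) | u)
    · exact ⟨.inl w.1, by simp [f, w.2]⟩
    · exact ⟨.inl v, by simpa [f] using tri i⟩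
    · exact ⟨.inr u, .refl _⟩
  · have := hJ.2.1
    simp only [iDeg] at this ⊢
    omega
  · have := hJ.2.2
    rw [loopNumber_eq] at this ⊢
    rw [hcard, hU]
    omega

theorem wheel_isConn {m : ℕ} (x : Fin m → L) (hm : 0 < m) : (wheel x).IsConn m 1 := by
  obtain ⟨k, rfl⟩ : ∃ k, m = k + 1 := ⟨m - 1, by omega⟩
  have hV : ∀ (j : ℕ) (hj : j < k + 1),
      (wheel x).graph.Reachable (.inl (0 : Fin (k + 1))) (.inl (⟨j, hj⟩ : Fin (k + 1))) := by
    intro j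
    induction j with
    | zero => exact fun _ => .refl _
    | succ j ih =>
      intro hj
      refine (ih (by omega)).trans ?_
      have := (wheel x).reachable_α (.inl ((⟨j, by omega⟩ : Fin (k + 1)), 2))
      have e : finRotate (k + 1) ⟨j, by omega⟩ = ⟨j + 1, hj⟩ := finRotate_of_lt (by omega)
      simpa [wheel, vert, e] using this
  refine ⟨connected_of_root (.inl (0 : Fin (k + 1))) ?_, ?_, ?_⟩
  · rintro (j | j)
    · exact hV j.1 j.2
    · exact (hV j.1 j.2).trans ((wheel x).reachable_α (.inl ((j : Fin (k + 1)), 0)))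
  · simp [iDeg, wheel]
  · rw [loopNumber_eq]
    simp only [wheel, Nat.card_eq_fintype_card, Fintype.card_fin]
    omega

theorem theta_isConn {p q r : ℕ} (a : Fin p → L) (b : Fin q → L) (c : Fin r → L) :
    (theta a b c).IsConn (p + q + r + 2) 2 := by
  set T := theta a b c with hT
  have hR : ∀ (k : Fin 3) (j : ℕ), j ≤ ![p, q, r] k →
      T.graph.Reachable (.inl (.inr false)) (T.vert (thetaR ![p, q, r] k j)) := by
    intro k j
    induction j with
    | zero => exact fun _ => .refl _
    | succ j ih =>
      intro hj
      refine (ih (by omega)).trans ?_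
      have := T.reachable_α (thetaR ![p, q, r] k j)
      have e : T.α (thetaR ![p, q, r] k j) = thetaL ![p, q, r] k j := thetaα_R _ _ _ (by omega)
      rw [e] at this
      have e' : T.vert (thetaL ![p, q, r] k j) = T.vert (thetaR ![p, q, r] k (j + 1)) := by
        have h : j < ![p, q, r] k := hj
        simp [thetaL, thetaR, h, vert]
      rwa [e'] at this
  have hV : ∀ (k : Fin 3) (j : Fin (![p, q, r] k)),
      T.graph.Reachable (.inl (.inr false)) (.inl (.inl ⟨k, j⟩)) := by
    intro k j
    have := hR k (j + 1) j.2
    simpa [thetaR, vert] using this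
  have hcU : Nat.card (Σ k : Fin 3, Fin (![p, q, r] k)) = p + q + r := by
    simp [Nat.card_eq_fintype_card, Fin.sum_univ_three]
  have hcV : Nat.card T.V = p + q + r + 2 := by
    change Nat.card ((Σ k : Fin 3, Fin (![p, q, r] k)) ⊕ Bool) = _
    rw [Nat.card_sum, hcU]; simp
  refine ⟨connected_of_root (.inl (.inr false)) ?_, hcV, ?_⟩
  · rintro ((⟨k, j⟩ | b) | ⟨k, j⟩)
    · exact hV k j
    · cases b
      · exact .refl _
      · have h1 := hR 0 p le_rfl
        have h2 := T.reachable_α (thetaR ![p, q, r] 0 p)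
        have e : T.α (thetaR ![p, q, r] 0 p) = thetaL ![p, q, r] 0 p := thetaα_R _ _ _ le_rfl
        rw [e] at h2
        have := h1.trans h2
        simpa [thetaL, vert] using this
    · have := T.reachable_α (.inl (.inl ⟨k, j⟩, 0))
      exact (hV k j).trans this
  · rw [loopNumber_eq, hcV]
    have : Nat.card T.U = p + q + r := hcU
    rw [this]
    omega

end JacobiDiagram

/-- The set of connected Jacobi diagrams of internal degree `n` and first Betti number `l`. -/
def ConnDiagram (L : Type) (n : ℕ) (l : ℤ) : Type 1 := {J : JacobiDiagram L // J.IsConn n l}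

namespace ConnDiagram

open JacobiDiagram

variable {L : Type} {n : ℕ} {l : ℤ}

/-- `J` with the cyclic order at `v` reversed. -/
noncomputable def flip (J : ConnDiagram L n l) (v : J.1.V) : ConnDiagram L n l :=
  ⟨J.1.permute (J.1.asPerm v), J.2.asPerm v⟩

/-- For an edge that joins the half-edges `(v, i)` and `(w, j)` with `v ≠ w`: the diagram in which
the three outer half-edges `(v, i + 1)`, `(v, i + 2)`, `(w, j + 1)` are cyclically permuted. -/
noncomputable def ihx₁ (J : ConnDiagram L n l) {v w : J.1.V} {i j : Fin 3} (hvw : v ≠ w)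
    (he : J.1.α (.inl (v, i)) = .inl (w, j)) : ConnDiagram L n l :=
  ⟨J.1.permute (J.1.ihxPerm v w i j), (J.2.ihxPerm hvw he).1⟩

/-- As `ihx₁`, with the inverse cyclic permutation. -/
noncomputable def ihx₂ (J : ConnDiagram L n l) {v w : J.1.V} {i j : Fin 3} (hvw : v ≠ w)
    (he : J.1.α (.inl (v, i)) = .inl (w, j)) : ConnDiagram L n l :=
  ⟨J.1.permute (J.1.ihxPerm v w i j)⁻¹, (J.2.ihxPerm hvw he).2⟩

/-- Blowing up the trivalent vertex `v` into a triangle. -/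
noncomputable def blowUp (J : ConnDiagram L n l) (v : J.1.V) {n' : ℕ} {l' : ℤ} (hn : n + 2 = n')
    (hl : l + 1 = l') : ConnDiagram L n' l' :=
  ⟨J.1.blowUp v, hn ▸ hl ▸ J.2.blowUp v⟩

/-- `O(x₁, …, xₘ)` as a connected one-loop diagram. -/
def wheel {m : ℕ} (x : Fin m → L) (hm : 0 < m) (hn : m = n) : ConnDiagram L n 1 :=
  ⟨JacobiDiagram.wheel x, hn ▸ wheel_isConn x hm⟩

/-- `θ(a₁, …, a_p; b₁, …, b_q; c₁, …, c_r)` as a connected two-loop diagram. -/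
def theta {p q r : ℕ} (a : Fin p → L) (b : Fin q → L) (c : Fin r → L) (hn : p + q + r + 2 = n) :
    ConnDiagram L n 2 :=
  ⟨JacobiDiagram.theta a b c, hn ▸ theta_isConn a b c⟩

/-- The relators: isomorphic diagrams are equal, AS, IHX and self-loop. With the outer half-edges
named as in `ihx₁`, the IHX relation is the Jacobi identity `I - H + X = 0`, the signs having been
absorbed in the cyclic orders. -/
inductive IsRelator : (ConnDiagram L n l →₀ ℤ) → Prop
  | iso (J K : ConnDiagram L n l) (e : Iso J.1 K.1) : IsRelator (single J 1 - single K 1)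
  | as (J : ConnDiagram L n l) (v : J.1.V) : IsRelator (single J 1 + single (J.flip v) 1)
  | ihx (J : ConnDiagram L n l) (v w : J.1.V) (i j : Fin 3) (hvw : v ≠ w)
      (he : J.1.α (.inl (v, i)) = .inl (w, j)) :
      IsRelator (single J 1 + single (J.ihx₁ hvw he) 1 + single (J.ihx₂ hvw he) 1)
  | selfLoop (J : ConnDiagram L n l) (v : J.1.V) (i j : Fin 3)
      (he : J.1.α (.inl (v, i)) = .inl (v, j)) : IsRelator (single J 1)

end ConnDiagram

/-- The `ℤ`-module of connected Jacobi diagrams of internal degree `n` and loop number `l` modulo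
the AS, IHX and self-loop relations. -/
abbrev JacobiModule (L : Type) (n : ℕ) (l : ℤ) : Type 1 :=
  (ConnDiagram L n l →₀ ℤ) ⧸
    Submodule.span ℤ {x : ConnDiagram L n l →₀ ℤ | ConnDiagram.IsRelator x}

/-- The class of a diagram. -/
noncomputable def ConnDiagram.cls {L : Type} {n : ℕ} {l : ℤ} (J : ConnDiagram L n l) :
    JacobiModule L n l :=
  Submodule.Quotient.mk (single J 1)

/-- The submodule generated by the `θ(a₁, …, a_p; b₁, …, b_q; c₁, …, c_r)` with `p, q, r ≥ 1` and
`p + q + r + 2 = n`. -/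
noncomputable def thetaSubmodule (L : Type) (n : ℕ) : Submodule ℤ (JacobiModule L n 2) :=
  Submodule.span ℤ {x | ∃ (p q r : ℕ) (a : Fin p → L) (b : Fin q → L) (c : Fin r → L)
    (hn : p + q + r + 2 = n), 1 ≤ p ∧ 1 ≤ q ∧ 1 ≤ r ∧ x = (ConnDiagram.theta a b c hn).cls}

/-- The labels `1⁺, …, g⁺, 1⁻, …, g⁻`. -/
abbrev SurfaceLabel (g : ℕ) : Type := Fin g × Bool

/-! Diagrams are handled through the names of their edges: a multiset of ordered triples for the
trivalent vertices and a multiset of labelled names for the legs (`IsModel`). Such a description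
determines the diagram up to isomorphism (`IsModel.iso`), so AS and IHX become rewriting rules for
the class `ncl` of a description (`ncl_flip`, `ncl_ihx`). Diagrams of the wrong type get class `0`,
which makes these rules unconditional.

The blow-up is well defined for the following reason. Let `v` and `w` be adjacent. IHX at the edge
between them writes the blow-up at `v` as a difference of two squares whose outer edges are the
remaining half-edges at `v` and `w` (`ncl_triangle`, `IsModel.cl_blowUp`). A square has an even
number of vertices, hence the full dihedral symmetry without signs. Consequently the difference is
symmetric in `v` and `w` (`cl_blowUp_of_adj`), and the six squares arising from an IHX relation
cancel in pairs (`cl_blowUp_ihx`). A self-loop survives a blow-up elsewhere; if there is no other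
vertex, the blow-up is annihilated by both 2 and 3.

Surjectivity modulo the thetas with three non-empty strands: IHX inserts vertices into a path or a
cycle, so diagrams of Betti number at least 1 reduce to diagrams with a cycle through all trivalent
vertices (`eq_top_of_cycle_mem`). With Betti number 1 these are wheels; with Betti number 2 such a
cycle has exactly one chord, which gives a theta graph with empty middle strand. IHX moves legs
between strands (`thetaCl_move`) until a single upper leg is left, and that theta is the blow-up of
a wheel (`exists_cl_blowUp_wheel`).

Injectivity comes from a left inverse, a state sum in the style of the weight systems of associative
algebras. A sign at every vertex thickens the graph to a surface. A state contributes if all legs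
lie on one boundary component and another component exists; its value is the product of the signs
times the wheel that carries the word on that component. One base sign is fixed, because a global
sign change alters nothing (`stateCl_neg`). AS and self-loop cancel between states that differ at
one vertex; contracting an edge turns IHX into the Jacobi identity for commutators (`stateSum_ihx`).
On a theta graph a face borders only two strands, so three non-empty strands give `0`
(`stateSum_theta`); with one upper leg, empty middle and non-empty lower strand a single state
survives and reads off the wheel (`stateSum_theta_one`).

The formulas for the inverse follow by moving the upper legs one at a time to the lower strand,
modulo the submodule. When both other strands are empty, the two terms of the first move agree, and
this is the source of the factor 2. -/

namespace JacobiDiagram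

variable {L : Type} {n : ℕ} {l : ℤ}

/-! ### Classes of arbitrary diagrams -/

open Classical in
/-- The class of a diagram, `0` unless it is connected of the right degree and loop number. -/
noncomputable def cl (n : ℕ) (l : ℤ) (J : JacobiDiagram L) : JacobiModule L n l :=
  if h : J.IsConn n l then ConnDiagram.cls ⟨J, h⟩ else 0

theorem cl_of_isConn {J : JacobiDiagram L} (h : J.IsConn n l) :
    J.cl n l = ConnDiagram.cls ⟨J, h⟩ := dif_pos h

theorem cl_of_not_isConn {J : JacobiDiagram L} (h : ¬ J.IsConn n l) : J.cl n l = 0 := dif_neg h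

theorem mk_eq_zero_of_isRelator {x : ConnDiagram L n l →₀ ℤ} (h : ConnDiagram.IsRelator x) :
    (Submodule.Quotient.mk x : JacobiModule L n l) = 0 :=
  (Submodule.Quotient.mk_eq_zero _).2 (Submodule.subset_span h)

namespace Iso

variable {J K : JacobiDiagram L}

/-- The bijection of the half-edges. -/
def hmap (e : Iso J K) : J.H ≃ K.H :=
  Equiv.sumCongr (Equiv.prodShear e.eV fun v => Equiv.addRight (e.rot v)) e.eU

theorem hmap_apply (e : Iso J K) (h : J.H) :
    e.hmap h = Sum.map (fun x => (e.eV x.1, x.2 + e.rot x.1)) e.eU h := by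
  rcases h with ⟨v, i⟩ | u <;> rfl

theorem α_hmap (e : Iso J K) (h : J.H) : K.α (e.hmap h) = e.hmap (J.α h) := by
  rw [hmap_apply, hmap_apply, e.α_comm]

theorem vert_hmap (e : Iso J K) (h : J.H) :
    K.vert (e.hmap h) = Sum.map e.eV e.eU (J.vert h) := by
  rcases h with ⟨v, i⟩ | u <;> rfl

theorem isConn (e : Iso J K) (h : J.IsConn n l) : K.IsConn n l := by
  have cV := Nat.card_congr e.eV
  have cU := Nat.card_congr e.eU
  refine ⟨h.1.transfer (Sum.map e.eV e.eU) (fun k => ?_) (fun y => ?_), ?_, ?_⟩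
  · rw [← vert_hmap, ← vert_hmap, ← α_hmap]; exact K.reachable_α _
  · refine ⟨(Equiv.sumCongr e.eV e.eU).symm y, ?_⟩
    have : Sum.map e.eV e.eU ((Equiv.sumCongr e.eV e.eU).symm y) = y :=
      (Equiv.sumCongr e.eV e.eU).apply_symm_apply y
    rw [this]
  · rw [← h.2.1, iDeg, iDeg, cV]
  · rw [← h.2.2, loopNumber_eq, loopNumber_eq, cV, cU]

/-- The inverse isomorphism. -/
def symm (e : Iso J K) : Iso K J where
  eV := e.eV.symm
  eU := e.eU.symm
  rot v := - e.rot (e.eV.symm v)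
  α_comm h := by
    have key : ∀ k : K.H, Sum.map (fun x => (e.eV.symm x.1, x.2 + - e.rot (e.eV.symm x.1)))
        e.eU.symm k = e.hmap.symm k := by
      intro k
      rw [Equiv.eq_symm_apply, hmap_apply]
      rcases k with ⟨v, i⟩ | u <;> simp
    rw [key, key, Equiv.eq_symm_apply, ← α_hmap, Equiv.apply_symm_apply]
  label_comm u := by rw [← e.label_comm, Equiv.apply_symm_apply]

end Iso

theorem cl_iso {J K : JacobiDiagram L} (e : Iso J K) : J.cl n l = K.cl n l := by
  by_cases h : J.IsConn n l
  · rw [cl_of_isConn h, cl_of_isConn (e.isConn h)]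
    have := mk_eq_zero_of_isRelator (.iso ⟨J, h⟩ ⟨K, e.isConn h⟩ e)
    exact sub_eq_zero.1 this
  · rw [cl_of_not_isConn h, cl_of_not_isConn fun h' => h (e.symm.isConn h')]

/-- Flipping twice restores the diagram, so either both diagrams are connected of the right type or
both classes are `0` by default. -/
theorem cl_flip (J : JacobiDiagram L) (v : J.V) :
    J.cl n l + (J.permute (J.asPerm v)).cl n l = 0 := by
  by_cases h : J.IsConn n l
  · rw [cl_of_isConn h, cl_of_isConn (h.asPerm v)]
    exact mk_eq_zero_of_isRelator (.as ⟨J, h⟩ v)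
  · rw [cl_of_not_isConn h, cl_of_not_isConn, add_zero]
    intro h'
    have h2 := h'.asPerm (J := J.permute (J.asPerm v)) v
    apply h
    have h3 : (J.permute (J.asPerm v * J.asPerm v)).IsConn n l := h2
    have e : J.asPerm v * J.asPerm v = 1 := by classical exact Equiv.swap_mul_self _ _
    rwa [e] at h3

theorem α_permute_ihxPerm {J : JacobiDiagram L} {v w : J.V} {i j : Fin 3} (hvw : v ≠ w)
    (he : J.α (.inl (v, i)) = .inl (w, j)) :
    (J.permute (J.ihxPerm v w i j)).α (.inl (v, i)) = .inl (w, j) ∧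
    (J.permute (J.ihxPerm v w i j)⁻¹).α (.inl (v, i)) = .inl (w, j) := by
  obtain ⟨f1, f2⟩ := J.ihxPerm_fix hvw i j
  constructor
  · change J.ihxPerm v w i j (J.α ((J.ihxPerm v w i j).symm (.inl (v, i)))) = _
    rw [(Equiv.symm_apply_eq _).2 f1.symm, he, f2]; rfl
  · change (J.ihxPerm v w i j).symm (J.α (J.ihxPerm v w i j (.inl (v, i)))) = _
    rw [f1, he]; exact (Equiv.symm_apply_eq _).2 f2.symm

/-- Both moves keep the edge from `v` to `w` and are inverse to each other. Hence the three diagrams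
have the right type simultaneously, and otherwise all three terms take the default value `0`. -/
theorem cl_ihx (J : JacobiDiagram L) {v w : J.V} {i j : Fin 3} (hvw : v ≠ w)
    (he : J.α (.inl (v, i)) = .inl (w, j)) :
    J.cl n l + (J.permute (J.ihxPerm v w i j)).cl n l +
      (J.permute (J.ihxPerm v w i j)⁻¹).cl n l = 0 := by
  by_cases h : J.IsConn n l
  · rw [cl_of_isConn h, cl_of_isConn (h.ihxPerm hvw he).1, cl_of_isConn (h.ihxPerm hvw he).2]
    exact mk_eq_zero_of_isRelator (.ihx ⟨J, h⟩ v w i j hvw he)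
  · obtain ⟨e1, e2⟩ := α_permute_ihxPerm hvw he
    rw [cl_of_not_isConn h, cl_of_not_isConn, cl_of_not_isConn, add_zero, add_zero]
    · intro h'
      have h2 := (h'.ihxPerm (J := J.permute (J.ihxPerm v w i j)⁻¹) hvw e2).1
      have h3 : (J.permute (J.ihxPerm v w i j * (J.ihxPerm v w i j)⁻¹)).IsConn n l := h2
      rw [mul_inv_cancel] at h3
      exact h h3
    · intro h'
      have h2 := (h'.ihxPerm (J := J.permute (J.ihxPerm v w i j)) hvw e1).2
      have h3 : (J.permute ((J.ihxPerm v w i j)⁻¹ * J.ihxPerm v w i j)).IsConn n l := h2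
      rw [inv_mul_cancel] at h3
      exact h h3

theorem cl_selfLoop (J : JacobiDiagram L) {v : J.V} {i j : Fin 3}
    (he : J.α (.inl (v, i)) = .inl (v, j)) : J.cl n l = 0 := by
  by_cases h : J.IsConn n l
  · rw [cl_of_isConn h]
    exact mk_eq_zero_of_isRelator (.selfLoop ⟨J, h⟩ v i j he)
  · exact cl_of_not_isConn h

end JacobiDiagram

/-! ### Enumerations of finite types -/

section enumeration

variable {X Y Z : Type*}

/-- All elements of a finite type. -/
noncomputable def Multiset.enum (X : Type*) [Finite X] : Multiset X :=
  (@Finset.univ X (Fintype.ofFinite X)).val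

theorem Multiset.mem_enum [Finite X] (x : X) : x ∈ Multiset.enum X :=
  @Finset.mem_univ X (Fintype.ofFinite X) x

theorem Multiset.nodup_enum [Finite X] : (Multiset.enum X).Nodup :=
  (@Finset.univ X (Fintype.ofFinite X)).nodup

theorem Multiset.eq_enum [Finite X] {m : Multiset X} (hm : m.Nodup) (h : ∀ x, x ∈ m) :
    m = Multiset.enum X :=
  (Multiset.Nodup.ext hm Multiset.nodup_enum).2 fun x => ⟨fun _ => Multiset.mem_enum x, fun _ => h x⟩

theorem Multiset.card_enum [Finite X] : (Multiset.enum X).card = Nat.card X := by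
  have := Fintype.ofFinite X
  rw [← Multiset.eq_enum (Finset.univ (α := X)).nodup (fun x => Finset.mem_univ x)]
  simp [Nat.card_eq_fintype_card]

theorem Multiset.count_map_enum [Finite X] [DecidableEq Y] (f : X → Y) (y : Y) :
    ((Multiset.enum X).map f).count y = Nat.card {x // f x = y} := by
  classical
  have := Fintype.ofFinite X
  rw [← Multiset.eq_enum (Finset.univ (α := X)).nodup (fun x => Finset.mem_univ x),
    Multiset.count_map, Nat.card_eq_fintype_card, Fintype.card_subtype]
  simp only [Finset.card, Finset.filter_val, eq_comm]

/-- Multiplicities are cardinalities of fibres, and bijections between the fibres assemble to one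
bijection. This converts equal descriptions of two diagrams into bijections of their vertices and of
their legs. -/
theorem Multiset.exists_equiv_of_map_enum_eq [Finite X] [Finite Y] {f : X → Z} {g : Y → Z}
    (h : (Multiset.enum X).map f = (Multiset.enum Y).map g) : ∃ e : X ≃ Y, ∀ x, g (e x) = f x := by
  classical
  have key : ∀ z, Nonempty ({x // f x = z} ≃ {y // g y = z}) := by
    intro z
    have := congrArg (Multiset.count z) h
    rw [Multiset.count_map_enum, Multiset.count_map_enum] at this
    exact (Finite.card_eq).1 this
  exact ⟨Equiv.ofFiberEquiv fun z => (key z).some, fun x => Equiv.ofFiberEquiv_map _ x⟩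

theorem Multiset.enum_eq_cons [Finite X] [DecidableEq X] (x : X) :
    Multiset.enum X = x ::ₘ (Multiset.enum X).erase x :=
  (Multiset.cons_erase (Multiset.mem_enum x)).symm

theorem Multiset.mem_erase_enum [Finite X] [DecidableEq X] {x y : X} :
    y ∈ (Multiset.enum X).erase x ↔ y ≠ x := by
  rw [Multiset.nodup_enum.mem_erase_iff]
  simp [Multiset.mem_enum]

theorem Multiset.map_enum_eq_cons [Finite X] [DecidableEq X] {f : X → Y} {y : Y} {m : Multiset Y}
    (h : (Multiset.enum X).map f = y ::ₘ m) :
    ∃ x, f x = y ∧ ((Multiset.enum X).erase x).map f = m := by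
  have hy : y ∈ (Multiset.enum X).map f := by rw [h]; exact Multiset.mem_cons_self _ _
  obtain ⟨x, -, hx⟩ := Multiset.mem_map.1 hy
  refine ⟨x, hx, ?_⟩
  rw [Multiset.enum_eq_cons x, Multiset.map_cons, hx] at h
  exact (Multiset.cons_inj_right _).1 h

end enumeration

namespace JacobiDiagram

variable {L ε : Type} {n : ℕ} {b : ℤ}

/-! ### Diagrams described by the names of their edges -/

/-- The names at a trivalent vertex. -/
def tripleOf {J : JacobiDiagram L} (ν : J.H → ε) (v : J.V) : ε × ε × ε :=
  (ν (.inl (v, 0)), ν (.inl (v, 1)), ν (.inl (v, 2)))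

/-- The edges of `J` are named by `ν`, the trivalent vertices are listed in `T` by the names of their
half-edges, and the legs are listed in `S` with their labels. -/
structure IsModel (J : JacobiDiagram L) (ν : J.H → ε) (T : Multiset (ε × ε × ε))
    (S : Multiset (ε × L)) : Prop where
  naming : ∀ h k, ν h = ν k ↔ k = h ∨ k = J.α h
  triples : (Multiset.enum J.V).map (tripleOf ν) = T
  legs : (Multiset.enum J.U).map (fun u => (ν (.inr u), J.label u)) = S

theorem IsModel.name_α {J : JacobiDiagram L} {ν : J.H → ε} {T : Multiset (ε × ε × ε)}
    {S : Multiset (ε × L)} (h : IsModel J ν T S) (k : J.H) : ν (J.α k) = ν k :=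
  ((h.naming _ _).2 (.inr rfl)).symm

theorem tripleOf_eq_iff {J : JacobiDiagram L} {ν : J.H → ε} {v : J.V} {a b c : ε} :
    tripleOf ν v = (a, b, c) ↔
      ν (.inl (v, 0)) = a ∧ ν (.inl (v, 1)) = b ∧ ν (.inl (v, 2)) = c := by
  simp [tripleOf]

/-- The bijections of vertices and legs preserve names, and a name determines its edge, so they
respect the edges as well. No rotation is needed because the triples are ordered. -/
theorem IsModel.iso {J K : JacobiDiagram L} {ν : J.H → ε} {μ : K.H → ε}
    {T : Multiset (ε × ε × ε)} {S : Multiset (ε × L)} (h : IsModel J ν T S) (h' : IsModel K μ T S) :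
    Nonempty (Iso J K) := by
  obtain ⟨eV, hV⟩ := Multiset.exists_equiv_of_map_enum_eq (h.triples.trans h'.triples.symm)
  obtain ⟨eU, hU⟩ := Multiset.exists_equiv_of_map_enum_eq (h.legs.trans h'.legs.symm)
  have key : ∀ k : J.H, μ (Sum.map (fun x => (eV x.1, x.2 + 0)) eU k) = ν k := by
    rintro (⟨v, i⟩ | u)
    · have := hV v
      rw [tripleOf, eq_comm, tripleOf_eq_iff] at this
      obtain ⟨h0, h1, h2⟩ := this
      fin_cases i
      · exact h0.symm
      · exact h1.symm
      · exact h2.symm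
    · exact congrArg Prod.fst (hU u)
  have inj : Function.Injective
      (Sum.map (fun x => (eV x.1, x.2 + 0)) eU : J.H → K.H) := by
    refine Function.Injective.sumMap ?_ eU.injective
    rintro ⟨v, i⟩ ⟨w, j⟩ e
    simpa using e
  refine ⟨⟨eV, eU, fun _ => 0, fun k => ?_, fun u => congrArg Prod.snd (hU u)⟩⟩
  have e1 : μ (Sum.map (fun x => (eV x.1, x.2 + 0)) eU k) =
      μ (Sum.map (fun x => (eV x.1, x.2 + 0)) eU (J.α k)) := by
    rw [key, key, h.name_α]
  -- The images of the two halves of an edge have the same name and differ by injectivity, so they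
  -- form an edge.
  rcases (h'.naming _ _).1 e1 with e | e
  · exact absurd (inj e) (J.α_ne k)
  · exact e.symm

open Classical in
/-- The class of the diagrams that are described by `T` and `S`. -/
noncomputable def ncl (n : ℕ) (b : ℤ) (T : Multiset (ε × ε × ε)) (S : Multiset (ε × L)) :
    JacobiModule L n b :=
  if h : ∃ (J : JacobiDiagram L) (ν : J.H → ε), IsModel J ν T S then h.choose.cl n b else 0

theorem IsModel.ncl_eq {J : JacobiDiagram L} {ν : J.H → ε} {T : Multiset (ε × ε × ε)}
    {S : Multiset (ε × L)} (h : IsModel J ν T S) : ncl n b T S = J.cl n b := by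
  have h' : ∃ (J : JacobiDiagram L) (ν : J.H → ε), IsModel J ν T S := ⟨J, ν, h⟩
  rw [ncl, dif_pos h']
  obtain ⟨μ, hμ⟩ := h'.choose_spec
  obtain ⟨e⟩ := hμ.iso h
  exact cl_iso e

theorem ncl_of_not {T : Multiset (ε × ε × ε)} {S : Multiset (ε × L)}
    (h : ¬ ∃ (J : JacobiDiagram L) (ν : J.H → ε), IsModel J ν T S) : ncl n b T S = 0 := dif_neg h

/-- Every diagram has a naming. -/
theorem exists_isModel (J : JacobiDiagram L) :
    IsModel J (fun h => s(h, J.α h)) ((Multiset.enum J.V).map (tripleOf fun h => s(h, J.α h)))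
      ((Multiset.enum J.U).map (fun u => (s(.inr u, J.α (.inr u)), J.label u))) := by
  refine ⟨fun h k => ?_, rfl, rfl⟩
  rw [Sym2.eq_iff]
  constructor
  · rintro (⟨rfl, -⟩ | ⟨-, rfl⟩)
    · exact .inl rfl
    · exact .inr rfl
  · rintro (rfl | rfl)
    · exact .inl ⟨rfl, rfl⟩
    · exact .inr ⟨(J.α_α _).symm, rfl⟩

/-! ### Effect of the local moves on the names -/

section moves

variable {J : JacobiDiagram L} {ν : J.H → ε} {T : Multiset (ε × ε × ε)} {S : Multiset (ε × L)}

theorem IsModel.exists_vertex {t : ε × ε × ε} (h : IsModel J ν (t ::ₘ T) S) [DecidableEq J.V] :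
    ∃ v, tripleOf ν v = t ∧ ((Multiset.enum J.V).erase v).map (tripleOf ν) = T :=
  Multiset.map_enum_eq_cons h.triples

theorem IsModel.exists_vertices {t t' : ε × ε × ε} (h : IsModel J ν (t ::ₘ t' ::ₘ T) S)
    [DecidableEq J.V] : ∃ v w, v ≠ w ∧ tripleOf ν v = t ∧ tripleOf ν w = t' ∧
      (((Multiset.enum J.V).erase v).erase w).map (tripleOf ν) = T := by
  obtain ⟨v, hv, hT⟩ := h.exists_vertex
  have : t' ∈ ((Multiset.enum J.V).erase v).map (tripleOf ν) := by
    rw [hT]; exact Multiset.mem_cons_self _ _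
  obtain ⟨w, hw, hwt⟩ := Multiset.mem_map.1 this
  refine ⟨v, w, (Multiset.mem_erase_enum.1 hw).symm, hv, hwt, ?_⟩
  rw [← Multiset.cons_erase hw, Multiset.map_cons, hwt] at hT
  exact (Multiset.cons_inj_right _).1 hT

/-- Reattaching the half-edges changes the names by the inverse permutation. -/
theorem IsModel.permute (h : IsModel J ν T S) (ρ : Equiv.Perm J.H)
    (hρ : ∀ u, ρ.symm (.inr u) = .inr u) {T' : Multiset (ε × ε × ε)}
    (hT : (Multiset.enum J.V).map (tripleOf (J := J) (ν ∘ ρ.symm)) = T') :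
    IsModel (J.permute ρ) (ν ∘ ρ.symm) T' S := by
  have key : ∀ k k' : J.H, ν (ρ.symm k) = ν (ρ.symm k') ↔ k' = k ∨ k' = ρ (J.α (ρ.symm k)) := by
    intro k k'
    rw [h.naming, ρ.symm.apply_eq_iff_eq, Equiv.symm_apply_eq]
  have leg : ∀ u : J.U, (ν (ρ.symm (.inr u)), J.label u) = (ν (.inr u), J.label u) := by
    intro u
    rw [hρ]
  refine ⟨key, hT, ?_⟩
  rw [← h.legs]
  exact Multiset.map_congr rfl fun u _ => leg u

theorem map_tripleOf_erase (ρ : Equiv.Perm J.H) (v : J.V) [DecidableEq J.V]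
    (hρ : ∀ w i, w ≠ v → ρ.symm (.inl (w, i)) = .inl (w, i)) :
    (Multiset.enum J.V).map (tripleOf (J := J) (ν ∘ ρ.symm)) =
      tripleOf (J := J) (ν ∘ ρ.symm) v ::ₘ ((Multiset.enum J.V).erase v).map (tripleOf ν) := by
  rw [Multiset.enum_eq_cons v, Multiset.map_cons, Multiset.erase_cons_head]
  congr 1
  refine Multiset.map_congr rfl fun w hw => ?_
  have := Multiset.mem_erase_enum.1 hw
  simp [tripleOf, hρ w _ this]

theorem map_tripleOf_erase_erase (ρ : Equiv.Perm J.H) {v w : J.V} (hvw : v ≠ w) [DecidableEq J.V]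
    (hρ : ∀ x i, x ≠ v → x ≠ w → ρ.symm (.inl (x, i)) = .inl (x, i)) :
    (Multiset.enum J.V).map (tripleOf (J := J) (ν ∘ ρ.symm)) =
      tripleOf (J := J) (ν ∘ ρ.symm) v ::ₘ tripleOf (J := J) (ν ∘ ρ.symm) w ::ₘ
        (((Multiset.enum J.V).erase v).erase w).map (tripleOf ν) := by
  have hw : w ∈ (Multiset.enum J.V).erase v := Multiset.mem_erase_enum.2 hvw.symm
  conv_lhs => rw [Multiset.enum_eq_cons v, ← Multiset.cons_erase hw, Multiset.map_cons,
    Multiset.map_cons]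
  congr 2
  refine Multiset.map_congr rfl fun x hx => ?_
  rw [(Multiset.nodup_enum.erase v).mem_erase_iff] at hx
  have := Multiset.mem_erase_enum.1 hx.2
  simp [tripleOf, hρ x _ this hx.1]

/-- Rotating the half-edges at a vertex. -/
def rotPerm (J : JacobiDiagram L) (r : J.V → Fin 3) : Equiv.Perm J.H :=
  Equiv.sumCongr (Equiv.prodShear (Equiv.refl _) fun v => Equiv.addRight (r v)) (Equiv.refl _)

/-- Rotations do not change the isomorphism class. -/
def isoRotPerm (J : JacobiDiagram L) (r : J.V → Fin 3) : Iso J (J.permute (J.rotPerm r)) where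
  eV := Equiv.refl _
  eU := Equiv.refl _
  rot := r
  α_comm h := by
    have key : ∀ k : J.H, Sum.map (fun x => (Equiv.refl J.V x.1, x.2 + r x.1)) (Equiv.refl J.U) k =
        J.rotPerm r k := by
      rintro (⟨v, i⟩ | u) <;> rfl
    change J.rotPerm r (J.α ((J.rotPerm r).symm (Sum.map (fun x => (Equiv.refl J.V x.1,
      x.2 + r x.1)) (Equiv.refl J.U) h))) = Sum.map (fun x => (Equiv.refl J.V x.1,
      x.2 + r x.1)) (Equiv.refl J.U) (J.α h)
    rw [key, key, Equiv.symm_apply_apply]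
  label_comm _ := rfl

theorem IsModel.rot {a c d : ε} (h : IsModel J ν ((a, c, d) ::ₘ T) S) :
    ∃ (K : JacobiDiagram L) (μ : K.H → ε), Nonempty (Iso J K) ∧ IsModel K μ ((c, d, a) ::ₘ T) S := by
  classical
  obtain ⟨v, hv, hT⟩ := h.exists_vertex
  rw [tripleOf_eq_iff] at hv
  obtain ⟨h0, h1, h2⟩ := hv
  -- Rotating by `2` puts at position `i` the name that was at `i - 2 = i + 1`.
  set r : J.V → Fin 3 := Pi.single v 2 with hr
  have hsymm : ∀ w i, (J.rotPerm r).symm (.inl (w, i)) = .inl (w, i - r w) := by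
    intro w i
    rw [Equiv.symm_apply_eq]
    change _ = Sum.inl (w, i - r w + r w)
    simp
  refine ⟨_, _, ⟨J.isoRotPerm r⟩, h.permute (J.rotPerm r) (fun u => rfl) ?_⟩
  rw [map_tripleOf_erase _ v, hT]
  · congr 1
    rw [tripleOf_eq_iff]
    have hrv : r v = 2 := Pi.single_eq_same v 2
    simp only [Function.comp_apply, hsymm, hrv]
    exact ⟨h1, h2, h0⟩
  · intro w i hw
    rw [hsymm, hr, Pi.single_eq_of_ne hw, sub_zero]

theorem IsModel.flip {a c d : ε} (h : IsModel J ν ((a, c, d) ::ₘ T) S) :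
    ∃ (v : J.V) (μ : J.H → ε), IsModel (J.permute (J.asPerm v)) μ ((a, d, c) ::ₘ T) S := by
  classical
  obtain ⟨v, hv, hT⟩ := h.exists_vertex
  rw [tripleOf_eq_iff] at hv
  obtain ⟨h0, h1, h2⟩ := hv
  have hsymm : (J.asPerm v).symm = J.asPerm v := by
    unfold asPerm; exact Equiv.symm_swap _ _
  refine ⟨v, ν ∘ (J.asPerm v).symm, h.permute (J.asPerm v) (fun u => ?_) ?_⟩
  · rw [hsymm]; exact Equiv.swap_apply_of_ne_of_ne (by simp) (by simp)
  rw [map_tripleOf_erase _ v, hT]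
  · congr 1
    rw [tripleOf_eq_iff, hsymm]
    simp only [Function.comp_apply, asPerm, Equiv.swap_apply_left, Equiv.swap_apply_right]
    rw [Equiv.swap_apply_of_ne_of_ne (by simp) (by simp)]
    exact ⟨h0, h2, h1⟩
  · intro w i hw
    rw [hsymm]; exact Equiv.swap_apply_of_ne_of_ne (by simp [hw]) (by simp [hw])

theorem ihxPerm_apply {v w : J.V} (hvw : v ≠ w) (i j : Fin 3) :
    J.ihxPerm v w i j (.inl (v, i + 1)) = .inl (v, i + 2) ∧
    J.ihxPerm v w i j (.inl (v, i + 2)) = .inl (w, j + 1) ∧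
    J.ihxPerm v w i j (.inl (w, j + 1)) = .inl (v, i + 1) ∧
    J.ihxPerm v w i j (.inl (w, j + 2)) = .inl (w, j + 2) := by
  simp [ihxPerm, Equiv.Perm.mul_apply, Equiv.swap_apply_def, hvw, hvw.symm]

theorem ihxPerm_apply_of_ne {v w x : J.V} (hv : x ≠ v) (hw : x ≠ w) (i j k : Fin 3) :
    J.ihxPerm v w i j (.inl (x, k)) = .inl (x, k) := by
  simp [ihxPerm, Equiv.Perm.mul_apply, Equiv.swap_apply_def, hv, hw]

theorem ihxPerm_apply_inr {v w : J.V} (i j : Fin 3) (u : J.U) :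
    J.ihxPerm v w i j (.inr u) = .inr u := by
  simp [ihxPerm, Equiv.Perm.mul_apply, Equiv.swap_apply_def]

/-- The permutation fixes both halves of the edge `e` and the half-edge named `d`, so only the names
`a`, `b`, `c` travel, in one direction for the permutation and in the other for its inverse. -/
theorem IsModel.ihx {e a b c d : ε} (h : IsModel J ν ((e, a, b) ::ₘ (e, c, d) ::ₘ T) S) :
    ∃ (v w : J.V) (μ μ' : J.H → ε), v ≠ w ∧ J.α (.inl (v, 0)) = .inl (w, 0) ∧
      IsModel (J.permute (J.ihxPerm v w 0 0)) μ ((e, c, a) ::ₘ (e, b, d) ::ₘ T) S ∧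
      IsModel (J.permute (J.ihxPerm v w 0 0)⁻¹) μ' ((e, b, c) ::ₘ (e, a, d) ::ₘ T) S := by
  classical
  obtain ⟨v, w, hvw, hv, hw, hT⟩ := h.exists_vertices
  rw [tripleOf_eq_iff] at hv hw
  obtain ⟨h0, h1, h2⟩ := hv
  obtain ⟨k0, k1, k2⟩ := hw
  obtain ⟨p0, q0⟩ := J.ihxPerm_fix hvw 0 0
  obtain ⟨p1, p2, q1, q2⟩ := ihxPerm_apply hvw 0 0
  simp only [zero_add] at p1 p2 q1 q2
  refine ⟨v, w, ν ∘ (J.ihxPerm v w 0 0).symm, ν ∘ (J.ihxPerm v w 0 0), hvw, ?_, ?_, ?_⟩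
  -- The name `e` occurs at two different vertices, so its half-edges there form the edge to which
  -- IHX is applied.
  · rcases (h.naming (.inl (v, 0)) (.inl (w, 0))).1 (h0.trans k0.symm) with e | e
    · simp at e; exact absurd e.symm hvw
    · exact e.symm
  · refine h.permute _ (fun u => (Equiv.symm_apply_eq _).2 (ihxPerm_apply_inr 0 0 u).symm) ?_
    rw [map_tripleOf_erase_erase _ hvw, hT]
    · congr 1
      · rw [tripleOf_eq_iff]
        simp only [Function.comp_apply, (Equiv.symm_apply_eq _).2 p0.symm,
          (Equiv.symm_apply_eq _).2 p1.symm, (Equiv.symm_apply_eq _).2 q1.symm]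
        exact ⟨h0, k1, h1⟩
      · congr 1
        rw [tripleOf_eq_iff]
        simp only [Function.comp_apply, (Equiv.symm_apply_eq _).2 q0.symm,
          (Equiv.symm_apply_eq _).2 p2.symm, (Equiv.symm_apply_eq _).2 q2.symm]
        exact ⟨k0, h2, k2⟩
    · intro x i hx hx'
      exact (Equiv.symm_apply_eq _).2 (ihxPerm_apply_of_ne hx hx' 0 0 i).symm
  · refine h.permute (J.ihxPerm v w 0 0)⁻¹ (fun u => ihxPerm_apply_inr 0 0 u) ?_
    rw [map_tripleOf_erase_erase _ hvw, hT]
    · congr 1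
      · rw [tripleOf_eq_iff]
        change ν (J.ihxPerm v w 0 0 _) = _ ∧ ν (J.ihxPerm v w 0 0 _) = _ ∧
          ν (J.ihxPerm v w 0 0 _) = _
        rw [p0, p1, p2]
        exact ⟨h0, h2, k1⟩
      · congr 1
        rw [tripleOf_eq_iff]
        change ν (J.ihxPerm v w 0 0 _) = _ ∧ ν (J.ihxPerm v w 0 0 _) = _ ∧
          ν (J.ihxPerm v w 0 0 _) = _
        rw [q0, q1, q2]
        exact ⟨k0, h1, k2⟩
    · intro x i hx hx'
      exact ihxPerm_apply_of_ne hx hx' 0 0 i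

end moves

/-! ### AS, IHX and renaming as rules for descriptions -/

section relations

variable {T : Multiset (ε × ε × ε)} {S : Multiset (ε × L)}

theorem ncl_rot (a c d : ε) : ncl n b ((a, c, d) ::ₘ T) S = ncl n b ((c, d, a) ::ₘ T) S := by
  by_cases h : ∃ (J : JacobiDiagram L) (ν : J.H → ε), IsModel J ν ((a, c, d) ::ₘ T) S
  · obtain ⟨J, ν, h⟩ := h
    obtain ⟨K, μ, ⟨e⟩, h'⟩ := h.rot
    rw [h.ncl_eq, h'.ncl_eq, cl_iso e]
  · rw [ncl_of_not h, ncl_of_not]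
    rintro ⟨J, ν, h'⟩
    -- Two more rotations lead back to the original triple.
    obtain ⟨K, μ, -, h2⟩ := h'.rot
    obtain ⟨K', μ', -, h3⟩ := h2.rot
    exact h ⟨_, _, h3⟩

theorem ncl_flip (a c d : ε) : ncl n b ((a, c, d) ::ₘ T) S = - ncl n b ((a, d, c) ::ₘ T) S := by
  by_cases h : ∃ (J : JacobiDiagram L) (ν : J.H → ε), IsModel J ν ((a, c, d) ::ₘ T) S
  · obtain ⟨J, ν, h⟩ := h
    obtain ⟨v, μ, h'⟩ := h.flip
    rw [h.ncl_eq, h'.ncl_eq, eq_neg_iff_add_eq_zero, cl_flip]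
  · rw [ncl_of_not h, ncl_of_not, neg_zero]
    rintro ⟨J, ν, h'⟩
    obtain ⟨v, μ, h2⟩ := h'.flip
    exact h ⟨_, _, h2⟩

/-- Any of the three descriptions is carried to the other two by IHX moves, so either all of them
come from diagrams or none does. -/
theorem ncl_ihx (e a c d f : ε) :
    ncl n b ((e, a, c) ::ₘ (e, d, f) ::ₘ T) S + ncl n b ((e, c, d) ::ₘ (e, a, f) ::ₘ T) S +
      ncl n b ((e, d, a) ::ₘ (e, c, f) ::ₘ T) S = 0 := by
  by_cases h : ∃ (J : JacobiDiagram L) (ν : J.H → ε),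
    IsModel J ν ((e, a, c) ::ₘ (e, d, f) ::ₘ T) S
  · obtain ⟨J, ν, h⟩ := h
    obtain ⟨v, w, μ, μ', hvw, he, h1, h2⟩ := h.ihx
    rw [h.ncl_eq, h1.ncl_eq, h2.ncl_eq, add_right_comm, cl_ihx J hvw he]
  · rw [ncl_of_not h, ncl_of_not, ncl_of_not, add_zero, add_zero]
    · rintro ⟨J, ν, h'⟩
      obtain ⟨v, w, μ, μ', -, -, h1, h2⟩ := h'.ihx
      exact h ⟨_, _, h2⟩
    · rintro ⟨J, ν, h'⟩
      obtain ⟨v, w, μ, μ', -, -, h1, h2⟩ := h'.ihx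
      exact h ⟨_, _, h1⟩

theorem IsModel.rename {J : JacobiDiagram L} {ν : J.H → ε} (h : IsModel J ν T S)
    {ε' : Type} {f : ε → ε'} (hf : Function.Injective f) :
    IsModel J (f ∘ ν) (T.map (Prod.map f (Prod.map f f))) (S.map (Prod.map f id)) := by
  refine ⟨fun k k' => ?_, ?_, ?_⟩
  · rw [Function.comp_apply, Function.comp_apply, hf.eq_iff, h.naming]
  · rw [← h.triples, Multiset.map_map]; rfl
  · rw [← h.legs, Multiset.map_map]; rfl

/-- A permutation is used rather than an injection so that a diagram for the renamed description can
be transported back. -/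
theorem ncl_rename (f : Equiv.Perm ε) :
    ncl n b (T.map (Prod.map f (Prod.map f f))) (S.map (Prod.map f id)) = ncl n b T S := by
  by_cases h : ∃ (J : JacobiDiagram L) (ν : J.H → ε), IsModel J ν T S
  · obtain ⟨J, ν, h⟩ := h
    rw [h.ncl_eq, (h.rename f.injective).ncl_eq]
  · rw [ncl_of_not h, ncl_of_not]
    rintro ⟨J, ν, h'⟩
    have := h'.rename f.symm.injective
    refine h ⟨J, f.symm ∘ ν, ?_⟩
    · convert this using 1
      · rw [Multiset.map_map]; convert (Multiset.map_id _).symm using 2; ext <;> simp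
      · rw [Multiset.map_map]; convert (Multiset.map_id _).symm using 2; ext <;> simp

end relations

/-! ### Names and connectedness -/

section names

variable {T : Multiset (ε × ε × ε)} {S : Multiset (ε × L)} {J : JacobiDiagram L} {ν : J.H → ε}

/-- All names, with multiplicity. -/
def names (T : Multiset (ε × ε × ε)) (S : Multiset (ε × L)) : Multiset ε :=
  T.bind (fun t => {t.1, t.2.1, t.2.2}) + S.map Prod.fst

theorem IsModel.names_eq (h : IsModel J ν T S) : names T S = (Multiset.enum J.H).map ν := by
  have : (Multiset.enum J.V).bind (fun v => ({.inl (v, 0), .inl (v, 1), .inl (v, 2)} :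
      Multiset J.H)) + (Multiset.enum J.U).map Sum.inr = Multiset.enum J.H := by
    apply Multiset.eq_enum
    · rw [Multiset.nodup_add]
      refine ⟨?_, Multiset.nodup_enum.map Sum.inr_injective, ?_⟩
      · rw [Multiset.nodup_bind]
        refine ⟨fun v _ => by simp, ?_⟩
        refine Multiset.nodup_enum.pairwise fun v _ w _ hvw => ?_
        simp [Function.onFun, Multiset.disjoint_left, hvw]
      · simp [Multiset.disjoint_left]
    · rintro (⟨v, i⟩ | u)
      · refine Multiset.mem_add.2 (.inl (Multiset.mem_bind.2 ⟨v, Multiset.mem_enum v, ?_⟩))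
        fin_cases i <;> simp
      · exact Multiset.mem_add.2 (.inr (Multiset.mem_map.2 ⟨u, Multiset.mem_enum u, rfl⟩))
  rw [names, ← this, ← h.triples, ← h.legs, Multiset.map_add, Multiset.map_bind,
    Multiset.bind_map, Multiset.map_map, Multiset.map_map]
  rfl

/-- The fibre of the naming over a name consists of the two halves of an edge, which are distinct.
-/
theorem IsModel.count_names [DecidableEq ε] (h : IsModel J ν T S) {x : ε} (hx : x ∈ names T S) :
    (names T S).count x = 2 := by
  classical
  rw [h.names_eq] at hx ⊢
  obtain ⟨k, -, rfl⟩ := Multiset.mem_map.1 hx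
  rw [Multiset.count_map_enum]
  have : {x // ν x = ν k} = ({k, J.α k} : Set J.H) := by
    congr 1; ext x; rw [eq_comm, h.naming]; rfl
  rw [this]
  have := Set.ncard_pair (J.α_ne k).symm
  exact this

/-- At every vertex all names or none belong to `A`, and the halves of an edge share their name, so
`A` cuts out a union of components. -/
theorem IsModel.mem_of_connected (h : IsModel J ν T S) (hJ : J.Connected) (A : Set ε)
    (hA : ∀ t ∈ T, (t.1 ∈ A ↔ t.2.1 ∈ A) ∧ (t.1 ∈ A ↔ t.2.2 ∈ A)) {t : ε × ε × ε} (ht : t ∈ T)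
    (htA : t.1 ∈ A) : (∀ t ∈ T, t.1 ∈ A) ∧ ∀ s ∈ S, s.1 ∈ A := by
  have hv : ∀ v i, ν (.inl (v, i)) ∈ A ↔ ν (.inl (v, 0)) ∈ A := by
    intro v i
    have := hA (tripleOf ν v) (by rw [← h.triples]; exact Multiset.mem_map_of_mem _ (Multiset.mem_enum v))
    fin_cases i
    · rfl
    · exact this.1.symm
    · exact this.2.symm
  let P : J.V ⊕ J.U → Prop := Sum.elim (fun v => ν (.inl (v, 0)) ∈ A) (fun u => ν (.inr u) ∈ A)
  have hP : ∀ k : J.H, P (J.vert k) ↔ ν k ∈ A := by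
    rintro (⟨v, i⟩ | u)
    · exact (hv v i).symm
    · rfl
  have key : ∀ x y, J.graph.Reachable x y → P x → P y := by
    rintro x y ⟨p⟩
    induction p with
    | nil => exact id
    | cons hadj _ ih =>
      refine fun hx => ih ?_
      rcases ((SimpleGraph.fromRel_adj _ _ _).1 hadj).2 with ⟨k, rfl, rfl⟩ | ⟨k, rfl, rfl⟩
      · rwa [hP, h.name_α, ← hP]
      · rwa [hP, h.name_α, ← hP] at hx
  rw [← h.triples] at ht
  obtain ⟨v, -, rfl⟩ := Multiset.mem_map.1 ht
  have hJ' : J.graph.Connected := hJ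
  have all : ∀ y, P y := fun y => key (.inl v) y (hJ'.preconnected _ _) htA
  constructor
  · intro t ht
    rw [← h.triples] at ht
    obtain ⟨w, -, rfl⟩ := Multiset.mem_map.1 ht
    exact all (.inl w)
  · intro s hs
    rw [← h.legs] at hs
    obtain ⟨u, -, rfl⟩ := Multiset.mem_map.1 hs
    exact all (.inr u)

/-- The half-edges carry a fixed-point free involution. -/
theorem even_card_H (J : JacobiDiagram L) : Even (Nat.card J.V * 3 + Nat.card J.U) := by
  classical
  have h : Nat.card J.H = Nat.card J.V * 3 + Nat.card J.U := by
    rw [H, Nat.card_sum, Nat.card_prod, Nat.card_fin]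
  have := Fintype.ofFinite J.H
  rw [← h, Nat.card_eq_fintype_card, even_iff_two_dvd, ← Nat.modEq_zero_iff_dvd]
  have key := Equiv.Perm.card_fixedPoints_modEq (f := (J.α : Function.End J.H)) (p := 2) (n := 1)
    (by funext x; exact J.α_α x)
  have : IsEmpty (Function.fixedPoints (J.α : Function.End J.H)) := ⟨fun x => J.α_ne x.1 x.2⟩
  rwa [Fintype.card_eq_zero_iff.2 this] at key

/-- Counting half-edges gives `2E = 3n + |S|`, to be combined with `b = E - (n + |S|) + 1`. The
parity is what makes the division by two in `numEdges` exact. -/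
theorem IsModel.card_of_isConn (h : IsModel J ν T S) (hJ : J.IsConn n b) :
    T.card = n ∧ (n : ℤ) = S.card + 2 * (b - 1) := by
  have hT : T.card = Nat.card J.V := by rw [← h.triples, Multiset.card_map, Multiset.card_enum]
  have hS : S.card = Nat.card J.U := by rw [← h.legs, Multiset.card_map, Multiset.card_enum]
  obtain ⟨m, hm⟩ := J.even_card_H
  have h1 := hJ.2.1
  have h2 := hJ.2.2
  rw [loopNumber_eq, hm] at h2
  rw [iDeg] at h1
  refine ⟨by omega, ?_⟩
  rw [← h2]
  omega

end names

end JacobiDiagram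

namespace JacobiDiagram

variable {L ε : Type} {n : ℕ} {b : ℤ}

/-! ### The names of a blow-up -/

section blowUp

variable {J : JacobiDiagram L} {ν : J.H → ε} {T : Multiset (ε × ε × ε)} {S : Multiset (ε × L)}

/-- The names in the blow-up at `v`, with new names `x` for the sides of the triangle. -/
def blowUpName (J : JacobiDiagram L) (ν : J.H → ε) (v : J.V) (x : Fin 3 → ε) :
    (({w : J.V // w ≠ v} ⊕ Fin 3) × Fin 3) ⊕ J.U → ε
  | .inl (.inl w, i) => ν (.inl (w.1, i))
  | .inl (.inr i, 0) => ν (.inl (v, i))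
  | .inl (.inr i, 1) => x i
  | .inl (.inr i, 2) => x (i + 2)
  | .inr u => ν (.inr u)

theorem blowUpName_emb (v : J.V) (x : Fin 3 → ε) (k : J.H) :
    J.blowUpName ν v x (J.blowUpEmb v k) = ν k := by
  rcases k with ⟨w, i⟩ | u
  · by_cases hw : w = v
    · subst hw; simp [blowUpEmb, blowUpName]
    · simp [blowUpEmb, blowUpName, hw]
  · rfl

theorem enum_blowUp (v : J.V) [DecidableEq J.V] {Y : Type} (f : {w : J.V // w ≠ v} ⊕ Fin 3 → Y)
    (g : J.V → Y) (hg : ∀ w, f (.inl w) = g w.1) :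
    (Multiset.enum ({w : J.V // w ≠ v} ⊕ Fin 3)).map f =
      f (.inr 0) ::ₘ f (.inr 1) ::ₘ f (.inr 2) ::ₘ ((Multiset.enum J.V).erase v).map g := by
  have h : (Multiset.enum J.V).erase v = (Multiset.enum {w : J.V // w ≠ v}).map Subtype.val := by
    refine (Multiset.Nodup.ext (Multiset.nodup_enum.erase v)
      (Multiset.nodup_enum.map Subtype.val_injective)).2 fun w => ?_
    rw [Multiset.mem_erase_enum]
    constructor
    · exact fun hw => Multiset.mem_map.2 ⟨⟨w, hw⟩, Multiset.mem_enum _, rfl⟩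
    · rintro hw
      obtain ⟨w', -, rfl⟩ := Multiset.mem_map.1 hw
      exact w'.2
  have h2 : (.inr 0 ::ₘ .inr 1 ::ₘ .inr 2 ::ₘ (Multiset.enum {w : J.V // w ≠ v}).map .inl :
      Multiset ({w : J.V // w ≠ v} ⊕ Fin 3)) = Multiset.enum _ := by
    apply Multiset.eq_enum
    · simp [Multiset.nodup_enum.map Sum.inl_injective]
    · rintro (w | i)
      · simp [Multiset.mem_enum]
      · fin_cases i <;> simp
  rw [← h2, h]
  simp only [Multiset.map_cons, Multiset.map_map]
  congr 4
  funext w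
  exact hg w

theorem IsModel.blowUp (h : IsModel J ν T S) (v : J.V) [DecidableEq J.V] (x : Fin 3 → ε)
    (hx : Function.Injective x) (hν : ∀ i k, x i ≠ ν k) :
    IsModel (J.blowUp v) (J.blowUpName ν v x)
      ((ν (.inl (v, 0)), x 0, x 2) ::ₘ (ν (.inl (v, 1)), x 1, x 0) ::ₘ (ν (.inl (v, 2)), x 2, x 1) ::ₘ
        ((Multiset.enum J.V).erase v).map (tripleOf ν)) S := by
  refine ⟨?_, enum_blowUp v _ (tripleOf ν) (fun w => rfl), h.legs⟩
  have key : ∀ k k' : (({w : J.V // w ≠ v} ⊕ Fin 3) × Fin 3) ⊕ J.U,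
      J.blowUpName ν v x k = J.blowUpName ν v x k' ↔ k' = k ∨ k' = J.blowUpα v k := by
    intro k k'
    rcases J.blowUp_cases v k with ⟨a, rfl⟩ | ⟨i, rfl⟩ | ⟨i, rfl⟩ <;>
    rcases J.blowUp_cases v k' with ⟨a', rfl⟩ | ⟨i', rfl⟩ | ⟨i', rfl⟩
    · rw [blowUpName_emb, blowUpName_emb, blowUpα_emb, (J.blowUpEmb_injective v).eq_iff,
        (J.blowUpEmb_injective v).eq_iff, h.naming]
    · rw [blowUpName_emb, blowUpα_emb]
      refine iff_of_false (fun e => hν _ _ e.symm) ?_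
      rintro (e | e) <;>
      · have := congrArg (J.blowUpName ν v x) e
        rw [blowUpName_emb] at this
        exact hν _ _ this
    · rw [blowUpName_emb, blowUpα_emb]
      refine iff_of_false (fun e => hν _ _ e.symm) ?_
      rintro (e | e) <;>
      · have := congrArg (J.blowUpName ν v x) e
        rw [blowUpName_emb] at this
        exact hν _ _ this
    · rw [blowUpName_emb]
      refine iff_of_false (fun e => hν _ _ e) ?_
      rintro (e | e) <;>
      · have := congrArg (J.blowUpName ν v x) e
        rw [blowUpName_emb] at this
        exact hν _ _ this.symm
    · simp only [blowUpName, blowUpα, hx.eq_iff]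
      simp [eq_comm]
    · simp only [blowUpName, blowUpα, hx.eq_iff]
      revert i i'; clear * -; simp; decide
    · rw [blowUpName_emb]
      refine iff_of_false (fun e => hν _ _ e) ?_
      rintro (e | e) <;>
      · have := congrArg (J.blowUpName ν v x) e
        rw [blowUpName_emb] at this
        exact hν _ _ this.symm
    · simp only [blowUpName, blowUpα, hx.eq_iff]
      revert i i'; clear * -; simp; decide
    · simp only [blowUpName, blowUpα, hx.eq_iff]
      simp [eq_comm]
  exact key

theorem IsModel.exists_blowUp (h : IsModel J ν T S) (v : J.V) [DecidableEq J.V] (i : Fin 3)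
    {x y z : ε} (hxy : x ≠ y) (hyz : y ≠ z) (hxz : x ≠ z) (hx : ∀ k, x ≠ ν k) (hy : ∀ k, y ≠ ν k)
    (hz : ∀ k, z ≠ ν k) : ∃ μ, IsModel (J.blowUp v) μ
      ((ν (.inl (v, i)), x, z) ::ₘ (ν (.inl (v, i + 1)), y, x) ::ₘ (ν (.inl (v, i + 2)), z, y) ::ₘ
        ((Multiset.enum J.V).erase v).map (tripleOf ν)) S := by
  have inj : ∀ {x y z : ε}, x ≠ y → y ≠ z → x ≠ z → Function.Injective ![x, y, z] := by
    intro x y z h1 h2 h3 i j e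
    fin_cases i <;> fin_cases j <;> simp_all
  have fresh : ∀ {x y z : ε}, (∀ k, x ≠ ν k) → (∀ k, y ≠ ν k) → (∀ k, z ≠ ν k) →
      ∀ i k, ![x, y, z] i ≠ ν k := by
    intro x y z h1 h2 h3 i k
    fin_cases i
    · exact h1 k
    · exact h2 k
    · exact h3 k
  fin_cases i
  · exact ⟨_, h.blowUp v ![x, y, z] (inj hxy hyz hxz) (fresh hx hy hz)⟩
  -- The names of the sides are shifted together with `i`, so that the corner at the half-edge `i`
  -- always carries `x` and `z`.
  · refine ⟨J.blowUpName ν v ![z, x, y], ?_⟩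
    convert h.blowUp v ![z, x, y] (inj hxz.symm hxy hyz.symm) (fresh hz hx hy) using 1
    rw [Multiset.cons_swap (ν (.inl (v, 0)), _), Multiset.cons_swap (ν (.inl (v, 0)), _)]
    rfl
  · refine ⟨J.blowUpName ν v ![y, z, x], ?_⟩
    convert h.blowUp v ![y, z, x] (inj hyz hxz.symm hxy.symm) (fresh hy hz hx) using 1
    rw [Multiset.cons_swap (ν (.inl (v, 1)), _), Multiset.cons_swap (ν (.inl (v, 0)), _)]
    rfl

end blowUp

/-! ### Squares -/

section square

variable {R : Multiset (ε × ε × ε)} {S : Multiset (ε × L)}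

theorem ncl_rename_of_fix (f : Equiv.Perm ε) (T : Multiset (ε × ε × ε))
    (hR : ∀ t ∈ R, f t.1 = t.1 ∧ f t.2.1 = t.2.1 ∧ f t.2.2 = t.2.2) (hS : ∀ s ∈ S, f s.1 = s.1) :
    ncl n b (T.map (Prod.map f (Prod.map f f)) + R) S = ncl n b (T + R) S := by
  rw [← ncl_rename (T := T + R) f, Multiset.map_add]
  congr 2
  · conv_lhs => rw [← Multiset.map_id R]
    refine Multiset.map_congr rfl fun t ht => ?_
    obtain ⟨h1, h2, h3⟩ := hR t ht
    simp [Prod.ext_iff, h1, h2, h3]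
  · conv_lhs => rw [← Multiset.map_id S]
    refine Multiset.map_congr rfl fun t ht => ?_
    simp [Prod.ext_iff, hS t ht]

theorem ncl_flip₂ (t : ε × ε × ε) (a c d : ε) :
    ncl n b (t ::ₘ (a, c, d) ::ₘ R) S = - ncl n b (t ::ₘ (a, d, c) ::ₘ R) S := by
  rw [Multiset.cons_swap, ncl_flip, Multiset.cons_swap]

theorem ncl_flip₃ (t t' : ε × ε × ε) (a c d : ε) :
    ncl n b (t ::ₘ t' ::ₘ (a, c, d) ::ₘ R) S = - ncl n b (t ::ₘ t' ::ₘ (a, d, c) ::ₘ R) S := by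
  rw [Multiset.cons_swap t', ncl_flip₂, Multiset.cons_swap t']

theorem ncl_flip₄ (t t' t'' : ε × ε × ε) (a c d : ε) :
    ncl n b (t ::ₘ t' ::ₘ t'' ::ₘ (a, c, d) ::ₘ R) S =
      - ncl n b (t ::ₘ t' ::ₘ t'' ::ₘ (a, d, c) ::ₘ R) S := by
  rw [Multiset.cons_swap t'', ncl_flip₃, Multiset.cons_swap t'']

theorem ncl_rot₂ (t : ε × ε × ε) (a c d : ε) :
    ncl n b (t ::ₘ (a, c, d) ::ₘ R) S = ncl n b (t ::ₘ (c, d, a) ::ₘ R) S := by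
  rw [Multiset.cons_swap, ncl_rot, Multiset.cons_swap]

theorem ncl_rot₃ (t u : ε × ε × ε) (a c d : ε) :
    ncl n b (t ::ₘ u ::ₘ (a, c, d) ::ₘ R) S = ncl n b (t ::ₘ u ::ₘ (c, d, a) ::ₘ R) S := by
  rw [Multiset.cons_swap u, ncl_rot₂, Multiset.cons_swap u]

/-- `x, y, z, e` are distinct names that occur neither in `R` nor in `S`. -/
structure Fresh (x y z e : ε) (R : Multiset (ε × ε × ε)) (S : Multiset (ε × L)) : Prop where
  xy : x ≠ y
  xz : x ≠ z
  xe : x ≠ e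
  yz : y ≠ z
  ye : y ≠ e
  ze : z ≠ e
  hR : ∀ t ∈ R, ∀ k ∈ ({t.1, t.2.1, t.2.2} : Set ε), k ≠ x ∧ k ≠ y ∧ k ≠ z ∧ k ≠ e
  hS : ∀ s ∈ S, s.1 ≠ x ∧ s.1 ≠ y ∧ s.1 ≠ z ∧ s.1 ≠ e

theorem Fresh.rename {x y z e : ε} (h : Fresh x y z e R S) (f : Equiv.Perm ε)
    (hf : ∀ k, k ≠ x → k ≠ y → k ≠ z → k ≠ e → f k = k) (T : Multiset (ε × ε × ε)) :
    ncl n b (T.map (Prod.map f (Prod.map f f)) + R) S = ncl n b (T + R) S := by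
  refine ncl_rename_of_fix f T (fun t ht => ?_) (fun s hs => ?_)
  · have key : ∀ k ∈ ({t.1, t.2.1, t.2.2} : Set ε), f k = k := fun k hk => by
      obtain ⟨h1, h2, h3, h4⟩ := h.hR t ht k hk
      exact hf k h1 h2 h3 h4
    exact ⟨key _ (by simp), key _ (by simp), key _ (by simp)⟩
  · obtain ⟨h1, h2, h3, h4⟩ := h.hS s hs
    exact hf _ h1 h2 h3 h4

/-- A square with outer edges `p, q, r, s`. -/
noncomputable def square (n : ℕ) (b : ℤ) (x y z e : ε) (R : Multiset (ε × ε × ε)) (S : Multiset (ε × L))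
    (p q r s : ε) : JacobiModule L n b :=
  ncl n b ((p, x, y) ::ₘ (q, y, z) ::ₘ (r, z, e) ::ₘ (s, e, x) ::ₘ R) S

/-- `k` is none of the names `x, y, z, e`. -/
def Avoids (x y z e k : ε) : Prop := k ≠ x ∧ k ≠ y ∧ k ≠ z ∧ k ≠ e

variable {x y z e : ε} {p q r s : ε}

/-- Renaming the sides along `x → y → z → e → x` turns the square; no cyclic order is changed. -/
theorem square_rot (h : Fresh x y z e R S) (hp : Avoids x y z e p) (hq : Avoids x y z e q)
    (hr : Avoids x y z e r) (hs : Avoids x y z e s) :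
    square n b x y z e R S p q r s = square n b x y z e R S q r s p := by
  classical
  obtain ⟨p1, p2, p3, p4⟩ := hp
  obtain ⟨q1, q2, q3, q4⟩ := hq
  obtain ⟨r1, r2, r3, r4⟩ := hr
  obtain ⟨s1, s2, s3, s4⟩ := hs
  have := h.rename (n := n) (b := b)
    (Equiv.swap x y * Equiv.swap y z * Equiv.swap z e) (fun k h1 h2 h3 h4 => by
    simp [Equiv.Perm.mul_apply, Equiv.swap_apply_of_ne_of_ne, *])
    {(q, x, y), (r, y, z), (s, z, e), (p, e, x)}
  rw [square, square]
  simp only [Multiset.insert_eq_cons, Multiset.map_cons, Multiset.map_singleton, Multiset.cons_add,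
    Multiset.singleton_add, Prod.map, Equiv.Perm.mul_apply] at this
  have h1 := h.xy; have h2 := h.xz; have h3 := h.xe; have h4 := h.yz; have h5 := h.ye
  have h6 := h.ze
  have h1' := h.xy.symm; have h2' := h.xz.symm; have h3' := h.xe.symm; have h4' := h.yz.symm
  have h5' := h.ye.symm; have h6' := h.ze.symm
  simp only [Equiv.swap_apply_of_ne_of_ne, Equiv.swap_apply_left, Equiv.swap_apply_right, ne_eq,
    not_false_eq_true, *] at this
  rw [← this, Multiset.cons_swap (p, x, y), Multiset.cons_swap (p, x, y),
    Multiset.cons_swap (p, x, y)]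

/-- The reflection that exchanges the sides `y` and `e` reverses the cyclic order at all four
corners, and the four signs cancel. -/
theorem square_reverse (h : Fresh x y z e R S) (hp : Avoids x y z e p) (hq : Avoids x y z e q)
    (hr : Avoids x y z e r) (hs : Avoids x y z e s) :
    square n b x y z e R S p q r s = square n b x y z e R S s r q p := by
  classical
  obtain ⟨p1, p2, p3, p4⟩ := hp
  obtain ⟨q1, q2, q3, q4⟩ := hq
  obtain ⟨r1, r2, r3, r4⟩ := hr
  obtain ⟨s1, s2, s3, s4⟩ := hs
  have := h.rename (n := n) (b := b)
    (Equiv.swap y e) (fun k h1 h2 h3 h4 => by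
    simp [Equiv.swap_apply_of_ne_of_ne, *])
    {(s, x, y), (r, y, z), (q, z, e), (p, e, x)}
  rw [square, square]
  simp only [Multiset.insert_eq_cons, Multiset.map_cons, Multiset.map_singleton, Multiset.cons_add,
    Multiset.singleton_add, Prod.map] at this
  have h1 := h.xy; have h2 := h.xz; have h3 := h.xe; have h4 := h.yz; have h5 := h.ye
  have h6 := h.ze
  have h1' := h.xy.symm; have h2' := h.xz.symm; have h3' := h.xe.symm; have h4' := h.yz.symm
  have h5' := h.ye.symm; have h6' := h.ze.symm
  simp only [Equiv.swap_apply_of_ne_of_ne, Equiv.swap_apply_left, Equiv.swap_apply_right, ne_eq,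
    not_false_eq_true, *] at this
  rw [← this, ncl_flip, ncl_flip₂, ncl_flip₃, ncl_flip₄]
  simp only [neg_neg]
  rw [Multiset.cons_swap (r, e, z), Multiset.cons_swap (q, z, y), Multiset.cons_swap (q, z, y),
    Multiset.cons_swap (p, y, x), Multiset.cons_swap (p, y, x), Multiset.cons_swap (p, y, x)]

/-- Expanding a triangle that is attached to a trivalent vertex into squares. -/
theorem ncl_triangle (h : Fresh x y z e R S) (hp : Avoids x y z e p) (hq : Avoids x y z e q)
    (hr : Avoids x y z e r) (hs : Avoids x y z e s) :
    ncl n b ((e, x, z) ::ₘ (p, y, x) ::ₘ (q, z, y) ::ₘ (e, r, s) ::ₘ R) S =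
      square n b x y z e R S p q r s - square n b x y z e R S q p r s := by
  classical
  -- IHX at the edge `e` by which the triangle hangs on the rest. In the other two terms `e` has
  -- become the fourth side of a cycle.
  have h0 := ncl_ihx (n := n) (b := b) (T := (p, y, x) ::ₘ (q, z, y) ::ₘ R) (S := S) e x z r s
  have e1 : ncl n b ((e, z, r) ::ₘ (e, x, s) ::ₘ (p, y, x) ::ₘ (q, z, y) ::ₘ R) S =
      - square n b x y z e R S p q r s := by
    rw [ncl_rot, ncl_rot, ncl_flip, ncl_rot₂, ncl_rot₂, ncl_flip₃, ncl_flip₄, neg_neg, square,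
      Multiset.cons_swap (s, e, x), Multiset.cons_swap (s, e, x), Multiset.cons_swap (r, z, e),
      Multiset.cons_swap (r, z, e)]
  have e2 : ncl n b ((e, r, x) ::ₘ (e, z, s) ::ₘ (p, y, x) ::ₘ (q, z, y) ::ₘ R) S =
      square n b x y z e R S q p r s := by
    obtain ⟨p1, p2, p3, p4⟩ := hp
    obtain ⟨q1, q2, q3, q4⟩ := hq
    obtain ⟨r1, r2, r3, r4⟩ := hr
    obtain ⟨s1, s2, s3, s4⟩ := hs
    -- Exchanging the names `x` and `z` brings this cycle into the standard form of a square.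
    have := h.rename (n := n) (b := b)
      (Equiv.swap x z) (fun k h1 h2 h3 h4 => by
      simp [Equiv.swap_apply_of_ne_of_ne, *])
      {(q, x, y), (p, y, z), (r, z, e), (s, e, x)}
    rw [square]
    simp only [Multiset.insert_eq_cons, Multiset.map_cons, Multiset.map_singleton,
      Multiset.cons_add, Multiset.singleton_add, Prod.map] at this
    have h1 := h.xy; have h2 := h.xz; have h3 := h.xe; have h4 := h.yz; have h5 := h.ye
    have h6 := h.ze
    have h1' := h.xy.symm; have h2' := h.xz.symm; have h3' := h.xe.symm; have h4' := h.yz.symm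
    have h5' := h.ye.symm; have h6' := h.ze.symm
    simp only [Equiv.swap_apply_of_ne_of_ne, Equiv.swap_apply_left, Equiv.swap_apply_right, ne_eq,
      not_false_eq_true, *] at this
    rw [← this, ncl_rot, ncl_rot₂, ncl_rot₂, Multiset.cons_swap (s, e, z),
      Multiset.cons_swap (s, e, z), Multiset.cons_swap (r, x, e), Multiset.cons_swap (r, x, e),
      Multiset.cons_swap (p, y, x)]
  rw [e1, e2, Multiset.cons_swap (e, r, s), Multiset.cons_swap (e, r, s)] at h0
  rw [eq_sub_iff_add_eq, ← sub_eq_zero, ← h0]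
  abel

end square

end JacobiDiagram

namespace JacobiDiagram

variable {L ε : Type} {n : ℕ} {b : ℤ}

/-! ### Blowing up on the level of classes -/

theorem ncl_rot_fun {T : Multiset (ε × ε × ε)} {S : Multiset (ε × L)} (f : Fin 3 → ε) (r : Fin 3) :
    ncl n b ((f r, f (r + 1), f (r + 2)) ::ₘ T) S = ncl n b ((f 0, f 1, f 2) ::ₘ T) S := by
  fin_cases r
  · rfl
  · exact (ncl_rot _ _ _).symm
  · exact ncl_rot _ _ _

section blowUp

variable {J : JacobiDiagram L} {ν : J.H → ε} {T : Multiset (ε × ε × ε)} {S : Multiset (ε × L)}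
  {v w : J.V} {i j : Fin 3} {x y z : ε}

/-- `x, y, z` are distinct and not in the range of `ν`. -/
structure New {H : Type} (ν : H → ε) (x y z : ε) : Prop where
  xy : x ≠ y
  yz : y ≠ z
  xz : x ≠ z
  hx : ∀ k, x ≠ ν k
  hy : ∀ k, y ≠ ν k
  hz : ∀ k, z ≠ ν k

theorem New.avoids {H : Type} {ν : H → ε} (hN : New ν x y z) {k k' : H} (h : ν k ≠ ν k') :
    Avoids x y z (ν k') (ν k) :=
  ⟨(hN.hx k).symm, (hN.hy k).symm, (hN.hz k).symm, h⟩

/-- Both halves of the edge from `v` to `w` are located at the two erased vertices, so its name is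
free to serve as the fourth side of a square. -/
theorem IsModel.fresh [DecidableEq J.V] (h : IsModel J ν T S) (hN : New ν x y z)
    (he : J.α (.inl (v, i)) = .inl (w, j)) :
    Fresh x y z (ν (.inl (v, i))) ((((Multiset.enum J.V).erase v).erase w).map (tripleOf ν)) S := by
  refine ⟨hN.xy, hN.xz, hN.hx _, hN.yz, hN.hy _, hN.hz _, ?_, ?_⟩
  · intro t ht k hk
    obtain ⟨u, hu, rfl⟩ := Multiset.mem_map.1 ht
    rw [(Multiset.nodup_enum.erase v).mem_erase_iff, Multiset.mem_erase_enum] at hu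
    have key : ∀ l, Avoids x y z (ν (.inl (v, i))) (ν (.inl (u, l))) := by
      intro l
      refine hN.avoids fun e => ?_
      rcases (h.naming _ _).1 e.symm with e | e
      · simp [hu.2] at e
      · rw [he] at e; simp [hu.1] at e
    rcases hk with rfl | rfl | rfl
    · exact key _
    · exact key _
    · exact key _
  · intro s hs
    rw [← h.legs] at hs
    obtain ⟨u, -, rfl⟩ := Multiset.mem_map.1 hs
    refine hN.avoids (k := .inr u) fun e => ?_
    rcases (h.naming _ _).1 e.symm with e | e
    · simp at e
    · rw [he] at e; simp at e

theorem IsModel.avoids (h : IsModel J ν T S) (hN : New ν x y z) (hvw : v ≠ w)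
    (he : J.α (.inl (v, i)) = .inl (w, j)) :
    Avoids x y z (ν (.inl (v, i))) (ν (.inl (v, i + 1))) ∧
    Avoids x y z (ν (.inl (v, i))) (ν (.inl (v, i + 2))) ∧
    Avoids x y z (ν (.inl (v, i))) (ν (.inl (w, j + 1))) ∧
    Avoids x y z (ν (.inl (v, i))) (ν (.inl (w, j + 2))) := by
  have key : ∀ k, k ≠ .inl (v, i) → k ≠ .inl (w, j) → Avoids x y z (ν (.inl (v, i))) (ν k) := by
    intro k h1 h2
    refine hN.avoids fun e => ?_
    rcases (h.naming _ _).1 e.symm with e | e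
    · exact h1 e
    · exact h2 (e.trans he)
  exact ⟨key _ (by simp) (by simp [hvw]), key _ (by simp) (by simp [hvw]),
    key _ (by simp [hvw.symm]) (by simp), key _ (by simp [hvw.symm]) (by simp)⟩

/-- This is `ncl_triangle` for the triangle that replaces `v`, hanging on the vertex `w`. All
further properties of the blow-up are read off from this formula and the symmetries of squares. -/
theorem IsModel.cl_blowUp [DecidableEq J.V] (h : IsModel J ν T S) (hN : New ν x y z) (hvw : v ≠ w)
    (he : J.α (.inl (v, i)) = .inl (w, j)) {R : Multiset (ε × ε × ε)}
    (hR : (((Multiset.enum J.V).erase v).erase w).map (tripleOf ν) = R) :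
    (J.blowUp v).cl n b =
      square n b x y z (ν (.inl (v, i))) R S (ν (.inl (v, i + 1))) (ν (.inl (v, i + 2)))
        (ν (.inl (w, j + 1))) (ν (.inl (w, j + 2))) -
      square n b x y z (ν (.inl (v, i))) R S (ν (.inl (v, i + 2))) (ν (.inl (v, i + 1)))
        (ν (.inl (w, j + 1))) (ν (.inl (w, j + 2))) := by
  obtain ⟨a1, a2, a3, a4⟩ := h.avoids hN hvw he
  subst hR
  rw [← ncl_triangle (h.fresh hN he) a1 a2 a3 a4]
  obtain ⟨μ, hμ⟩ := h.exists_blowUp v i hN.xy hN.yz hN.xz hN.hx hN.hy hN.hz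
  have hw : w ∈ (Multiset.enum J.V).erase v := Multiset.mem_erase_enum.2 hvw.symm
  rw [← hμ.ncl_eq, ← Multiset.cons_erase hw, Multiset.map_cons, Multiset.erase_cons_head]
  have e1 := h.name_α (.inl (v, i))
  rw [he] at e1
  rw [← e1, Multiset.cons_swap _ (tripleOf ν w), Multiset.cons_swap _ (tripleOf ν w),
    Multiset.cons_swap _ (tripleOf ν w), tripleOf, ← ncl_rot_fun (fun k => ν (.inl (w, k))) j]
  congr 1
  rw [Multiset.cons_swap (ν (.inl (w, j)), ν (.inl (w, j + 1)), _),
    Multiset.cons_swap (ν (.inl (w, j)), ν (.inl (w, j + 1)), _),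
    Multiset.cons_swap (ν (.inl (w, j)), ν (.inl (w, j + 1)), _)]

theorem exists_new (J : JacobiDiagram L) :
    ∃ (ε : Type) (ν : J.H → ε) (T : Multiset (ε × ε × ε)) (S : Multiset (ε × L)) (x y z : ε),
      IsModel J ν T S ∧ New ν x y z := by
  refine ⟨Sym2 J.H ⊕ Fin 3, _, _, _, .inr 0, .inr 1, .inr 2,
    J.exists_isModel.rename Sum.inl_injective, ?_⟩
  constructor <;> simp

/-- Both sides are differences of squares on the same four outer edges. A half-turn matches the
positive squares and a reflection matches the negative ones. -/
theorem cl_blowUp_of_adj (hvw : v ≠ w) (he : J.α (.inl (v, i)) = .inl (w, j)) :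
    (J.blowUp v).cl n b = (J.blowUp w).cl n b := by
  classical
  obtain ⟨ε, ν, T, S, x, y, z, h, hN⟩ := J.exists_new
  have he' : J.α (.inl (w, j)) = .inl (v, i) := by rw [← he, J.α_α]
  have hν : ν (.inl (w, j)) = ν (.inl (v, i)) := by rw [← he, h.name_α]
  have hF := h.fresh hN he
  obtain ⟨a1, a2, a3, a4⟩ := h.avoids hN hvw he
  rw [h.cl_blowUp hN hvw he rfl, h.cl_blowUp hN hvw.symm he' (R := (((Multiset.enum J.V).erase v).erase w).map (tripleOf ν))
    (by rw [Multiset.erase_comm]), hν]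
  rw [square_rot hF a1 a2 a3 a4, square_rot hF a2 a3 a4 a1, square_reverse hF a2 a1 a3 a4]

theorem cl_blowUp_eq (hJ : J.Connected) (v w : J.V) :
    (J.blowUp v).cl n b = (J.blowUp w).cl n b := by
  -- At a leg the predicate speaks of the trivalent vertex to which the leg is attached, so that it
  -- can be propagated along any walk in the graph.
  let P : J.V ⊕ J.U → Prop := Sum.elim (fun w => (J.blowUp v).cl n b = (J.blowUp w).cl n b)
    (fun u => ∃ w i, J.α (.inr u) = .inl (w, i) ∧ (J.blowUp v).cl n b = (J.blowUp w).cl n b)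
  have step : ∀ h, P (J.vert h) → P (J.vert (J.α h)) := by
    rintro (⟨x, i⟩ | u) hP
    · rcases hk : J.α (.inl (x, i)) with ⟨y, j⟩ | u
      · by_cases hxy : x = y
        · subst hxy; exact hP
        · exact Eq.trans hP (cl_blowUp_of_adj hxy hk)
      · exact ⟨x, i, by rw [← hk, J.α_α], hP⟩
    · obtain ⟨y, j, hk, hP⟩ := hP
      rw [hk]; exact hP
  have key : ∀ x y, J.graph.Reachable x y → P x → P y := by
    rintro x y ⟨p⟩
    induction p with
    | nil => exact id
    | cons hadj _ ih =>
      refine fun hx => ih ?_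
      rcases ((SimpleGraph.fromRel_adj _ _ _).1 hadj).2 with ⟨k, rfl, rfl⟩ | ⟨k, rfl, rfl⟩
      · exact step k hx
      · have := step _ hx
        rwa [J.α_α] at this
  have hJ' : J.graph.Connected := hJ
  exact key (.inl v) (.inl w) (hJ'.preconnected _ _) rfl

theorem ncl_map_rot (f : J.V → Fin 3 → ε) (r : J.V → Fin 3) (M : Multiset J.V)
    (Q : Multiset (ε × ε × ε)) :
    ncl n b (M.map (fun v => (f v (r v), f v (r v + 1), f v (r v + 2))) + Q) S =
      ncl n b (M.map (fun v => (f v 0, f v 1, f v 2)) + Q) S := by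
  induction M using Multiset.induction_on generalizing Q with
  | empty => rfl
  | cons v M ih =>
    rw [Multiset.map_cons, Multiset.map_cons, Multiset.cons_add, ncl_rot_fun, ← Multiset.add_cons, ih,
      Multiset.cons_add, Multiset.add_cons]

theorem cl_blowUp_iso {J K : JacobiDiagram L} (e : Iso J K) (v : J.V) :
    (J.blowUp v).cl n b = (K.blowUp (e.eV v)).cl n b := by
  classical
  obtain ⟨ε, ν, T, S, x, y, z, h, hN⟩ := K.exists_new
  have hJ : IsModel J (ν ∘ e.hmap) ((Multiset.enum J.V).map (tripleOf (ν ∘ e.hmap))) S := by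
    refine ⟨fun k k' => ?_, rfl, ?_⟩
    · rw [Function.comp_apply, Function.comp_apply, h.naming, e.α_hmap, e.hmap.apply_eq_iff_eq,
        e.hmap.apply_eq_iff_eq]
    · rw [← h.legs]
      have : Multiset.enum K.U = (Multiset.enum J.U).map e.eU :=
        (Multiset.eq_enum (Multiset.nodup_enum.map e.eU.injective) fun u =>
          Multiset.mem_map.2 ⟨e.eU.symm u, Multiset.mem_enum _, by simp⟩).symm
      rw [this, Multiset.map_map]
      refine Multiset.map_congr rfl fun u _ => ?_
      simp only [Function.comp_apply, e.label_comm]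
      rfl
  obtain ⟨μ, hμ⟩ := hJ.exists_blowUp v 0 hN.xy hN.yz hN.xz (fun k => hN.hx _) (fun k => hN.hy _)
    (fun k => hN.hz _)
  -- Starting the triangle of `K` at the position `e.rot v` aligns it with the triangle of `J`
  -- started at `0`. The rotations at the other vertices are absorbed by `ncl_map_rot`.
  obtain ⟨μ', hμ'⟩ := h.exists_blowUp (e.eV v) (e.rot v) hN.xy hN.yz hN.xz hN.hx hN.hy hN.hz
  rw [← hμ.ncl_eq, ← hμ'.ncl_eq]
  have hV : (Multiset.enum K.V).erase (e.eV v) = ((Multiset.enum J.V).erase v).map e.eV := by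
    rw [Multiset.map_erase _ e.eV.injective]
    congr 1
    exact (Multiset.eq_enum (Multiset.nodup_enum.map e.eV.injective) fun u =>
          Multiset.mem_map.2 ⟨e.eV.symm u, Multiset.mem_enum _, by simp⟩).symm
  have hh : ∀ u k, (ν ∘ e.hmap) (.inl (u, k)) = ν (.inl (e.eV u, e.rot u + k)) := by
    intro u k
    rw [add_comm]; rfl
  have hR := ncl_map_rot (n := n) (b := b) (S := S) (fun u k => ν (.inl (e.eV u, k))) e.rot
    ((Multiset.enum J.V).erase v) ((ν (.inl (e.eV v, e.rot v)), x, z) ::ₘ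
      (ν (.inl (e.eV v, e.rot v + 1)), y, x) ::ₘ (ν (.inl (e.eV v, e.rot v + 2)), z, y) ::ₘ 0)
  rw [hV, Multiset.map_map]
  simp only [Multiset.add_cons, add_zero] at hR
  have e1 : tripleOf (ν ∘ e.hmap) = fun v => (ν (.inl (e.eV v, e.rot v)),
      ν (.inl (e.eV v, e.rot v + 1)), ν (.inl (e.eV v, e.rot v + 2))) := by
    funext u
    simp only [tripleOf, hh, add_zero]
  rw [e1, hh, hh, hh]
  simp only [add_zero, zero_add]
  exact hR

/-- Reversing `v` amounts to reflecting the triangle, which reverses its three corners; three signs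
make `-1`. -/
theorem cl_blowUp_flip (v : J.V) :
    (J.blowUp v).cl n b + ((J.permute (J.asPerm v)).blowUp v).cl n b = 0 := by
  classical
  obtain ⟨ε, ν, T, S, x, y, z, h, hN⟩ := J.exists_new
  have hsymm : (J.asPerm v).symm = J.asPerm v := by
    unfold asPerm; exact Equiv.symm_swap _ _
  have hu : ∀ u, (J.asPerm v).symm (.inr u) = .inr u := fun u => by
    rw [hsymm]; exact Equiv.swap_apply_of_ne_of_ne (by simp) (by simp)
  have hw : ∀ w i, w ≠ v → (J.asPerm v).symm (.inl (w, i)) = .inl (w, i) := fun w i hw => by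
    rw [hsymm]; exact Equiv.swap_apply_of_ne_of_ne (by simp [hw]) (by simp [hw])
  have h0 : (J.asPerm v).symm (.inl (v, 0)) = .inl (v, 0) := by
    rw [hsymm]; exact Equiv.swap_apply_of_ne_of_ne (by simp) (by simp)
  have h1 : (J.asPerm v).symm (.inl (v, 1)) = .inl (v, 2) := by
    rw [hsymm]; exact Equiv.swap_apply_left _ _
  have h2 : (J.asPerm v).symm (.inl (v, 2)) = .inl (v, 1) := by
    rw [hsymm]; exact Equiv.swap_apply_right _ _
  have hK := h.permute (J.asPerm v) hu rfl
  -- The sides are named `z, y, x` here and `x, y, z` for the flipped diagram, so that the two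
  -- triangles differ only in their cyclic orders.
  obtain ⟨μ, hμ⟩ := h.exists_blowUp v 0 hN.yz.symm hN.xy.symm hN.xz.symm hN.hz hN.hy hN.hx
  obtain ⟨μ', hμ'⟩ := IsModel.exists_blowUp (J := J.permute (J.asPerm v)) hK v 0 hN.xy hN.yz hN.xz
    (fun k => hN.hx _) (fun k => hN.hy _) (fun k => hN.hz _)
  have e1 : ((Multiset.enum J.V).erase v).map (tripleOf (J := J) (ν ∘ (J.asPerm v).symm)) =
      ((Multiset.enum J.V).erase v).map (tripleOf ν) := by
    refine Multiset.map_congr rfl fun w hw' => ?_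
    have := Multiset.mem_erase_enum.1 hw'
    simp [tripleOf, hw w _ this]
  have e2 : ((J.permute (J.asPerm v)).blowUp v).cl n b =
      ncl n b ((ν (.inl (v, 0)), x, z) ::ₘ (ν (.inl (v, 2)), y, x) ::ₘ (ν (.inl (v, 1)), z, y) ::ₘ
        ((Multiset.enum J.V).erase v).map (tripleOf ν)) S := by
    rw [← hμ'.ncl_eq, ← e1, ← congrArg ν h0, ← congrArg ν h1, ← congrArg ν h2]
    rfl
  rw [e2, ← hμ.ncl_eq, ncl_flip, ncl_flip₂, ncl_flip₃, Multiset.cons_swap (ν (.inl (v, 2)), y, x)]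
  simp

/-- The relation permutes three of the four outer edges cyclically. Up to dihedral symmetry only
three squares exist on four outer edges, and each of them appears once with each sign among the six
terms. -/
theorem cl_blowUp_ihx (hvw : v ≠ w) (he : J.α (.inl (v, i)) = .inl (w, j)) :
    (J.blowUp v).cl n b + ((J.permute (J.ihxPerm v w i j)).blowUp v).cl n b +
      ((J.permute (J.ihxPerm v w i j)⁻¹).blowUp v).cl n b = 0 := by
  classical
  obtain ⟨ε, ν, T, S, x, y, z, h, hN⟩ := J.exists_new
  obtain ⟨p0, q0⟩ := J.ihxPerm_fix hvw i j
  obtain ⟨p1, p2, q1, q2⟩ := ihxPerm_apply hvw i j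
  obtain ⟨he1, he2⟩ := α_permute_ihxPerm hvw he
  have hF := h.fresh hN he
  obtain ⟨a1, a2, a3, a4⟩ := h.avoids hN hvw he
  set ρ := J.ihxPerm v w i j with hρ
  have hR : ∀ σ : Equiv.Perm J.H, (∀ x k, x ≠ v → x ≠ w → σ.symm (.inl (x, k)) = .inl (x, k)) →
      (((Multiset.enum J.V).erase v).erase w).map (tripleOf (J := J) (ν ∘ σ.symm)) =
      (((Multiset.enum J.V).erase v).erase w).map (tripleOf ν) := by
    intro σ hσ
    refine Multiset.map_congr rfl fun x hx => ?_
    rw [(Multiset.nodup_enum.erase v).mem_erase_iff] at hx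
    have := Multiset.mem_erase_enum.1 hx.2
    simp [tripleOf, hσ x _ this hx.1]
  have h1 := h.permute ρ (fun u => (Equiv.symm_apply_eq _).2 (ihxPerm_apply_inr i j u).symm) rfl
  have h2 := h.permute ρ⁻¹ (fun u => ihxPerm_apply_inr i j u) rfl
  have N1 : ∀ σ : Equiv.Perm J.H, New (ν ∘ σ.symm) x y z := fun σ =>
    ⟨hN.xy, hN.yz, hN.xz, fun k => hN.hx _, fun k => hN.hy _, fun k => hN.hz _⟩
  have c1 := IsModel.cl_blowUp (n := n) (b := b) (J := J.permute ρ) h1 (N1 ρ) hvw he1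
    (hR ρ fun x k hx hx' => (Equiv.symm_apply_eq _).2 (ihxPerm_apply_of_ne hx hx' i j k).symm)
  have c2 := IsModel.cl_blowUp (n := n) (b := b) (J := J.permute ρ⁻¹) h2 (N1 ρ⁻¹) hvw he2
    (hR ρ⁻¹ fun x k hx hx' => ihxPerm_apply_of_ne hx hx' i j k)
  have s0 : ρ.symm (.inl (v, i)) = .inl (v, i) := (Equiv.symm_apply_eq _).2 p0.symm
  have s1 : ρ.symm (.inl (v, i + 2)) = .inl (v, i + 1) := (Equiv.symm_apply_eq _).2 p1.symm
  have s2 : ρ.symm (.inl (w, j + 1)) = .inl (v, i + 2) := (Equiv.symm_apply_eq _).2 p2.symm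
  have s3 : ρ.symm (.inl (v, i + 1)) = .inl (w, j + 1) := (Equiv.symm_apply_eq _).2 q1.symm
  have s4 : ρ.symm (.inl (w, j + 2)) = .inl (w, j + 2) := (Equiv.symm_apply_eq _).2 q2.symm
  set R := (((Multiset.enum J.V).erase v).erase w).map (tripleOf ν) with hRdef
  have d1 : ((J.permute ρ).blowUp v).cl n b =
      square n b x y z (ν (.inl (v, i))) R S (ν (.inl (w, j + 1))) (ν (.inl (v, i + 1)))
        (ν (.inl (v, i + 2))) (ν (.inl (w, j + 2))) -
      square n b x y z (ν (.inl (v, i))) R S (ν (.inl (v, i + 1))) (ν (.inl (w, j + 1)))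
        (ν (.inl (v, i + 2))) (ν (.inl (w, j + 2))) := by
    rw [c1, ← congrArg ν s0, ← congrArg ν s1, ← congrArg ν s2, ← congrArg ν s3, ← congrArg ν s4]
    rfl
  have d2 : ((J.permute ρ⁻¹).blowUp v).cl n b =
      square n b x y z (ν (.inl (v, i))) R S (ν (.inl (v, i + 2))) (ν (.inl (w, j + 1)))
        (ν (.inl (v, i + 1))) (ν (.inl (w, j + 2))) -
      square n b x y z (ν (.inl (v, i))) R S (ν (.inl (w, j + 1))) (ν (.inl (v, i + 2)))
        (ν (.inl (v, i + 1))) (ν (.inl (w, j + 2))) := by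
    rw [c2, ← congrArg ν p0, ← congrArg ν p1, ← congrArg ν p2, ← congrArg ν q1, ← congrArg ν q2]
    rfl
  rw [h.cl_blowUp hN hvw he rfl, d1, d2]
  rw [square_reverse hF a2 a1 a3 a4, square_rot hF a4 a3 a1 a2,
    square_reverse hF a1 a3 a2 a4, square_rot hF a4 a2 a3 a1,
    square_reverse hF a3 a2 a1 a4, square_rot hF a4 a1 a2 a3]
  abel

end blowUp

/-! ### Blow-ups of diagrams with a self-loop -/

section lollipop

/-- The triangle on a self-loop whose vertex carries a leg. -/
theorem ncl_triangle_selfLoop {x y z e c : ε} {S : Multiset (ε × L)} (h : Fresh x y z e 0 S)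
    (hc : Avoids x y z e c) : ncl n b ((e, x, z) ::ₘ (e, y, x) ::ₘ (c, z, y) ::ₘ 0) S = 0 := by
  classical
  obtain ⟨c1, c2, c3, c4⟩ := hc
  have h1 := h.xy; have h2 := h.xz; have h3 := h.xe; have h4 := h.yz; have h5 := h.ye
  have h6 := h.ze
  have h1' := h.xy.symm; have h2' := h.xz.symm; have h3' := h.xe.symm; have h4' := h.yz.symm
  have h5' := h.ye.symm; have h6' := h.ze.symm
  have key : ∀ f : Equiv.Perm ε, (∀ k, k ≠ x → k ≠ y → k ≠ z → k ≠ e → f k = k) →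
      ncl n b ((f e, f x, f z) ::ₘ (f e, f y, f x) ::ₘ (c, f z, f y) ::ₘ 0) S =
        ncl n b ((e, x, z) ::ₘ (e, y, x) ::ₘ (c, z, y) ::ₘ 0) S := by
    intro f hf
    have := h.rename (n := n) (b := b) f hf {(e, x, z), (e, y, x), (c, z, y)}
    simpa [hf c c1 c2 c3 c4] using this
  set X := ncl n b ((e, x, z) ::ₘ (e, y, x) ::ₘ (c, z, y) ::ₘ 0) S with hX
  -- The reflection that exchanges `y` and `z` maps the diagram to itself and reverses all three
  -- cyclic orders.
  have two : X + X = 0 := by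
    have := key (Equiv.swap y z) (fun k _ h1 h2 _ => Equiv.swap_apply_of_ne_of_ne h1 h2)
    simp only [Equiv.swap_apply_of_ne_of_ne, Equiv.swap_apply_left, Equiv.swap_apply_right, ne_eq,
      not_false_eq_true, *] at this
    rw [ncl_flip, ncl_flip₂, ncl_flip₃, Multiset.cons_swap, neg_neg, ← hX] at this
    nth_rw 1 [← this]
    simp
  -- All three terms of the IHX relation at the edge `z` are the same diagram up to renaming.
  have three : X + X + X = 0 := by
    have h0 := ncl_ihx (n := n) (b := b) (T := (e, y, x) ::ₘ 0) (S := S) z e x y c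
    have e1 : ncl n b ((z, e, x) ::ₘ (z, y, c) ::ₘ (e, y, x) ::ₘ 0) S = X := by
      rw [hX, ncl_rot, ncl_rot₂, ncl_rot₂, Multiset.cons_swap (c, z, y)]
    have e2 : ncl n b ((z, x, y) ::ₘ (z, e, c) ::ₘ (e, y, x) ::ₘ 0) S = X := by
      have := key (Equiv.swap e x * Equiv.swap x y) (fun k h1 h2 h3 h4 => by
        simp [Equiv.Perm.mul_apply, Equiv.swap_apply_of_ne_of_ne, *])
      simp only [Equiv.Perm.mul_apply, Equiv.swap_apply_of_ne_of_ne, Equiv.swap_apply_left,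
        Equiv.swap_apply_right, ne_eq, not_false_eq_true, *] at this
      rw [hX, ← this, ncl_rot, ncl_rot₂, ncl_rot₂, ncl_rot₃, ncl_rot₃, Multiset.cons_swap (c, z, e)]
    have e3 : ncl n b ((z, y, e) ::ₘ (z, x, c) ::ₘ (e, y, x) ::ₘ 0) S = X := by
      have := key (Equiv.swap x e * Equiv.swap y e) (fun k h1 h2 h3 h4 => by
        simp [Equiv.Perm.mul_apply, Equiv.swap_apply_of_ne_of_ne, *])
      simp only [Equiv.Perm.mul_apply, Equiv.swap_apply_of_ne_of_ne, Equiv.swap_apply_left,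
        Equiv.swap_apply_right, ne_eq, not_false_eq_true, *] at this
      rw [hX, ← this, ncl_rot, ncl_rot₂, ncl_rot₂, ncl_rot₃, Multiset.cons_swap (c, z, x)]
    rw [e1, e2, e3] at h0
    exact h0
  rw [two, zero_add] at three
  exact three

/-- If there is another trivalent vertex, it may be blown up instead, and the loop survives.
Otherwise the diagram is a loop with one further edge, for which `ncl_triangle_selfLoop` applies. -/
theorem cl_blowUp_selfLoop {J : JacobiDiagram L} (hJ : J.Connected) {v : J.V} {i j : Fin 3}
    (he : J.α (.inl (v, i)) = .inl (v, j)) (u : J.V) : (J.blowUp u).cl n b = 0 := by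
  classical
  rw [cl_blowUp_eq hJ u v]
  by_cases hw : ∃ w, w ≠ v
  · obtain ⟨w, hw⟩ := hw
    rw [cl_blowUp_eq hJ v w]
    refine cl_selfLoop (J.blowUp w) (v := .inl ⟨v, hw.symm⟩) (i := i) (j := j) ?_
    change J.blowUpEmb w (J.α (.inl (v, i))) = _
    rw [he]
    simp only [blowUpEmb, hw.symm, dite_false]
    rfl
  · push Not at hw
    obtain ⟨ε, ν, T, S, x, y, z, h, hN⟩ := J.exists_new
    obtain ⟨k, hk⟩ : ∃ k, J.α (.inl (v, k)) = .inl (v, k + 1) := by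
      have hij : i ≠ j := fun e => J.α_ne (.inl (v, i)) (by rw [he, e])
      have : j = i + 1 ∨ i = j + 1 := by
        clear he; revert i j; decide
      rcases this with rfl | rfl
      · exact ⟨i, he⟩
      · exact ⟨j, by rw [← he, J.α_α]⟩
    have hF := h.fresh hN hk
    have hR : ((Multiset.enum J.V).erase v) = 0 :=
      Multiset.eq_zero_of_forall_notMem fun w hw' => Multiset.mem_erase_enum.1 hw' (hw w)
    rw [hR] at hF
    have hc : Avoids x y z (ν (.inl (v, k))) (ν (.inl (v, k + 2))) := by
      refine hN.avoids fun e => ?_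
      rcases (h.naming _ _).1 e.symm with e | e
      · simp at e
      · rw [hk] at e; simp at e
    have := ncl_triangle_selfLoop (n := n) (b := b) hF hc
    obtain ⟨μ, hμ⟩ := h.exists_blowUp v k hN.xy hN.yz hN.xz hN.hx hN.hy hN.hz
    have e1 := h.name_α (.inl (v, k))
    rw [hk] at e1
    rw [← hμ.ncl_eq, hR, e1]
    exact this

end lollipop

end JacobiDiagram

/-! ### The blow-up homomorphism -/

namespace ConnDiagram

open JacobiDiagram

variable {L : Type} {N n : ℕ}

open Classical in
/-- Blowing up some trivalent vertex. -/
noncomputable def blowUpClass (n : ℕ) (J : ConnDiagram L N 1) : JacobiModule L n 2 :=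
  if h : Nonempty J.1.V then (J.1.blowUp h.some).cl n 2 else 0

theorem blowUpClass_eq (J : ConnDiagram L N 1) (v : J.1.V) :
    J.blowUpClass n = (J.1.blowUp v).cl n 2 := by
  have h : Nonempty J.1.V := ⟨v⟩
  rw [blowUpClass, dif_pos h]
  exact cl_blowUp_eq J.2.1 _ _

/-- The blow-up map. -/
noncomputable def blowUpMap (L : Type) (N n : ℕ) (hN : 0 < N) :
    JacobiModule L N 1 →ₗ[ℤ] JacobiModule L n 2 :=
  Submodule.liftQ _ (Finsupp.linearCombination ℤ (blowUpClass n)) <| by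
    have hne : ∀ J : ConnDiagram L N 1, Nonempty J.1.V := fun J => by
      have h : Nat.card J.1.V = N := J.2.2.1
      have : Nat.card J.1.V ≠ 0 := by omega
      exact (Nat.card_ne_zero.1 this).1
    rw [Submodule.span_le]
    rintro x hx
    simp only [SetLike.mem_coe, LinearMap.mem_ker]
    induction hx with
    | iso J K e =>
      obtain ⟨v⟩ := hne J
      simp only [map_sub, linearCombination_single, one_smul]
      rw [blowUpClass_eq J v, blowUpClass_eq K (e.eV v), cl_blowUp_iso e v, sub_self]
    | as J v =>
      simp only [map_add, linearCombination_single, one_smul]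
      rw [blowUpClass_eq J v, blowUpClass_eq (J.flip v) v]
      exact cl_blowUp_flip v
    | ihx J v w i j hvw he =>
      simp only [map_add, linearCombination_single, one_smul]
      rw [blowUpClass_eq J v, blowUpClass_eq (J.ihx₁ hvw he) v, blowUpClass_eq (J.ihx₂ hvw he) v]
      exact cl_blowUp_ihx hvw he
    | selfLoop J v i j he =>
      simp only [linearCombination_single, one_smul]
      rw [blowUpClass_eq J v]
      exact cl_blowUp_selfLoop J.2.1 he v

theorem blowUpMap_cls (hN : 0 < N) (J : ConnDiagram L N 1) (v : J.1.V) :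
    blowUpMap L N n hN J.cls = (J.1.blowUp v).cl n 2 := by
  rw [← blowUpClass_eq]
  change Finsupp.linearCombination ℤ (blowUpClass n) (single J 1) = _
  simp

end ConnDiagram

namespace JacobiDiagram

variable {L ε : Type} {n : ℕ} {b : ℤ}

/-! ### Strands -/

/-- The end of the strand that starts with the edge `s` and has the legs and edges listed. -/
def strandEnd (s : ε) : List (ε × ε) → ε
  | [] => s
  | (_, o) :: r => strandEnd o r

/-- The trivalent vertices of a strand that starts with the edge `s`: an entry `(f, o)` stands for a
vertex with side edge `f` and next edge `o`. -/
def strand (s : ε) : List (ε × ε) → List (ε × ε × ε)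
  | [] => []
  | (f, o) :: r => (f, s, o) :: strand o r

/-- As `strand`, with the opposite cyclic orders. -/
def lowerStrand (s : ε) : List (ε × ε) → List (ε × ε × ε)
  | [] => []
  | (f, o) :: r => (f, o, s) :: lowerStrand o r

/-- The legs of a strand. -/
def strandLegs (R : List (L × ε × ε)) : List (ε × L) := R.map fun t => (t.2.1, t.1)

theorem strandEnd_append (s : ε) (r r' : List (ε × ε)) :
    strandEnd s (r ++ r') = strandEnd (strandEnd s r) r' := by
  induction r generalizing s with
  | nil => rfl
  | cons t r ih => exact ih t.2

theorem strand_append (s : ε) (r r' : List (ε × ε)) :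
    strand s (r ++ r') = strand s r ++ strand (strandEnd s r) r' := by
  induction r generalizing s with
  | nil => rfl
  | cons t r ih => exact congrArg (_ :: ·) (ih t.2)

theorem lowerStrand_append (s : ε) (r r' : List (ε × ε)) :
    lowerStrand s (r ++ r') = lowerStrand s r ++ lowerStrand (strandEnd s r) r' := by
  induction r generalizing s with
  | nil => rfl
  | cons t r ih => exact congrArg (_ :: ·) (ih t.2)

theorem length_strand (s : ε) (r : List (ε × ε)) : (strand s r).length = r.length := by
  induction r generalizing s with
  | nil => rfl
  | cons t r ih => exact congrArg (· + 1) (ih t.2)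

theorem length_lowerStrand (s : ε) (r : List (ε × ε)) : (lowerStrand s r).length = r.length := by
  induction r generalizing s with
  | nil => rfl
  | cons t r ih => exact congrArg (· + 1) (ih t.2)

/-- This links the recursive strands, suited to induction, with the indexed families in
`isModel_wheel` and `isModel_theta`. All indices are in range, so the default `s` is immaterial. -/
theorem getElem_strand (s : ε) (r : List (ε × ε)) (j : ℕ) (hj : j < (strand s r).length) :
    (strand s r)[j] = ((r.map Prod.fst).getD j s, (s :: r.map Prod.snd).getD j s,
      (s :: r.map Prod.snd).getD (j + 1) s) := by
  induction r generalizing s j with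
  | nil => simp [strand] at hj
  | cons t r ih =>
    rcases j with _ | j
    · simp [strand]
    · have hj' : j < (strand t.2 r).length := by simpa [strand] using hj
      have e : (strand s (t :: r))[j + 1] = (strand t.2 r)[j] := rfl
      have hr : j < r.length := by rwa [length_strand] at hj'
      rw [e, ih]
      rcases j with _ | j
      · simp [hr]
      · have : j < r.length := by omega
        simp [hr, this]

theorem getElem_lowerStrand (s : ε) (r : List (ε × ε)) (j : ℕ)
    (hj : j < (lowerStrand s r).length) :
    (lowerStrand s r)[j] = ((r.map Prod.fst).getD j s, (s :: r.map Prod.snd).getD (j + 1) s,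
      (s :: r.map Prod.snd).getD j s) := by
  induction r generalizing s j with
  | nil => simp [lowerStrand] at hj
  | cons t r ih =>
    rcases j with _ | j
    · simp [lowerStrand]
    · have hj' : j < (lowerStrand t.2 r).length := by simpa [lowerStrand] using hj
      have e : (lowerStrand s (t :: r))[j + 1] = (lowerStrand t.2 r)[j] := rfl
      have hr : j < r.length := by rwa [length_lowerStrand] at hj'
      rw [e, ih]
      rcases j with _ | j
      · simp [hr]
      · have : j < r.length := by omega
        simp [hr, this]

theorem strandEnd_eq (s : ε) (r : List (ε × ε)) :
    strandEnd s r = (s :: r.map Prod.snd).getD r.length s := by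
  induction r generalizing s with
  | nil => rfl
  | cons t r ih =>
    rw [strandEnd, ih]
    simp only [List.length_cons, List.map_cons, List.getD_cons_succ]
    rcases h : r.length with _ | k
    · simp
    · have : k < r.length := by omega
      simp [this]

theorem enum_fin {Y : Type*} {m : ℕ} (f : Fin m → Y) :
    (Multiset.enum (Fin m)).map f = (List.ofFn f : Multiset Y) := by
  rw [← Multiset.eq_enum (Finset.univ (α := Fin m)).nodup (fun x => Finset.mem_univ x),
    Fin.univ_val_map]

/-! ### Wheels -/

/-- The names in a wheel. -/
def wheelName {m : ℕ} (F O : Fin m → ε) : (Fin m × Fin 3) ⊕ Fin m → ε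
  | .inl (j, 0) => F j
  | .inl (j, 1) => O ((finRotate m).symm j)
  | .inl (j, 2) => O j
  | .inr j => F j

theorem isModel_wheel {m : ℕ} (x : Fin m → L) (F O : Fin m → ε) (hF : Function.Injective F)
    (hO : Function.Injective O) (hFO : ∀ i j, F i ≠ O j) :
    IsModel (wheel x) (wheelName F O)
      (List.ofFn fun j => (F j, O ((finRotate m).symm j), O j) : Multiset (ε × ε × ε))
      (List.ofFn fun j => (F j, x j) : Multiset (ε × L)) := by
  have h1 : ∀ i j, F i = F j ↔ j = i := fun i j => by rw [hF.eq_iff, eq_comm]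
  have h2 : ∀ i j, O i = O j ↔ j = i := fun i j => by rw [hO.eq_iff, eq_comm]
  have h3 : ∀ i j, ¬ F i = O j := hFO
  have h4 : ∀ i j, ¬ O i = F j := fun i j e => hFO j i e.symm
  have key : ∀ h k : (Fin m × Fin 3) ⊕ Fin m,
      wheelName F O h = wheelName F O k ↔ k = h ∨ k = (wheel x).α h := by
    rintro (⟨j, i⟩ | j) (⟨j', i'⟩ | j')
    · fin_cases i <;> fin_cases i' <;>
        simp [wheelName, wheel, h1, h2, h3, h4, Equiv.eq_symm_apply, Equiv.symm_apply_eq,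
          -finRotate_apply, -finRotate_symm_apply]
    · fin_cases i <;> simp [wheelName, wheel, h1, h4]
    · fin_cases i' <;> simp [wheelName, wheel, h1, h3]
    · simp [wheelName, wheel, h1]
  exact ⟨key, enum_fin _, enum_fin _⟩

/-- The class of the wheel with a list of labels. -/
noncomputable def wheelCl (n : ℕ) (a : List L) : JacobiModule L n 1 := (wheel a.get).cl n 1

/-- The number of legs is part of the type of the labelling, so functions are compared with lists
inside a sigma type. -/
theorem cl_wheel {m : ℕ} (x : Fin m → L) : (wheel x).cl n 1 = wheelCl n (List.ofFn x) := by
  obtain ⟨a, ha⟩ : ∃ a, a = List.ofFn x := ⟨_, rfl⟩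
  have h : (⟨m, x⟩ : Σ m, Fin m → L) = ⟨a.length, a.get⟩ :=
    List.ofFn_inj'.1 (by rw [List.ofFn_get, ha])
  rw [← ha, wheelCl]
  exact congrArg (fun y : Σ m, Fin m → L => (wheel y.2).cl n 1) h

theorem finRotate_symm_zero {m k : ℕ} (hm : m = k + 1) (h0 : 0 < m) :
    ((finRotate m).symm ⟨0, h0⟩ : ℕ) = k := by
  subst hm
  have : (finRotate (k + 1)).symm ⟨0, h0⟩ = ⟨k, by omega⟩ := by
    rw [Equiv.symm_apply_eq]; exact finRotate_last'.symm
  rw [this]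

theorem finRotate_symm_succ {m j : ℕ} (hj : j + 1 < m) :
    ((finRotate m).symm ⟨j + 1, hj⟩ : ℕ) = j := by
  obtain ⟨k, rfl⟩ : ∃ k, m = k + 1 := ⟨m - 1, by omega⟩
  have : (finRotate (k + 1)).symm ⟨j + 1, hj⟩ = ⟨j, by omega⟩ := by
    rw [Equiv.symm_apply_eq]; exact (finRotate_of_lt (by omega)).symm
  rw [this]

/-- Since the strand closes up, its first edge `s` is the outgoing edge of the last vertex, which is
the cyclic predecessor of index `0`. -/
theorem isModel_strand_wheel {s : ε} {R : List (L × ε × ε)}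
    (hs : strandEnd s (R.map Prod.snd) = s)
    (hd : (R.map (fun t => t.2.1) ++ R.map (fun t => t.2.2)).Nodup) :
    ∃ ν, IsModel (wheel fun j : Fin R.length => R[j].1) ν
      (strand s (R.map Prod.snd) : Multiset (ε × ε × ε)) (strandLegs R : Multiset (ε × L)) := by
  rw [List.nodup_append] at hd
  obtain ⟨hF, hO, hFO⟩ := hd
  have h := isModel_wheel (fun j : Fin R.length => R[j].1) (fun j => R[j].2.1)
    (fun j => R[j].2.2) (fun i j e => ?_) (fun i j e => ?_) (fun i j e => ?_)
  · have e2 : List.ofFn (fun j : Fin R.length => (R[j].2.1, R[j].1)) = strandLegs R := by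
      apply List.ext_getElem <;> simp [strandLegs]
    have e3 : List.ofFn (fun j : Fin R.length => (R[j].2.1, R[(finRotate R.length).symm j].2.2,
        R[j].2.2)) = strand s (R.map Prod.snd) := by
      apply List.ext_getElem
      · simp [length_strand]
      · intro j h1 h2
        rw [getElem_strand]
        have hj : j < R.length := by simpa using h1
        simp only [List.getElem_ofFn, List.map_map, Fin.getElem_fin]
        congr 1
        · simp [hj]
        congr 1
        · rcases j with _ | j
          · obtain ⟨k, hk⟩ : ∃ k, R.length = k + 1 := ⟨R.length - 1, by omega⟩
            rw [strandEnd_eq] at hs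
            have := finRotate_symm_zero hk hj
            simp only [this]
            conv_rhs => simp
            rw [← hs]
            simp [hk]
          · have := finRotate_symm_succ hj
            have hj' : j < R.length := by omega
            simp only [this]
            simp [hj']
        · simp [hj]
    rw [e2, e3] at h
    exact ⟨_, h⟩
  · have := hF.getElem_inj_iff (i := i) (j := j) (hi := by simp) (hj := by simp)
    simp only [List.getElem_map] at this
    exact Fin.ext (this.1 e)
  · have := hO.getElem_inj_iff (i := i) (j := j) (hi := by simp) (hj := by simp)
    simp only [List.getElem_map] at this
    exact Fin.ext (this.1 e)
  · exact hFO _ (List.mem_map.2 ⟨R[i], by simp, rfl⟩) _ (List.mem_map.2 ⟨R[j], by simp, rfl⟩) e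

theorem ncl_wheel {s : ε} {R : List (L × ε × ε)}
    (hs : strandEnd s (R.map Prod.snd) = s)
    (hd : (R.map (fun t => t.2.1) ++ R.map (fun t => t.2.2)).Nodup) :
    ncl n 1 (strand s (R.map Prod.snd) : Multiset (ε × ε × ε)) (strandLegs R : Multiset (ε × L)) =
      wheelCl n (R.map Prod.fst) := by
  have e : List.ofFn (fun j : Fin R.length => R[j].1) = R.map Prod.fst := by
    apply List.ext_getElem <;> simp
  obtain ⟨ν, h⟩ := isModel_strand_wheel hs hd
  rw [h.ncl_eq, cl_wheel, e]

end JacobiDiagram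

namespace JacobiDiagram

variable {L ε : Type} {n : ℕ} {b : ℤ}

/-! ### Theta graphs -/

section thetaName

variable (m : Fin 3 → ℕ) (F O : Fin 3 → ℕ → ε)

/-- The names in a theta graph: `F k j` for the legs, `O k j` for the edges of the strand `k`. -/
def thetaName : ThetaH m → ε
  | .inl (.inl ⟨k, j⟩, i) => if i = 0 then F k j else if i = leftPos k then O k j else O k (j + 1)
  | .inl (.inr false, i) => O (-i) 0
  | .inl (.inr true, i) => O i (m i)
  | .inr u => F u.1 u.2

theorem thetaName_L (k : Fin 3) (j : ℕ) (hj : j ≤ m k) :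
    thetaName m F O (thetaL m k j) = O k j := by
  have := leftPos_ne k
  by_cases h : j < m k
  · simp [thetaL, thetaName, h, this]
  · obtain rfl : j = m k := by omega
    simp [thetaL, thetaName]

theorem thetaName_R (k : Fin 3) (j : ℕ) (hj : j ≤ m k) :
    thetaName m F O (thetaR m k j) = O k j := by
  have := leftPos_ne k
  rcases j with _ | j
  · simp [thetaR, thetaName]
  · have h : j < m k := hj
    simp [thetaR, thetaName, h, this]

variable {m F O}

theorem thetaName_eq_iff (hF : ∀ k j k' j', j < m k → j' < m k' → F k j = F k' j' → k = k' ∧ j = j')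
    (hO : ∀ k j k' j', j ≤ m k → j' ≤ m k' → O k j = O k' j' → k = k' ∧ j = j')
    (hFO : ∀ k j k' j', j < m k → j' ≤ m k' → F k j ≠ O k' j') (h h' : ThetaH m) :
    thetaName m F O h = thetaName m F O h' ↔ h' = h ∨ h' = thetaα m h := by
  constructor
  · intro e
    rcases theta_cases m h with ⟨⟨k, j⟩, rfl⟩ | ⟨⟨k, j⟩, rfl⟩ | ⟨k, j, hj, rfl | rfl⟩ <;>
    rcases theta_cases m h' with ⟨⟨k', j'⟩, rfl⟩ | ⟨⟨k', j'⟩, rfl⟩ | ⟨k', j', hj', rfl | rfl⟩ <;>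
    (try rw [thetaName_L m F O k j hj] at e) <;> (try rw [thetaName_R m F O k j hj] at e) <;>
    (try rw [thetaName_L m F O k' j' hj'] at e) <;> (try rw [thetaName_R m F O k' j' hj'] at e)
    · obtain ⟨rfl, e⟩ := hF _ _ _ _ j.2 j'.2 e
      exact .inl (by rw [Fin.ext e])
    · obtain ⟨rfl, e⟩ := hF _ _ _ _ j.2 j'.2 e
      exact .inr (by rw [Fin.ext e]; rfl)
    · exact absurd e (hFO _ _ _ _ j.2 hj')
    · exact absurd e (hFO _ _ _ _ j.2 hj')
    · obtain ⟨rfl, e⟩ := hF _ _ _ _ j.2 j'.2 e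
      exact .inr (by rw [Fin.ext e]; rfl)
    · obtain ⟨rfl, e⟩ := hF _ _ _ _ j.2 j'.2 e
      exact .inl (by rw [Fin.ext e])
    · exact absurd e (hFO _ _ _ _ j.2 hj')
    · exact absurd e (hFO _ _ _ _ j.2 hj')
    · exact absurd e.symm (hFO _ _ _ _ j'.2 hj)
    · exact absurd e.symm (hFO _ _ _ _ j'.2 hj)
    · obtain ⟨rfl, rfl⟩ := hO _ _ _ _ hj hj' e
      exact .inl rfl
    · obtain ⟨rfl, rfl⟩ := hO _ _ _ _ hj hj' e
      exact .inr (thetaα_L m k j hj).symm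
    · exact absurd e.symm (hFO _ _ _ _ j'.2 hj)
    · exact absurd e.symm (hFO _ _ _ _ j'.2 hj)
    · obtain ⟨rfl, rfl⟩ := hO _ _ _ _ hj hj' e
      exact .inr (thetaα_R m k j hj).symm
    · obtain ⟨rfl, rfl⟩ := hO _ _ _ _ hj hj' e
      exact .inl rfl
  · rintro (rfl | rfl)
    · rfl
    · rcases theta_cases m h with ⟨⟨k, j⟩, rfl⟩ | ⟨⟨k, j⟩, rfl⟩ | ⟨k, j, hj, rfl | rfl⟩
      · rfl
      · rfl
      · rw [thetaα_L m k j hj, thetaName_L m F O k j hj, thetaName_R m F O k j hj]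
      · rw [thetaα_R m k j hj, thetaName_L m F O k j hj, thetaName_R m F O k j hj]

end thetaName

theorem enum_sigma {Y : Type*} (m : Fin 3 → ℕ) (f : (Σ k : Fin 3, Fin (m k)) → Y) :
    (Multiset.enum (Σ k : Fin 3, Fin (m k))).map f =
      (List.ofFn (fun j => f ⟨0, j⟩) : Multiset Y) + (List.ofFn (fun j => f ⟨1, j⟩) : Multiset Y) +
        (List.ofFn (fun j => f ⟨2, j⟩) : Multiset Y) := by
  have h : ∀ k : Fin 3, Function.Injective (fun j : Fin (m k) => (⟨k, j⟩ : Σ k : Fin 3, Fin (m k))) :=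
    fun k i j e => by simpa using e
  have : (Multiset.enum (Fin (m 0))).map (fun j => (⟨0, j⟩ : Σ k : Fin 3, Fin (m k))) +
      (Multiset.enum (Fin (m 1))).map (fun j => (⟨1, j⟩ : Σ k : Fin 3, Fin (m k))) +
      (Multiset.enum (Fin (m 2))).map (fun j => (⟨2, j⟩ : Σ k : Fin 3, Fin (m k))) =
      Multiset.enum _ := by
    apply Multiset.eq_enum
    · simp only [Multiset.nodup_add, Multiset.nodup_enum.map (h _), true_and, Multiset.disjoint_left,
        Multiset.mem_add, Multiset.mem_map]
      refine ⟨?_, ?_⟩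
      · rintro _ ⟨j, -, rfl⟩ ⟨j', -, e⟩
        simp at e
      · rintro _ (⟨j, -, rfl⟩ | ⟨j, -, rfl⟩) ⟨j', -, e⟩ <;> simp at e
    · rintro ⟨k, j⟩
      fin_cases k
      · exact Multiset.mem_add.2 (.inl (Multiset.mem_add.2 (.inl
          (Multiset.mem_map.2 ⟨j, Multiset.mem_enum _, rfl⟩))))
      · exact Multiset.mem_add.2 (.inl (Multiset.mem_add.2 (.inr
          (Multiset.mem_map.2 ⟨j, Multiset.mem_enum _, rfl⟩))))
      · exact Multiset.mem_add.2 (.inr (Multiset.mem_map.2 ⟨j, Multiset.mem_enum _, rfl⟩))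
  rw [← this, Multiset.map_add, Multiset.map_add, Multiset.map_map, Multiset.map_map,
    Multiset.map_map, enum_fin, enum_fin, enum_fin]
  rfl

theorem enum_thetaV {Y : Type*} (m : Fin 3 → ℕ) (f : ThetaV m → Y) :
    (Multiset.enum (ThetaV m)).map f = f (.inr false) ::ₘ f (.inr true) ::ₘ
      (Multiset.enum (Σ k : Fin 3, Fin (m k))).map (fun u => f (.inl u)) := by
  have : (.inr false ::ₘ .inr true ::ₘ (Multiset.enum (Σ k : Fin 3, Fin (m k))).map .inl :
      Multiset (ThetaV m)) = Multiset.enum _ := by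
    apply Multiset.eq_enum
    · simp [Multiset.nodup_enum.map Sum.inl_injective]
    · rintro (u | c)
      · simp [Multiset.mem_enum]
      · cases c <;> simp
  rw [← this]
  simp [Multiset.map_map]

theorem isModel_theta {p q r : ℕ} (x : Fin p → L) (y : Fin q → L) (z : Fin r → L)
    (F O : Fin 3 → ℕ → ε)
    (hF : ∀ k j k' j', j < ![p, q, r] k → j' < ![p, q, r] k' → F k j = F k' j' → k = k' ∧ j = j')
    (hO : ∀ k j k' j', j ≤ ![p, q, r] k → j' ≤ ![p, q, r] k' → O k j = O k' j' → k = k' ∧ j = j')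
    (hFO : ∀ k j k' j', j < ![p, q, r] k → j' ≤ ![p, q, r] k' → F k j ≠ O k' j') :
    IsModel (theta x y z) (thetaName ![p, q, r] F O)
      ((O 0 0, O 2 0, O 1 0) ::ₘ (O 0 p, O 1 q, O 2 r) ::ₘ
        ((List.ofFn fun j : Fin p => (F 0 j, O 0 j, O 0 (j + 1)) : Multiset (ε × ε × ε)) +
        (List.ofFn fun j : Fin q => (F 1 j, O 1 j, O 1 (j + 1)) : Multiset (ε × ε × ε)) +
        (List.ofFn fun j : Fin r => (F 2 j, O 2 (j + 1), O 2 j) : Multiset (ε × ε × ε))))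
      ((List.ofFn fun j : Fin p => (F 0 j, x j) : Multiset (ε × L)) +
        (List.ofFn fun j : Fin q => (F 1 j, y j) : Multiset (ε × L)) +
        (List.ofFn fun j : Fin r => (F 2 j, z j) : Multiset (ε × L))) := by
  refine ⟨thetaName_eq_iff hF hO hFO, ?_, ?_⟩
  · exact (enum_thetaV ![p, q, r] _).trans (congrArg (fun X => _ ::ₘ _ ::ₘ X) (enum_sigma ![p, q, r] _))
  · exact enum_sigma ![p, q, r] _

/-- The class of the theta graph with lists of labels. -/
noncomputable def thetaCl (n : ℕ) (x y z : List L) : JacobiModule L n 2 :=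
  (theta x.get y.get z.get).cl n 2

theorem cl_theta {p q r : ℕ} (x : Fin p → L) (y : Fin q → L) (z : Fin r → L) :
    (theta x y z).cl n 2 = thetaCl n (List.ofFn x) (List.ofFn y) (List.ofFn z) := by
  have key : ∀ {m : ℕ} (x : Fin m → L), (⟨m, x⟩ : Σ m, Fin m → L) =
      ⟨(List.ofFn x).length, (List.ofFn x).get⟩ := fun x =>
    List.ofFn_inj'.1 (by rw [List.ofFn_get])
  have := congrArg (fun w : (Σ m, Fin m → L) × (Σ m, Fin m → L) × (Σ m, Fin m → L) =>
    (theta w.1.2 w.2.1.2 w.2.2.2).cl n 2) (Prod.ext (key x) (Prod.ext (key y) (key z)) :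
      ((⟨p, x⟩ : Σ m, Fin m → L), (⟨q, y⟩ : Σ m, Fin m → L), (⟨r, z⟩ : Σ m, Fin m → L)) =
      (⟨_, (List.ofFn x).get⟩, ⟨_, (List.ofFn y).get⟩, ⟨_, (List.ofFn z).get⟩))
  exact this

/-- The trivalent vertices of a theta graph with left half-edges `s, t, u` of the strands. -/
def thetaTriples (s t u : ε) (A B C : List (ε × ε)) : Multiset (ε × ε × ε) :=
  (s, u, t) ::ₘ (strandEnd s A, strandEnd t B, strandEnd u C) ::ₘ
    ((strand s A : Multiset (ε × ε × ε)) + (strand t B : Multiset (ε × ε × ε)) +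
      (lowerStrand u C : Multiset (ε × ε × ε)))

/-- The names of the edges of a theta graph. -/
def thetaNames (s t u : ε) (A B C : List (ε × ε)) : List ε :=
  ((s :: A.map Prod.snd) ++ (t :: B.map Prod.snd) ++ (u :: C.map Prod.snd)) ++
    (A.map Prod.fst ++ B.map Prod.fst ++ C.map Prod.fst)

theorem getD_append_inj {l : Fin 3 → List ε} {d : ε} (h : (l 0 ++ l 1 ++ l 2).Nodup) :
    ∀ k j k' j', j < (l k).length → j' < (l k').length →
      (l k).getD j d = (l k').getD j' d → k = k' ∧ j = j' := by
  intro k j k' j' hj hj' e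
  rw [List.getD_eq_getElem _ _ hj, List.getD_eq_getElem _ _ hj'] at e
  simp only [List.nodup_append, List.mem_append] at h
  obtain ⟨⟨h0, h1, h01⟩, h2, h012⟩ := h
  have m1 := List.getElem_mem hj
  have m2 := List.getElem_mem hj'
  have nd : (l k).Nodup := by fin_cases k <;> assumption
  by_cases hk : k = k'
  · subst hk
    exact ⟨rfl, nd.getElem_inj_iff.1 e⟩
  · exfalso
    fin_cases k <;> fin_cases k' <;> simp only [Fin.zero_eta, Fin.mk_one, Fin.reduceFinMk,
      not_true_eq_false] at hk m1 m2 e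
    · exact h01 _ m1 _ m2 e
    · exact h012 _ (.inl m1) _ m2 e
    · exact h01 _ m2 _ m1 e.symm
    · exact h012 _ (.inr m1) _ m2 e
    · exact h012 _ (.inl m2) _ m1 e.symm
    · exact h012 _ (.inr m2) _ m1 e.symm

/-- Distinctness of the names is all that is needed to recognise a theta graph from its description.
-/
theorem ncl_theta {s t u : ε} {A B C : List (L × ε × ε)}
    (hd : (thetaNames s t u (A.map Prod.snd) (B.map Prod.snd) (C.map Prod.snd)).Nodup) :
    ncl n 2 (thetaTriples s t u (A.map Prod.snd) (B.map Prod.snd) (C.map Prod.snd))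
      ((strandLegs A : Multiset (ε × L)) + (strandLegs B : Multiset (ε × L)) +
        (strandLegs C : Multiset (ε × L))) =
      thetaCl n (A.map Prod.fst) (B.map Prod.fst) (C.map Prod.fst) := by
  rw [thetaNames, List.nodup_append] at hd
  obtain ⟨hO, hF, hOF⟩ := hd
  set lF : Fin 3 → List ε := ![(A.map Prod.snd).map Prod.fst, (B.map Prod.snd).map Prod.fst,
    (C.map Prod.snd).map Prod.fst] with hlF
  set lO : Fin 3 → List ε := ![s :: (A.map Prod.snd).map Prod.snd, t :: (B.map Prod.snd).map Prod.snd,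
    u :: (C.map Prod.snd).map Prod.snd] with hlO
  set m := ![A.length, B.length, C.length] with hm
  have lenF : ∀ k, (lF k).length = m k := by
    intro k; fin_cases k <;> simp [lF, m]
  have lenO : ∀ k, (lO k).length = m k + 1 := by
    intro k; fin_cases k <;> simp [lO, m]
  have memF : ∀ k, ∀ x ∈ lF k, x ∈ (A.map Prod.snd).map Prod.fst ++ (B.map Prod.snd).map Prod.fst ++
    (C.map Prod.snd).map Prod.fst := by
    intro k x hx
    simp only [List.mem_append]
    fin_cases k
    · exact .inl (.inl hx)
    · exact .inl (.inr hx)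
    · exact .inr hx
  have memO : ∀ k, ∀ x ∈ lO k, x ∈ (s :: (A.map Prod.snd).map Prod.snd) ++
      (t :: (B.map Prod.snd).map Prod.snd) ++ (u :: (C.map Prod.snd).map Prod.snd) := by
    intro k x hx
    rw [List.mem_append, List.mem_append]
    fin_cases k
    · exact .inl (.inl hx)
    · exact .inl (.inr hx)
    · exact .inr hx
  have h := isModel_theta (fun j : Fin A.length => A[j].1) (fun j : Fin B.length => B[j].1)
    (fun j : Fin C.length => C[j].1) (fun k j => (lF k).getD j s) (fun k j => (lO k).getD j s)
    (fun k j k' j' h1 h2 e => getD_append_inj (l := lF) (d := s) hF k j k' j' (by rw [lenF]; exact h1)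
      (by rw [lenF]; exact h2) e)
    (fun k j k' j' h1 h2 e => getD_append_inj (l := lO) (d := s) hO k j k' j'
      (by rw [lenO]; exact Nat.lt_succ_of_le h1) (by rw [lenO]; exact Nat.lt_succ_of_le h2) e)
    (fun k j k' j' h1 h2 e => by
      have h1' : j < (lF k).length := by rw [lenF]; exact h1
      have h2' : j' < (lO k').length := by rw [lenO]; exact Nat.lt_succ_of_le h2
      rw [List.getD_eq_getElem _ _ h1', List.getD_eq_getElem _ _ h2'] at e
      exact hOF _ (memO k' _ (List.getElem_mem h2')) _ (memF k _ (List.getElem_mem h1')) e.symm)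
  have labs : ∀ R : List (L × ε × ε), List.ofFn (fun j : Fin R.length => R[j].1) = R.map Prod.fst := by
    intro R; apply List.ext_getElem <;> simp
  have legs : ∀ (R : List (L × ε × ε)) (f : List ε), f = (R.map Prod.snd).map Prod.fst →
      List.ofFn (fun j : Fin R.length => (f.getD j s, R[j].1)) = strandLegs R := by
    rintro R _ rfl
    apply List.ext_getElem
    · simp [strandLegs]
    · intro j h1 h2
      simp [strandLegs]
  have getD_eq : ∀ (l : List ε) (j : ℕ) (d d' : ε), j < l.length → l.getD j d = l.getD j d' := by
    intro l j d d' hj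
    rw [List.getD_eq_getElem _ _ hj, List.getD_eq_getElem _ _ hj]
  have str : ∀ (a : ε) (R : List (L × ε × ε)), List.ofFn (fun j : Fin R.length =>
      (((R.map Prod.snd).map Prod.fst).getD j s, (a :: (R.map Prod.snd).map Prod.snd).getD j s,
        (a :: (R.map Prod.snd).map Prod.snd).getD (j + 1) s)) = strand a (R.map Prod.snd) := by
    intro a R
    apply List.ext_getElem
    · simp [length_strand]
    · intro j h1 h2
      have : j < R.length := by simpa using h1
      rw [getElem_strand, List.getElem_ofFn]
      rw [getD_eq _ j s a (by simpa), getD_eq _ j s a (by simp; omega),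
        getD_eq _ (j + 1) s a (by simpa)]
  have lstr : ∀ (a : ε) (R : List (L × ε × ε)), List.ofFn (fun j : Fin R.length =>
      (((R.map Prod.snd).map Prod.fst).getD j s, (a :: (R.map Prod.snd).map Prod.snd).getD (j + 1) s,
        (a :: (R.map Prod.snd).map Prod.snd).getD j s)) = lowerStrand a (R.map Prod.snd) := by
    intro a R
    apply List.ext_getElem
    · simp [length_lowerStrand]
    · intro j h1 h2
      have : j < R.length := by simpa using h1
      rw [getElem_lowerStrand, List.getElem_ofFn]
      rw [getD_eq _ j s a (by simpa), getD_eq _ j s a (by simp; omega),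
        getD_eq _ (j + 1) s a (by simpa)]
  have ends : ∀ (a : ε) (R : List (L × ε × ε)), (a :: (R.map Prod.snd).map Prod.snd).getD R.length s =
      strandEnd a (R.map Prod.snd) := by
    intro a R
    rw [strandEnd_eq, List.length_map]
    exact getD_eq _ _ _ _ (by simp)
  have h1 := cl_theta (n := n) (fun j : Fin A.length => A[j].1) (fun j : Fin B.length => B[j].1)
    (fun j : Fin C.length => C[j].1)
  rw [labs, labs, labs, ← h.ncl_eq] at h1
  rw [← h1, legs A (lF 0) rfl, legs B (lF 1) rfl, legs C (lF 2) rfl, thetaTriples]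
  congr 1
  rw [← str s A, ← str t B, ← lstr u C, ← ends s A, ← ends t B, ← ends u C]
  rfl

end JacobiDiagram

namespace JacobiDiagram

variable {L ε : Type} {n : ℕ} {b : ℤ}

/-! ### The names in strands -/

/-- The names at the trivalent vertices. -/
def tripleNames (T : Multiset (ε × ε × ε)) : Multiset ε := T.bind fun t => {t.1, t.2.1, t.2.2}

theorem names_eq (T : Multiset (ε × ε × ε)) (S : Multiset (ε × L)) :
    names T S = tripleNames T + S.map Prod.fst := rfl

theorem tripleNames_add (T T' : Multiset (ε × ε × ε)) :
    tripleNames (T + T') = tripleNames T + tripleNames T' := Multiset.add_bind _ _ _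

theorem tripleNames_cons (x y z : ε) (T : Multiset (ε × ε × ε)) :
    tripleNames ((x, y, z) ::ₘ T) = {x, y, z} + tripleNames T := Multiset.cons_bind _ _ _

theorem mem_tripleNames {T : Multiset (ε × ε × ε)} {x : ε} :
    x ∈ tripleNames T ↔ ∃ t ∈ T, x = t.1 ∨ x = t.2.1 ∨ x = t.2.2 := by
  simp only [tripleNames, Multiset.mem_bind, Multiset.insert_eq_cons, Multiset.mem_cons,
    Multiset.mem_singleton]

/-- Each outgoing edge occurs again as the next incoming edge, except for the last one. Adding the
end on the left compensates for this and avoids subtraction. -/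
theorem tripleNames_strand (s : ε) (r : List (ε × ε)) :
    tripleNames (strand s r : Multiset (ε × ε × ε)) + {strandEnd s r} =
      {s} + (r.map Prod.fst : Multiset ε) + 2 • (r.map Prod.snd : Multiset ε) := by
  induction r generalizing s with
  | nil => rfl
  | cons t r ih =>
    obtain ⟨f, o⟩ := t
    simp only [strand, strandEnd, List.map_cons, ← Multiset.cons_coe, tripleNames_cons]
    rw [add_assoc, ih]
    simp only [Multiset.insert_eq_cons, ← Multiset.singleton_add]
    simp only [two_nsmul]
    abel

theorem tripleNames_lowerStrand (s : ε) (r : List (ε × ε)) :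
    tripleNames (lowerStrand s r : Multiset (ε × ε × ε)) + {strandEnd s r} =
      {s} + (r.map Prod.fst : Multiset ε) + 2 • (r.map Prod.snd : Multiset ε) := by
  induction r generalizing s with
  | nil => rfl
  | cons t r ih =>
    obtain ⟨f, o⟩ := t
    simp only [lowerStrand, strandEnd, List.map_cons, ← Multiset.cons_coe, tripleNames_cons]
    rw [add_assoc, ih]
    simp only [Multiset.insert_eq_cons, ← Multiset.singleton_add]
    simp only [two_nsmul]
    abel

theorem map_fst_strandLegs (R : List (L × ε × ε)) :
    (strandLegs R : Multiset (ε × L)).map Prod.fst = ((R.map Prod.snd).map Prod.fst : Multiset ε) := by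
  simp [strandLegs, Function.comp_def]

/-- Every name of a diagram occurs exactly twice. The distinctness hypotheses of `ncl_wheel` and
`ncl_theta` are thus obtained from the mere existence of a diagram with the given description. -/
theorem IsModel.nodup_of_names_eq {J : JacobiDiagram L} {ν : J.H → ε} {T : Multiset (ε × ε × ε)}
    {S : Multiset (ε × L)} (h : IsModel J ν T S) {X : Multiset ε} (hX : names T S = 2 • X) :
    X.Nodup := by
  classical
  rw [Multiset.nodup_iff_count_le_one]
  intro x
  by_cases hx : x ∈ X
  · have h1 := h.count_names (x := x) (by rw [hX, two_nsmul]; exact Multiset.mem_add.2 (.inl hx))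
    rw [hX, Multiset.count_nsmul] at h1
    omega
  · rw [Multiset.count_eq_zero_of_notMem hx]; omega

theorem names_theta (s t u : ε) (A B C : List (L × ε × ε)) :
    names (thetaTriples s t u (A.map Prod.snd) (B.map Prod.snd) (C.map Prod.snd))
      ((strandLegs A : Multiset (ε × L)) + (strandLegs B : Multiset (ε × L)) +
        (strandLegs C : Multiset (ε × L))) =
      2 • (thetaNames s t u (A.map Prod.snd) (B.map Prod.snd) (C.map Prod.snd) : Multiset ε) := by
  rw [names_eq, thetaTriples, tripleNames_cons, tripleNames_cons, tripleNames_add, tripleNames_add,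
    Multiset.map_add, Multiset.map_add, map_fst_strandLegs, map_fst_strandLegs, map_fst_strandLegs]
  have h1 := tripleNames_strand s (A.map Prod.snd)
  have h2 := tripleNames_strand t (B.map Prod.snd)
  have h3 := tripleNames_lowerStrand u (C.map Prod.snd)
  have h4 : (thetaNames s t u (A.map Prod.snd) (B.map Prod.snd) (C.map Prod.snd) : Multiset ε) =
      {s} + ((A.map Prod.snd).map Prod.snd : Multiset ε) + ({t} +
      ((B.map Prod.snd).map Prod.snd : Multiset ε)) + ({u} +
      ((C.map Prod.snd).map Prod.snd : Multiset ε)) + ((((A.map Prod.snd).map Prod.fst : List ε) :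
      Multiset ε) + ((B.map Prod.snd).map Prod.fst : Multiset ε) +
      ((C.map Prod.snd).map Prod.fst : Multiset ε)) := by
    simp only [thetaNames, Multiset.singleton_add, Multiset.cons_coe, Multiset.coe_add]
  rw [h4]
  simp only [two_nsmul] at h1 h2 h3 ⊢
  have h123 := congrArg₂ (· + ·) (congrArg₂ (· + ·) h1 h2) h3
  have key : ∀ a b c : ε, ({a, b, c} : Multiset ε) = {a} + {b} + {c} := fun a b c => by
    simp only [Multiset.insert_eq_cons, ← Multiset.singleton_add, add_assoc]
  rw [key, key]
  generalize (tripleNames (strand s (A.map Prod.snd) : Multiset (ε × ε × ε))) = X1 at *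
  generalize (tripleNames (strand t (B.map Prod.snd) : Multiset (ε × ε × ε))) = X2 at *
  generalize (tripleNames (lowerStrand u (C.map Prod.snd) : Multiset (ε × ε × ε))) = X3 at *
  calc _ = ({s} + {u} + {t}) + (X1 + {strandEnd s (A.map Prod.snd)} + (X2 +
        {strandEnd t (B.map Prod.snd)}) + (X3 + {strandEnd u (C.map Prod.snd)})) +
        (((A.map Prod.snd).map Prod.fst : Multiset ε) + ((B.map Prod.snd).map Prod.fst : Multiset ε) +
        ((C.map Prod.snd).map Prod.fst : Multiset ε)) := by abel
    _ = _ := by rw [h123]; abel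

/-! ### Moving legs in theta graphs -/

/-- Names for the legs and edges of a strand. -/
def nameStrand (k : Fin 3) (a : List L) : List (L × (Fin 3 × ℕ × Bool) × (Fin 3 × ℕ × Bool)) :=
  a.zipIdx.map fun x => (x.1, (k, x.2, false), (k, x.2 + 1, true))

theorem nameStrand_fst (k : Fin 3) (a : List L) : (nameStrand k a).map Prod.fst = a := by
  simp [nameStrand, Function.comp_def]

theorem nameStrand_snd_fst (k : Fin 3) (a : List L) :
    ((nameStrand k a).map Prod.snd).map Prod.fst = (List.range a.length).map fun j => (k, j, false) := by
  apply List.ext_getElem <;> simp [nameStrand]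

theorem nameStrand_snd_snd (k : Fin 3) (a : List L) :
    (k, 0, true) :: ((nameStrand k a).map Prod.snd).map Prod.snd =
      (List.range (a.length + 1)).map fun j => (k, j, true) := by
  apply List.ext_getElem
  · simp [nameStrand]
  · intro j h1 h2
    rcases j with _ | j <;> simp [nameStrand]

theorem nodup_thetaNames (a c d : List L) :
    (thetaNames (0, 0, true) (1, 0, true) (2, 0, true) ((nameStrand 0 a).map Prod.snd)
      ((nameStrand 1 c).map Prod.snd) ((nameStrand 2 d).map Prod.snd)).Nodup := by
  rw [thetaNames, nameStrand_snd_snd, nameStrand_snd_snd, nameStrand_snd_snd, nameStrand_snd_fst,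
    nameStrand_snd_fst, nameStrand_snd_fst]
  have h : ∀ (k : Fin 3) (m : ℕ) (c : Bool), ((List.range m).map fun j => (k, j, c)).Nodup :=
    fun k m c => List.nodup_range.map fun i j e => by simpa using e
  simp only [List.nodup_append, h, List.mem_append, List.mem_map]
  refine ⟨⟨⟨trivial, trivial, ?_⟩, trivial, ?_⟩, ⟨⟨trivial, trivial, ?_⟩, trivial, ?_⟩, ?_⟩
  · rintro _ ⟨j, -, rfl⟩ _ ⟨j', -, rfl⟩; simp
  · rintro _ (⟨j, -, rfl⟩ | ⟨j, -, rfl⟩) _ ⟨j', -, rfl⟩ <;> simp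
  · rintro _ ⟨j, -, rfl⟩ _ ⟨j', -, rfl⟩; simp
  · rintro _ (⟨j, -, rfl⟩ | ⟨j, -, rfl⟩) _ ⟨j', -, rfl⟩ <;> simp
  · rintro _ ((⟨j, -, rfl⟩ | ⟨j, -, rfl⟩) | ⟨j, -, rfl⟩) _ ((⟨j', -, rfl⟩ | ⟨j', -, rfl⟩) |
      ⟨j', -, rfl⟩) <;> simp

theorem exists_thetaNames (a c d : List L) : ∃ (ε : Type) (s t u : ε) (A B C : List (L × ε × ε)),
    A.map Prod.fst = a ∧ B.map Prod.fst = c ∧ C.map Prod.fst = d ∧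
      (thetaNames s t u (A.map Prod.snd) (B.map Prod.snd) (C.map Prod.snd)).Nodup :=
  ⟨_, _, _, _, _, _, _, nameStrand_fst 0 a, nameStrand_fst 1 c, nameStrand_fst 2 d,
    nodup_thetaNames a c d⟩

/-- Moving the first leg of the upper strand to the other strands. -/
theorem thetaCl_move (x : L) (a c d : List L) :
    thetaCl n (x :: a) c d = thetaCl n a c (x :: d) - thetaCl n a (x :: c) d := by
  obtain ⟨ε, s, t, u, A', B, C, hA, rfl, rfl, hd⟩ := exists_thetaNames (x :: a) c d
  rcases A' with _ | ⟨⟨x', f, o⟩, A⟩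
  · simp at hA
  obtain ⟨rfl, rfl⟩ : x' = x ∧ A.map Prod.fst = a := by simpa using hA
  -- In both new theta graphs the upper strand starts with `o`, and the old first edge `s` becomes
  -- the first edge of the strand that receives the leg. The set of names does not change.
  have p1 : (thetaNames o t s (A.map Prod.snd) (B.map Prod.snd)
      (((x', f, u) :: C).map Prod.snd)).Nodup := by
    refine (List.Perm.nodup_iff ?_).1 hd
    rw [← Multiset.coe_eq_coe]
    simp only [thetaNames, List.map_cons, ← Multiset.coe_add, ← Multiset.cons_coe]
    simp only [← Multiset.singleton_add]
    abel
  have p2 : (thetaNames o s u (A.map Prod.snd) (((x', f, t) :: B).map Prod.snd)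
      (C.map Prod.snd)).Nodup := by
    refine (List.Perm.nodup_iff ?_).1 hd
    rw [← Multiset.coe_eq_coe]
    simp only [thetaNames, List.map_cons, ← Multiset.coe_add, ← Multiset.cons_coe]
    simp only [← Multiset.singleton_add]
    abel
  have e0 := ncl_theta (n := n) hd
  have e1 := ncl_theta (n := n) p1
  have e2 := ncl_theta (n := n) p2
  simp only [List.map_cons, strandLegs, ← Multiset.cons_coe, thetaTriples, strand, lowerStrand,
    strandEnd, Multiset.cons_add, Multiset.add_cons] at e0 e1 e2
  rw [← e0, ← e1, ← e2]
  set q := (strandEnd o (A.map Prod.snd), strandEnd t (B.map Prod.snd), strandEnd u (C.map Prod.snd))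
  set T := (strand o (A.map Prod.snd) : Multiset (ε × ε × ε)) +
    (strand t (B.map Prod.snd) : Multiset (ε × ε × ε)) +
    (lowerStrand u (C.map Prod.snd) : Multiset (ε × ε × ε))
  -- IHX at the edge `s`, which joins the left endpoint to the first vertex of the upper strand.
  have h0 := ncl_ihx (n := n) (b := 2) (T := q ::ₘ T) (S := (f, x') ::ₘ
    ((A.map fun t => (t.2.1, t.1) : List (ε × L)) + (B.map fun t => (t.2.1, t.1) : List (ε × L)) +
    (C.map fun t => (t.2.1, t.1) : List (ε × L)) : Multiset (ε × L))) s u t o f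
  rw [ncl_rot₂ (s, u, t) s o f, ncl_rot₂ (s, u, t) o f s, ncl_rot (s) t o, ncl_rot t o s,
    ncl_rot₂ _ s u f, ncl_rot₂ _ u f s, ncl_flip₂ _ f s u, ncl_rot s o u, ncl_rot₂ _ s t f,
    ncl_rot₂ _ t f s] at h0
  rw [Multiset.cons_swap q (f, s, o), Multiset.cons_swap q (f, u, s), Multiset.cons_swap q (f, s, t),
    ← sub_eq_zero, ← h0]
  abel

/-- Interchanging the middle and the lower strand reverses the two endpoints and the vertex that
carries `x`; three signs make `-1`. -/
theorem thetaCl_swap (x : L) (a : List L) : thetaCl n a [x] [] = - thetaCl n a [] [x] := by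
  obtain ⟨ε, s, t, u, A, B', C', rfl, hB, hC, hd⟩ := exists_thetaNames a [x] []
  obtain ⟨f, o, rfl⟩ : ∃ f o, B' = [(x, f, o)] := by
    obtain ⟨⟨x', f, o⟩, rfl, hx⟩ := List.map_eq_singleton_iff.1 hB
    exact ⟨f, o, by rw [← hx]⟩
  obtain rfl : C' = [] := by simpa using hC
  have p1 : (thetaNames s u t (A.map Prod.snd) (([] : List (L × ε × ε)).map Prod.snd)
      ([(x, f, o)].map Prod.snd)).Nodup := by
    refine (List.Perm.nodup_iff ?_).1 hd
    rw [← Multiset.coe_eq_coe]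
    simp only [thetaNames, List.map_cons, ← Multiset.coe_add, ← Multiset.cons_coe]
    simp only [← Multiset.singleton_add]
    abel
  have e0 := ncl_theta (n := n) hd
  have e1 := ncl_theta (n := n) p1
  simp only [List.map_cons, List.map_nil, strandLegs, ← Multiset.cons_coe, thetaTriples, strand,
    lowerStrand, strandEnd, Multiset.add_cons, Multiset.coe_nil, add_zero]
    at e0 e1
  rw [← e0, ← e1, ncl_flip, ncl_flip₂, ncl_flip₃]
  simp

/-- Reading a strand backwards. -/
theorem exists_reverse_strand (s : ε) (R : List (L × ε × ε)) : ∃ R' : List (L × ε × ε),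
    R'.map Prod.fst = (R.map Prod.fst).reverse ∧
    strandEnd (strandEnd s (R.map Prod.snd)) (R'.map Prod.snd) = s ∧
    (lowerStrand (strandEnd s (R.map Prod.snd)) (R'.map Prod.snd) : Multiset (ε × ε × ε)) =
      strand s (R.map Prod.snd) ∧
    (strandLegs R' : Multiset (ε × L)) = strandLegs R := by
  induction R generalizing s with
  | nil => exact ⟨[], rfl, rfl, rfl, rfl⟩
  | cons t R ih =>
    obtain ⟨x, f, o⟩ := t
    obtain ⟨R', h1, h2, h3, h4⟩ := ih o
    refine ⟨R' ++ [(x, f, s)], ?_, ?_, ?_, ?_⟩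
    · simp [h1]
    · simp [strandEnd, strandEnd_append]
    · simp only [List.map_append, List.map_cons, List.map_nil, strandEnd, lowerStrand_append, strand,
        ← Multiset.coe_add, h3, h2, lowerStrand, ← Multiset.cons_coe, ← Multiset.singleton_add]
      rw [add_comm]; rfl
    · have : strandLegs (R' ++ [(x, f, s)]) = strandLegs R' ++ [(f, x)] := by simp [strandLegs]
      rw [this, ← Multiset.coe_add, h4, add_comm]
      rfl

theorem names_wheel {s : ε} {R : List (L × ε × ε)} (hs : strandEnd s (R.map Prod.snd) = s) :
    names (strand s (R.map Prod.snd) : Multiset (ε × ε × ε)) (strandLegs R : Multiset (ε × L)) =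
      2 • ((R.map (fun t => t.2.1) : Multiset ε) + (R.map (fun t => t.2.2) : Multiset ε)) := by
  have h := tripleNames_strand s (R.map Prod.snd)
  rw [hs] at h
  rw [names_eq, map_fst_strandLegs]
  simp only [List.map_map, Function.comp_def, two_nsmul] at h ⊢
  rw [← add_left_inj {s}, add_right_comm, h]
  abel

/-- A strand with distinct names is closed up by letting its last edge be the first one as well. The
spare names `X`, `Y`, `Z` are meant for the sides of a triangle. -/
theorem exists_wheelNames (a : List L) : ∃ (ε : Type) (s X Y Z : ε) (R : List (L × ε × ε)),
    R.map Prod.fst = a ∧ (a ≠ [] → strandEnd s (R.map Prod.snd) = s) ∧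
    (X :: Y :: Z :: ((R.map fun t => t.2.1) ++ (R.map fun t => t.2.2))).Nodup := by
  have h := nameStrand_snd_fst 0 a
  have h' := congrArg List.tail (nameStrand_snd_snd 0 a)
  simp only [List.map_map, Function.comp_def, List.tail_cons] at h h'
  refine ⟨_, strandEnd (0, 0, true) ((nameStrand 0 a).map Prod.snd), (1, 0, true), (1, 1, true),
    (1, 2, true), nameStrand 0 a, nameStrand_fst 0 a, fun ha => ?_, ?_⟩
  · rcases a with _ | ⟨x, a⟩
    · exact absurd rfl ha
    · rfl
  · have key : ((nameStrand 0 a).map (fun t => t.2.1) ++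
        (nameStrand 0 a).map (fun t => t.2.2)).Nodup := by
      rw [h, h', List.nodup_append]
      refine ⟨List.nodup_range.map fun i j e => by simpa using e,
        (List.nodup_range.map fun i j e => by simpa using e).tail, ?_⟩
      rintro _ h1 _ h2
      obtain ⟨j, -, rfl⟩ := List.mem_map.1 h1
      obtain ⟨j', -, rfl⟩ := List.mem_map.1 (List.mem_of_mem_tail h2)
      simp
    have new : ∀ j, ((1 : Fin 3), j, true) ∉ (nameStrand 0 a).map (fun t => t.2.1) ++
        (nameStrand 0 a).map (fun t => t.2.2) := by
      intro j hj
      rw [h, h', List.mem_append] at hj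
      rcases hj with hj | hj
      · obtain ⟨j, -, e⟩ := List.mem_map.1 hj; simp at e
      · obtain ⟨j, -, e⟩ := List.mem_map.1 (List.mem_of_mem_tail hj); simp at e
    simp only [List.nodup_cons, List.mem_cons, new, key]
    simp

/-- The blow-up of a wheel is a theta graph. -/
theorem exists_cl_blowUp_wheel (x : L) (a : List L) : ∃ (m : ℕ) (y : Fin m → L) (v : Fin m),
    List.ofFn y = x :: a ∧
      ∀ n, ((wheel y).blowUp v).cl n 2 = thetaCl n [x] [] a.reverse := by
  classical
  obtain ⟨ε, s, X, Y, Z, R', hR, hs, hd⟩ := exists_wheelNames (x :: a)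
  rcases R' with _ | ⟨⟨x', f, o⟩, R⟩
  · simp at hR
  obtain ⟨rfl, rfl⟩ : x' = x ∧ R.map Prod.fst = a := by simpa using hR
  have hs' := hs (by simp)
  simp only [List.nodup_cons (a := X), List.nodup_cons (a := Y), List.nodup_cons (a := Z),
    List.mem_cons (b := Y), List.mem_cons (b := Z), not_or] at hd
  obtain ⟨⟨hXY, hXZ, hX⟩, ⟨hYZ, hY⟩, hZ, hd⟩ := hd
  obtain ⟨ν, h⟩ := isModel_strand_wheel hs' hd
  have hν : ∀ {W}, W ∉ (((x', f, o) :: R).map fun t => t.2.1) ++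
      (((x', f, o) :: R).map fun t => t.2.2) → ∀ k, W ≠ ν k := by
    rintro W hW k rfl
    have hk : ν k ∈ names (strand s (((x', f, o) :: R).map Prod.snd) : Multiset (ε × ε × ε))
        (strandLegs ((x', f, o) :: R) : Multiset (ε × L)) := by
      rw [h.names_eq]; exact Multiset.mem_map_of_mem _ (Multiset.mem_enum _)
    rw [names_wheel hs', two_nsmul, Multiset.mem_add, or_self, Multiset.coe_add] at hk
    exact hW hk
  have h' := h
  simp only [List.map_cons, strand, ← Multiset.cons_coe] at h'
  obtain ⟨v, hv, hT⟩ := h'.exists_vertex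
  rw [tripleOf_eq_iff] at hv
  obtain ⟨hv0, hv1, hv2⟩ := hv
  obtain ⟨μ, hμ⟩ := h.exists_blowUp v 0 hXY hYZ hXZ (hν hX) (hν hY) (hν hZ)
  have e1 : (0 : Fin 3) + 1 = 1 := rfl
  have e2 : (0 : Fin 3) + 2 = 2 := rfl
  simp only [e1, e2, hv0, hv1, hv2, hT] at hμ
  refine ⟨_, fun j : Fin ((x', f, o) :: R).length => ((x', f, o) :: R)[j].1, v,
    by apply List.ext_getElem <;> simp, fun n => ?_⟩
  obtain ⟨C, hC1, hC2, hC3, hC4⟩ := exists_reverse_strand o R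
  have hos : strandEnd o (R.map Prod.snd) = s := hs'
  rw [hos] at hC2 hC3
  -- The sides `X` and `Z` of the triangle form the upper strand with the leg `f`, the side `Y` is
  -- the empty middle strand, and the rest of the wheel, read backwards from `s` to `o`, is the
  -- lower strand.
  have key : ((f, X, Z) ::ₘ (X, s, Y) ::ₘ (Z, Y, o) ::ₘ (strand o (R.map Prod.snd) :
      Multiset (ε × ε × ε))) = thetaTriples X Y s ([(x', f, Z)].map Prod.snd)
        (([] : List (L × ε × ε)).map Prod.snd) (C.map Prod.snd) := by
    simp only [thetaTriples, List.map_cons, List.map_nil, strandEnd, hC2, strand, hC3,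
      ← Multiset.cons_coe, Multiset.coe_nil, add_zero, Multiset.cons_add, zero_add]
    rw [Multiset.cons_swap (f, X, Z), Multiset.cons_swap (f, X, Z)]
  have hS : (strandLegs ((x', f, o) :: R) : Multiset (ε × L)) = (strandLegs [(x', f, Z)] :
      Multiset (ε × L)) + (strandLegs ([] : List (L × ε × ε)) : Multiset (ε × L)) +
      (strandLegs C : Multiset (ε × L)) := by
    rw [hC4]; rfl
  have hnd : (thetaNames X Y s ([(x', f, Z)].map Prod.snd)
        (([] : List (L × ε × ε)).map Prod.snd) (C.map Prod.snd)).Nodup := by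
    rw [← Multiset.coe_nodup]
    refine hμ.nodup_of_names_eq ?_
    rw [← names_theta, ← hS, ← key]
    simp only [names_eq, tripleNames_cons]
    simp only [Multiset.insert_eq_cons, ← Multiset.singleton_add]
    abel
  have := ncl_theta (n := n) hnd
  rw [← hS, ← key, hC1] at this
  rw [← hμ.ncl_eq, ncl_rot₂ _ s Y X, ncl_rot₂ _ Y X s, ncl_rot₃]
  exact this

end JacobiDiagram

namespace JacobiDiagram

variable {L ε : Type} {n : ℕ} {b : ℤ} {T : Multiset (ε × ε × ε)} {S : Multiset (ε × L)}

/-! ### Reduction to diagrams with a cycle through all trivalent vertices -/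

/-- In membership proofs a description may therefore be assumed to come from a connected diagram of
the right type, to which the counting lemmas apply. -/
theorem ncl_eq_zero_or (n : ℕ) (b : ℤ) (T : Multiset (ε × ε × ε)) (S : Multiset (ε × L)) :
    ncl n b T S = 0 ∨ ∃ (J : JacobiDiagram L) (ν : J.H → ε), IsModel J ν T S ∧ J.IsConn n b := by
  by_cases h : ∃ (J : JacobiDiagram L) (ν : J.H → ε), IsModel J ν T S
  · obtain ⟨J, ν, h⟩ := h
    by_cases hJ : J.IsConn n b
    · exact .inr ⟨J, ν, h, hJ⟩
    · exact .inl (by rw [h.ncl_eq, cl_of_not_isConn hJ])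
  · exact .inl (ncl_of_not h)

/-- A vertex incident to `x` is turned until `x` comes first and is taken out of `T`; the strict
decrease drives the inductions below. -/
theorem exists_ncl_rot {x : ε} (hx : x ∈ tripleNames T) : ∃ c d T', T' < T ∧
    ∀ (n : ℕ) (b : ℤ) (X : Multiset (ε × ε × ε)) (S : Multiset (ε × L)),
      ncl n b (X + T) S = ncl n b ((x, c, d) ::ₘ (X + T')) S := by
  obtain ⟨⟨p, q, r⟩, ht, h⟩ := mem_tripleNames.1 hx
  obtain ⟨T', rfl⟩ := Multiset.exists_cons_of_mem ht
  rcases h with rfl | rfl | rfl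
  · exact ⟨q, r, T', Multiset.lt_cons_self _ _, fun n b X S => by rw [Multiset.add_cons]⟩
  · exact ⟨r, p, T', Multiset.lt_cons_self _ _, fun n b X S => by rw [Multiset.add_cons, ncl_rot]⟩
  · exact ⟨p, q, T', Multiset.lt_cons_self _ _,
      fun n b X S => by rw [Multiset.add_cons, ncl_rot, ncl_rot]⟩

/-- IHX at a side edge `f` of a path that enters by `i` and leaves by `o`. In both terms on the
right the path runs through `f` and so contains one more vertex. -/
theorem ncl_insert (f i o c d : ε) :
    ncl n b ((f, c, d) ::ₘ (f, i, o) ::ₘ T) S =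
      ncl n b ((d, i, f) ::ₘ (c, f, o) ::ₘ T) S - ncl n b ((c, i, f) ::ₘ (d, f, o) ::ₘ T) S := by
  have h := ncl_ihx (n := n) (b := b) (T := T) (S := S) f i o c d
  rw [ncl_rot₂ _ f i d, ncl_rot₂ _ i d f, ncl_flip₂ _ d f i, ncl_rot f o c, ncl_rot o c f,
    ncl_rot f c i, ncl_rot₂ _ f o d, ncl_rot₂ _ o d f] at h
  rw [Multiset.cons_swap, Multiset.cons_swap (d, i, f), ← sub_eq_zero, ← h]
  abel

theorem coe_strand_append_cons (s f o : ε) (r₁ r₂ : List (ε × ε)) :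
    (strand s (r₁ ++ (f, o) :: r₂) : Multiset (ε × ε × ε)) =
      (f, strandEnd s r₁, o) ::ₘ ((strand s r₁ : Multiset (ε × ε × ε)) +
        (strand o r₂ : Multiset (ε × ε × ε))) := by
  rw [strand_append, ← Multiset.coe_add, strand, ← Multiset.cons_coe, Multiset.add_cons]

theorem ncl_strand_insert (s f o c d : ε) (r₁ r₂ : List (ε × ε)) :
    ncl n b ((f, c, d) ::ₘ ((strand s (r₁ ++ (f, o) :: r₂) : Multiset (ε × ε × ε)) + T)) S =
      ncl n b ((strand s (r₁ ++ (d, f) :: (c, o) :: r₂) : Multiset (ε × ε × ε)) + T) S -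
      ncl n b ((strand s (r₁ ++ (c, f) :: (d, o) :: r₂) : Multiset (ε × ε × ε)) + T) S := by
  simp only [coe_strand_append_cons, strand, ← Multiset.cons_coe, Multiset.cons_add,
    Multiset.add_cons]
  rw [ncl_insert, Multiset.cons_swap (d, _, _), Multiset.cons_swap (c, _, _)]

/-- If `n`, `b` is the type of a connected diagram and no side edge of a cycle continues to other
vertices, there are no other vertices. -/
theorem IsModel.eq_zero_of_disjoint {J : JacobiDiagram L} {ν : J.H → ε} {T' : Multiset (ε × ε × ε)}
    (h : IsModel J ν (T + T') S) (hJ : J.Connected) (hT : T ≠ 0)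
    (hd : ∀ x ∈ tripleNames T, x ∉ tripleNames T') :
    T' = 0 ∧ ∀ s ∈ S, s.1 ∈ tripleNames T := by
  obtain ⟨t, ht⟩ := Multiset.exists_mem_of_ne_zero hT
  have h1 : ∀ t ∈ T, t.1 ∈ tripleNames T ∧ t.2.1 ∈ tripleNames T ∧ t.2.2 ∈ tripleNames T :=
    fun t ht => ⟨mem_tripleNames.2 ⟨t, ht, .inl rfl⟩, mem_tripleNames.2 ⟨t, ht, .inr (.inl rfl)⟩,
      mem_tripleNames.2 ⟨t, ht, .inr (.inr rfl)⟩⟩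
  have h2 : ∀ t ∈ T', t.1 ∉ tripleNames T ∧ t.2.1 ∉ tripleNames T ∧ t.2.2 ∉ tripleNames T :=
    fun t ht => ⟨fun h' => hd _ h' (mem_tripleNames.2 ⟨t, ht, .inl rfl⟩),
      fun h' => hd _ h' (mem_tripleNames.2 ⟨t, ht, .inr (.inl rfl)⟩),
      fun h' => hd _ h' (mem_tripleNames.2 ⟨t, ht, .inr (.inr rfl)⟩)⟩
  have key := h.mem_of_connected hJ {x | x ∈ tripleNames T} (fun t ht => ?_)
    (Multiset.mem_add.2 (.inl ht)) (h1 t ht).1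
  · refine ⟨Multiset.eq_zero_of_forall_notMem fun t ht => ?_, key.2⟩
    exact (h2 t ht).1 (key.1 t (Multiset.mem_add.2 (.inr ht)))
  · rcases Multiset.mem_add.1 ht with ht | ht
    · have := h1 t ht
      simp [this]
    · have := h2 t ht
      simp [this]

theorem count_tripleNames_strand [DecidableEq ε] (s : ε) (r : List (ε × ε)) (x : ε) :
    (tripleNames (strand s r : Multiset (ε × ε × ε))).count x + (if x = strandEnd s r then 1 else 0) =
      (if x = s then 1 else 0) + (r.map Prod.fst).count x + 2 * (r.map Prod.snd).count x := by
  have := congrArg (Multiset.count x) (tripleNames_strand s r)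
  simp only [Multiset.count_add, Multiset.count_singleton, Multiset.count_nsmul,
    Multiset.coe_count] at this
  exact this

theorem IsModel.count_le {J : JacobiDiagram L} {ν : J.H → ε} [DecidableEq ε]
    (h : IsModel J ν T S) (x : ε) : (tripleNames T).count x + (S.map Prod.fst).count x = 2 ∨
      (tripleNames T).count x + (S.map Prod.fst).count x = 0 := by
  by_cases hx : x ∈ names T S
  · have := h.count_names hx
    rw [JacobiDiagram.names_eq, Multiset.count_add] at this
    exact .inl this
  · have := Multiset.count_eq_zero_of_notMem hx
    rw [JacobiDiagram.names_eq, Multiset.count_add] at this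
    exact .inr this

theorem exists_eq_append_of_not_nodup {r : List (ε × ε)} (h : ¬ (r.map Prod.fst).Nodup) :
    ∃ r₁ r₂ r₃ f o o', r = r₁ ++ (f, o) :: (r₂ ++ (f, o') :: r₃) := by
  induction r with
  | nil => simp at h
  | cons p r ih =>
    obtain ⟨f, o⟩ := p
    by_cases hf : f ∈ r.map Prod.fst
    · obtain ⟨⟨f', o'⟩, hp, rfl⟩ := List.mem_map.1 hf
      obtain ⟨r₁, r₂, rfl⟩ := List.append_of_mem hp
      exact ⟨[], r₁, r₂, f', o, o', rfl⟩
    · obtain ⟨r₁, r₂, r₃, f', o', o'', rfl⟩ := ih fun h' => h (List.nodup_cons.2 ⟨hf, h'⟩)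
      exact ⟨(f, o) :: r₁, r₂, r₃, f', o', o'', rfl⟩

section reduction

variable {M : Submodule ℤ (JacobiModule L n b)}

theorem strand_ne_zero {s : ε} {r : List (ε × ε)} (hr : r ≠ []) :
    (strand s r : Multiset (ε × ε × ε)) ≠ 0 := by
  rcases r with _ | ⟨⟨f, o⟩, r⟩
  · exact absurd rfl hr
  · simp [strand]

/-- Strong induction on the vertices off the cycle. A side edge that leads off the cycle lets IHX
absorb one of them; if there is no such edge, connectedness leaves no vertex off the cycle. -/
theorem ncl_cycle_add_mem (hM : ∀ (s : ε) (r : List (ε × ε)), r ≠ [] → strandEnd s r = s →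
    ncl n b (strand s r : Multiset (ε × ε × ε)) S ∈ M) (T : Multiset (ε × ε × ε)) :
    ∀ (s : ε) (r : List (ε × ε)), r ≠ [] → strandEnd s r = s →
      ncl n b ((strand s r : Multiset (ε × ε × ε)) + T) S ∈ M := by
  classical
  induction T using Multiset.strongInductionOn with
  | ih T ih =>
    intro s r hr hs
    by_cases h : ∃ p ∈ r, p.1 ∈ tripleNames T
    · obtain ⟨⟨f, o⟩, hp, hf⟩ := h
      obtain ⟨r₁, r₂, rfl⟩ := List.append_of_mem hp
      obtain ⟨c, d, T', hT', e⟩ := exists_ncl_rot (L := L) hf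
      have hs' : ∀ g g' : ε, strandEnd s (r₁ ++ (g, f) :: (g', o) :: r₂) = s := fun g g' => by
        rw [strandEnd_append] at hs ⊢; exact hs
      rw [e, ncl_strand_insert]
      exact M.sub_mem (ih T' hT' _ _ (by simp) (hs' _ _)) (ih T' hT' _ _ (by simp) (hs' _ _))
    · push Not at h
      rcases ncl_eq_zero_or n b ((strand s r : Multiset (ε × ε × ε)) + T) S with e | ⟨J, ν, hν, hJ⟩
      · rw [e]; exact M.zero_mem
      · have : T = 0 := by
          -- A cycle edge that is not a side edge already has both its ends on the cycle, so a third
          -- occurrence in `T` is impossible.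
          refine (hν.eq_zero_of_disjoint hJ.1 (strand_ne_zero hr) fun x hx hx' => ?_).1
          have h1 := count_tripleNames_strand s r x
          have h2 := hν.count_le x
          rw [tripleNames_add, Multiset.count_add] at h2
          have h3 := Multiset.one_le_count_iff_mem.2 hx
          have h4 := Multiset.one_le_count_iff_mem.2 hx'
          have h5 : (r.map Prod.fst).count x = 0 := by
            rw [List.count_eq_zero]
            intro h5
            obtain ⟨p, hp, rfl⟩ := List.mem_map.1 h5
            exact h p hp hx'
          rw [hs] at h1
          omega
        rw [this, add_zero]
        exact hM s r hr hs

/-- Grow a path until a cycle appears. A cycle is found if the path closes up, if an end edge is a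
side edge of the path, or if two of its vertices share a side edge. Otherwise an end edge or a side
edge leading to `T` makes the path longer, by extension or by insertion. If none of this is
possible, the diagram is a tree, contrary to `1 ≤ b`. -/
theorem ncl_path_add_mem (hb : 1 ≤ b) (hM : ∀ (s : ε) (r : List (ε × ε)), r ≠ [] →
    strandEnd s r = s → ncl n b (strand s r : Multiset (ε × ε × ε)) S ∈ M)
    (T : Multiset (ε × ε × ε)) : ∀ (s : ε) (r : List (ε × ε)), r ≠ [] →
      ncl n b ((strand s r : Multiset (ε × ε × ε)) + T) S ∈ M := by
  classical
  induction T using Multiset.strongInductionOn with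
  | ih T ih =>
    intro s r hr
    by_cases hse : strandEnd s r = s
    · exact ncl_cycle_add_mem hM T s r hr hse
    by_cases hsf : ∃ p ∈ r, p.1 = s
    · obtain ⟨⟨f, o⟩, hp, rfl⟩ := hsf
      obtain ⟨r₁, r₂, rfl⟩ := List.append_of_mem hp
      rw [coe_strand_append_cons, Multiset.cons_add, ncl_rot, ncl_rot, ncl_flip]
      -- The first edge returns to the path as a side edge. The cycle consists of the path up to
      -- that vertex, whose former outgoing edge `o` becomes a side edge; the rest of the path joins
      -- the remaining vertices.
      convert M.neg_mem (ncl_cycle_add_mem hM ((strand o r₂ : Multiset (ε × ε × ε)) + T) f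
        (r₁ ++ [(o, f)]) (by simp) (by simp [strandEnd_append, strandEnd])) using 3
      rw [coe_strand_append_cons, Multiset.cons_add, strand, Multiset.coe_nil, add_zero, add_assoc]
    by_cases hef : ∃ p ∈ r, p.1 = strandEnd s r
    · obtain ⟨⟨f, o⟩, hp, he⟩ := hef
      obtain ⟨r₁, r₂, rfl⟩ := List.append_of_mem hp
      have he' : strandEnd o r₂ = f := by rw [strandEnd_append] at he; exact he.symm
      rw [coe_strand_append_cons, Multiset.cons_add, ncl_rot, ncl_flip]
      convert M.neg_mem (ncl_cycle_add_mem hM ((strand s r₁ : Multiset (ε × ε × ε)) + T) f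
        ((strandEnd s r₁, o) :: r₂) (by simp) he') using 3
      rw [strand, ← Multiset.cons_coe, Multiset.cons_add]
      congr 1
      abel
    by_cases hnd : (r.map Prod.fst).Nodup
    swap
    · obtain ⟨r₁, r₂, r₃, f, o, o', rfl⟩ := exists_eq_append_of_not_nodup hnd
      rw [coe_strand_append_cons, coe_strand_append_cons, Multiset.add_cons, Multiset.cons_add,
        Multiset.cons_add, ncl_rot, ncl_flip, ncl_rot₂, ncl_rot₂, ncl_flip₂, neg_neg]
      convert ncl_cycle_add_mem hM ((strand s r₁ : Multiset (ε × ε × ε)) +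
        (strand o' r₃ : Multiset (ε × ε × ε)) + T) f ((strandEnd s r₁, o) :: (r₂ ++ [(o', f)]))
        (by simp) (by simp [strandEnd, strandEnd_append]) using 2
      rw [strand, ← Multiset.cons_coe, coe_strand_append_cons]
      simp only [Multiset.cons_add, strand, Multiset.coe_nil, add_zero]
      congr 2
      abel
    by_cases hs : s ∈ tripleNames T
    · obtain ⟨c, d, T', hT', e⟩ := exists_ncl_rot (L := L) hs
      rw [e, ncl_rot, ncl_rot, ncl_flip]
      convert M.neg_mem (ih T' hT' c ((d, s) :: r) (by simp)) using 3
      rw [strand, ← Multiset.cons_coe, Multiset.cons_add]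
    by_cases he : strandEnd s r ∈ tripleNames T
    · obtain ⟨c, d, T', hT', e⟩ := exists_ncl_rot (L := L) he
      rw [e, ncl_rot, ncl_flip]
      convert M.neg_mem (ih T' hT' s (r ++ [(c, d)]) (by simp)) using 3
      rw [coe_strand_append_cons, strand, Multiset.coe_nil, add_zero, Multiset.cons_add]
    by_cases hf : ∃ p ∈ r, p.1 ∈ tripleNames T
    · obtain ⟨⟨f, o⟩, hp, hf⟩ := hf
      obtain ⟨r₁, r₂, rfl⟩ := List.append_of_mem hp
      obtain ⟨c, d, T', hT', e⟩ := exists_ncl_rot (L := L) hf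
      rw [e, ncl_strand_insert]
      exact M.sub_mem (ih T' hT' _ _ (by simp)) (ih T' hT' _ _ (by simp))
    rcases ncl_eq_zero_or n b ((strand s r : Multiset (ε × ε × ε)) + T) S with e | ⟨J, ν, hν, hJ⟩
    · rw [e]; exact M.zero_mem
    exfalso
    push Not at hf hsf hef
    have hsf' : s ∉ r.map Prod.fst := fun h => by
      obtain ⟨p, hp, e⟩ := List.mem_map.1 h
      exact hsf p hp e
    have hef' : strandEnd s r ∉ r.map Prod.fst := fun h => by
      obtain ⟨p, hp, e⟩ := List.mem_map.1 h
      exact hef p hp e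
    have h0 : T = 0 := by
      refine (hν.eq_zero_of_disjoint hJ.1 (strand_ne_zero hr) fun x hx hx' => ?_).1
      have h1 := count_tripleNames_strand s r x
      have h2 := hν.count_le x
      rw [tripleNames_add, Multiset.count_add] at h2
      have h3 := Multiset.one_le_count_iff_mem.2 hx
      have h4 := Multiset.one_le_count_iff_mem.2 hx'
      have h5 : (r.map Prod.fst).count x = 0 := by
        rw [List.count_eq_zero]
        intro h5
        obtain ⟨p, hp, rfl⟩ := List.mem_map.1 h5
        exact hf p hp hx'
      rw [if_neg, if_neg] at h1
      · omega
      · rintro rfl; exact hs hx'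
      · rintro rfl; exact he hx'
    subst h0
    obtain ⟨c1, c2⟩ := hν.card_of_isConn hJ
    rw [add_zero] at hν c1
    -- The two end edges and the `n` side edges would be distinct legs, whereas `n = |S| + 2 (b -
    -- 1)` with `1 ≤ b` allows at most `n` legs.
    have h1 : ((s :: strandEnd s r :: r.map Prod.fst : List ε) : Multiset ε) ≤ S.map Prod.fst := by
      rw [Multiset.le_iff_subset]
      · intro x hx
        rw [← Multiset.one_le_count_iff_mem]
        have h1 := count_tripleNames_strand s r x
        have h2 := hν.count_le x
        have h3 : ∀ {x}, x ∉ r.map Prod.fst → (r.map Prod.fst).count x = 0 := List.count_eq_zero.2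
        rcases List.mem_cons.1 (Multiset.mem_coe.1 hx) with rfl | hx
        · rw [if_neg (Ne.symm hse), if_pos rfl, h3] at h1
          · omega
          · exact hsf'
        rcases List.mem_cons.1 hx with rfl | hx
        · rw [if_neg hse, if_pos rfl, h3] at h1
          · omega
          · exact hef'
        · have h4 := List.count_eq_one_of_mem hnd hx
          obtain ⟨p, hp, rfl⟩ := List.mem_map.1 hx
          rw [if_neg (hef p hp), if_neg (hsf p hp)] at h1
          omega
      · rw [Multiset.coe_nodup, List.nodup_cons, List.nodup_cons]
        refine ⟨?_, ?_, hnd⟩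
        · simp only [List.mem_cons, not_or]
          exact ⟨Ne.symm hse, hsf'⟩
        · exact hef'
    have h2 := Multiset.card_le_card h1
    simp only [Multiset.coe_card, List.length_cons, List.length_map, Multiset.card_map,
      length_strand] at h2 c1
    omega

theorem ncl_mem (hb : 1 ≤ b) (hn : 1 ≤ n) (hM : ∀ (s : ε) (r : List (ε × ε)), r ≠ [] →
    strandEnd s r = s → ncl n b (strand s r : Multiset (ε × ε × ε)) S ∈ M)
    (T : Multiset (ε × ε × ε)) : ncl n b T S ∈ M := by
  rcases ncl_eq_zero_or n b T S with e | ⟨J, ν, hν, hJ⟩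
  · rw [e]; exact M.zero_mem
  · obtain ⟨c1, -⟩ := hν.card_of_isConn hJ
    obtain ⟨⟨x, y, z⟩, ht⟩ := Multiset.card_pos_iff_exists_mem.1 (by omega : 0 < T.card)
    obtain ⟨T', rfl⟩ := Multiset.exists_cons_of_mem ht
    -- A single vertex is a path with one side edge.
    exact ncl_path_add_mem hb hM T' y [(x, z)] (by simp)

theorem eq_top_of_cycle_mem (hb : 1 ≤ b) (hn : 1 ≤ n)
    (hM : ∀ (ε : Type) (S : Multiset (ε × L)) (s : ε) (r : List (ε × ε)), r ≠ [] →
      strandEnd s r = s → ncl n b (strand s r : Multiset (ε × ε × ε)) S ∈ M) : M = ⊤ := by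
  rw [eq_top_iff]
  rintro x -
  obtain ⟨x, rfl⟩ := Submodule.Quotient.mk_surjective _ x
  induction x using Finsupp.induction_linear with
  | zero => exact M.zero_mem
  | add x y hx hy => exact M.add_mem hx hy
  | single J k =>
    have e : (Submodule.Quotient.mk (single J k) : JacobiModule L n b) = k • J.cls := by
      rw [ConnDiagram.cls, ← Submodule.Quotient.mk_smul, Finsupp.smul_single, smul_eq_mul, mul_one]
    rw [e]
    refine M.smul_mem _ ?_
    have := (exists_isModel J.1).ncl_eq (n := n) (b := b)
    rw [cl_of_isConn J.2] at this
    change _ = J.cls at this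
    rw [← this]
    exact ncl_mem hb hn (hM _ _) _

end reduction

end JacobiDiagram

namespace JacobiDiagram

variable {L ε : Type} {n : ℕ} {b : ℤ} {T : Multiset (ε × ε × ε)} {S : Multiset (ε × L)}

/-! ### Generators in loop numbers one and two -/

theorem exists_strandLegs_eq {r : List (ε × ε)} (h : S.map Prod.fst = (r.map Prod.fst : Multiset ε)) :
    ∃ R : List (L × ε × ε), R.map Prod.snd = r ∧ (strandLegs R : Multiset (ε × L)) = S := by
  classical
  induction r generalizing S with
  | nil => exact ⟨[], rfl, by simpa [strandLegs, eq_comm] using h⟩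
  | cons p r ih =>
    obtain ⟨f, o⟩ := p
    have hf : f ∈ S.map Prod.fst := by rw [h]; simp
    obtain ⟨⟨f', x⟩, hx, rfl⟩ := Multiset.mem_map.1 hf
    obtain ⟨S', rfl⟩ := Multiset.exists_cons_of_mem hx
    simp only [Multiset.map_cons, List.map_cons, ← Multiset.cons_coe, Multiset.cons_inj_right] at h
    obtain ⟨R, rfl, rfl⟩ := ih h
    exact ⟨(x, f', o) :: R, rfl, rfl⟩

/-- In a cycle through all trivalent vertices, the side edges are legs or chords. -/
theorem IsModel.count_cycle {J : JacobiDiagram L} {ν : J.H → ε} [DecidableEq ε] {s : ε}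
    {r : List (ε × ε)} (h : IsModel J ν (strand s r : Multiset (ε × ε × ε)) S) (hJ : J.Connected)
    (hr : r ≠ []) (hs : strandEnd s r = s) (x : ε) :
    (r.map Prod.fst).count x = (S.map Prod.fst).count x ∧ (S.map Prod.fst).count x ≤ 1 ∨
      (r.map Prod.fst).count x = 2 ∧ (S.map Prod.fst).count x = 0 := by
  have h1 := count_tripleNames_strand s r x
  have h2 := h.count_le x
  rw [hs] at h1
  by_cases hx : x ∈ S.map Prod.fst
  · have h' : IsModel J ν ((strand s r : Multiset (ε × ε × ε)) + 0) S := by rwa [add_zero]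
    obtain ⟨y, hy, rfl⟩ := Multiset.mem_map.1 hx
    have h3 := Multiset.one_le_count_iff_mem.2 hx
    have h4 := Multiset.one_le_count_iff_mem.2
      ((h'.eq_zero_of_disjoint hJ (strand_ne_zero hr) (by simp [tripleNames])).2 y hy)
    omega
  · have h3 := Multiset.count_eq_zero_of_notMem hx
    omega

/-- With Betti number one there are as many legs as trivalent vertices, so the count leaves no room
for chords: every side edge of the cycle is a leg. -/
theorem ncl_cycle_one {s : ε} {r : List (ε × ε)} (hr : r ≠ []) (hs : strandEnd s r = s) :
    ncl n 1 (strand s r : Multiset (ε × ε × ε)) S = 0 ∨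
      ∃ a, ncl n 1 (strand s r : Multiset (ε × ε × ε)) S = wheelCl n a := by
  classical
  rcases ncl_eq_zero_or n 1 (strand s r : Multiset (ε × ε × ε)) S with e | ⟨J, ν, hν, hJ⟩
  · exact .inl e
  right
  obtain ⟨c1, c2⟩ := hν.card_of_isConn hJ
  have e : S.map Prod.fst = (r.map Prod.fst : Multiset ε) := by
    refine Multiset.eq_of_le_of_card_le (Multiset.le_iff_count.2 fun x => ?_) ?_
    · rw [Multiset.coe_count]
      have := hν.count_cycle hJ.1 hr hs x
      omega
    · simp only [Multiset.coe_card, length_strand, List.length_map, Multiset.card_map] at c1 ⊢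
      omega
  obtain ⟨R, rfl, rfl⟩ := exists_strandLegs_eq e
  refine ⟨R.map Prod.fst, ncl_wheel hs ?_⟩
  rw [← Multiset.coe_nodup, ← Multiset.coe_add]
  exact hν.nodup_of_names_eq (names_wheel hs)

/-- The chord `y` is the empty middle strand. Of the two arcs that it cuts off, `A` becomes the
upper strand and `B`, read backwards, the lower one. -/
theorem ncl_cycle_chord {i o o' y : ε} {A B : List (ε × ε)}
    (hi : strandEnd o' B = i) (hS : S.map Prod.fst = ((A ++ B).map Prod.fst : Multiset ε))
    {J : JacobiDiagram L} {ν : J.H → ε}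
    (hν : IsModel J ν (strand i ((y, o) :: (A ++ (y, o') :: B)) : Multiset (ε × ε × ε)) S) :
    ∃ a c, a.length = A.length ∧
      ncl n 2 (strand i ((y, o) :: (A ++ (y, o') :: B)) : Multiset (ε × ε × ε)) S =
        thetaCl n a [] c := by
  obtain ⟨R, hR, rfl⟩ := exists_strandLegs_eq hS
  obtain ⟨A, B, rfl, rfl, rfl⟩ := List.map_eq_append_iff.1 hR
  obtain ⟨C, hC1, hC2, hC3, hC4⟩ := exists_reverse_strand o' B
  rw [hi] at hC2 hC3
  have hS : (strandLegs (A ++ B) : Multiset (ε × L)) = (strandLegs A : Multiset (ε × L)) +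
      (strandLegs ([] : List (L × ε × ε)) : Multiset (ε × L)) + (strandLegs C : Multiset (ε × L)) := by
    rw [hC4]; simp [strandLegs]
  have key : thetaTriples o y i (A.map Prod.snd) (([] : List (L × ε × ε)).map Prod.snd)
      (C.map Prod.snd) = (o, i, y) ::ₘ (strandEnd o (A.map Prod.snd), y, o') ::ₘ
        ((strand o (A.map Prod.snd) : Multiset (ε × ε × ε)) +
          (strand o' (B.map Prod.snd) : Multiset (ε × ε × ε))) := by
    simp only [thetaTriples, List.map_nil, strandEnd, hC2, hC3, strand, Multiset.coe_nil, add_zero]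
  have hT : (strand i ((y, o) :: (A.map Prod.snd ++ (y, o') :: B.map Prod.snd)) :
      Multiset (ε × ε × ε)) = (y, i, o) ::ₘ (y, strandEnd o (A.map Prod.snd), o') ::ₘ
        ((strand o (A.map Prod.snd) : Multiset (ε × ε × ε)) +
          (strand o' (B.map Prod.snd) : Multiset (ε × ε × ε))) := by
    rw [strand, ← Multiset.cons_coe, coe_strand_append_cons]
  refine ⟨A.map Prod.fst, C.map Prod.fst, by simp, ?_⟩
  rw [hT] at hν ⊢
  have hnd : (thetaNames o y i (A.map Prod.snd) (([] : List (L × ε × ε)).map Prod.snd)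
      (C.map Prod.snd)).Nodup := by
    rw [← Multiset.coe_nodup]
    refine hν.nodup_of_names_eq ?_
    rw [← names_theta, ← hS, key]
    simp only [names_eq, tripleNames_cons]
    simp only [Multiset.insert_eq_cons, ← Multiset.singleton_add]
    abel
  have := ncl_theta (n := n) hnd
  rw [← hS, key] at this
  rw [ncl_flip, ncl_rot, ncl_flip₂, ncl_rot₂, ncl_rot₂, neg_neg]
  exact this

theorem strandEnd_rotate {s : ε} {r₁ r₂ : List (ε × ε)} (hs : strandEnd s (r₁ ++ r₂) = s) :
    strandEnd (strandEnd s r₁) (r₂ ++ r₁) = strandEnd s r₁ := by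
  rw [strandEnd_append] at hs ⊢
  rw [hs]

theorem coe_strand_rotate {s : ε} {r₁ r₂ : List (ε × ε)} (hs : strandEnd s (r₁ ++ r₂) = s) :
    (strand s (r₁ ++ r₂) : Multiset (ε × ε × ε)) = strand (strandEnd s r₁) (r₂ ++ r₁) := by
  rw [strandEnd_append] at hs
  rw [strand_append, strand_append, hs, ← Multiset.coe_add, ← Multiset.coe_add, add_comm]

/-- With Betti number two there are two legs fewer than trivalent vertices, so the cycle has exactly
one chord. From `3 ≤ n` there is at least one leg, and an arc that carries a leg is chosen as upper
strand. -/
theorem ncl_cycle_two (hn : 3 ≤ n) {s : ε} {r : List (ε × ε)} (hr : r ≠ [])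
    (hs : strandEnd s r = s) :
    ncl n 2 (strand s r : Multiset (ε × ε × ε)) S = 0 ∨
      ∃ a c, a ≠ [] ∧ ncl n 2 (strand s r : Multiset (ε × ε × ε)) S = thetaCl n a [] c := by
  classical
  rcases ncl_eq_zero_or n 2 (strand s r : Multiset (ε × ε × ε)) S with e | ⟨J, ν, hν, hJ⟩
  · exact .inl e
  right
  obtain ⟨c1, c2⟩ := hν.card_of_isConn hJ
  have hc := hν.count_cycle hJ.1 hr hs
  have hle : S.map Prod.fst ≤ (r.map Prod.fst : Multiset ε) :=
    Multiset.le_iff_count.2 fun x => by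
      rw [Multiset.coe_count]
      have := hc x
      omega
  obtain ⟨D, hD⟩ := Multiset.le_iff_exists_add.1 hle
  have hD2 : D.card = 2 := by
    have := congrArg Multiset.card hD
    simp only [Multiset.coe_card, length_strand, List.length_map, Multiset.card_map,
      Multiset.card_add] at c1 this
    omega
  obtain ⟨y, y', rfl⟩ := Multiset.card_eq_two.1 hD2
  -- A side edge that is not a leg occurs twice, so the two surplus entries coincide.
  obtain rfl : y' = y := by
    by_contra hy
    have h1 := hc y
    have h2 := congrArg (Multiset.count y) hD
    rw [Multiset.coe_count, Multiset.count_add] at h2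
    simp [Ne.symm hy] at h2
    omega
  have hnd : ¬ (r.map Prod.fst).Nodup := by
    rw [← Multiset.coe_nodup, hD]
    intro h
    have := (Multiset.nodup_add.1 h).2.1
    simp at this
  obtain ⟨r₁, A, r₃, f, o, o', rfl⟩ := exists_eq_append_of_not_nodup hnd
  obtain rfl : y' = f := by
    by_contra hy
    have h1 := hc f
    have h2 := congrArg (Multiset.count f) hD
    rw [Multiset.coe_count, Multiset.count_add] at h2
    have h4 : ∀ p q : ε, List.count f (List.map Prod.fst (r₁ ++ (f, p) :: (A ++ (f, q) :: r₃))) ≥ 2 := by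
      intro p q; simp; omega
    have h4 := h4 o o'
    have h5 : Multiset.count f {y', y'} = 0 := Multiset.count_eq_zero_of_notMem (by simp [Ne.symm hy])
    omega
  rw [coe_strand_rotate hs] at hν ⊢
  have hs' := strandEnd_rotate hs
  set i := strandEnd s r₁
  have e : (y', o) :: (A ++ (y', o') :: r₃) ++ r₁ = (y', o) :: (A ++ (y', o') :: (r₃ ++ r₁)) := by simp
  rw [e] at hs' hν ⊢
  have hS : S.map Prod.fst = ((A ++ (r₃ ++ r₁)).map Prod.fst : Multiset ε) := by
    simp only [List.map_append, List.map_cons, ← Multiset.coe_add, ← Multiset.cons_coe] at hD ⊢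
    rw [← add_left_inj {y', y'}, ← hD]
    simp only [Multiset.insert_eq_cons, ← Multiset.singleton_add]
    abel
  rw [strandEnd, strandEnd_append, strandEnd] at hs'
  set B := r₃ ++ r₁
  -- If the first arc is empty, starting the cycle at the other end of the chord interchanges the
  -- arcs.
  by_cases hA : A = []
  · have e' : (y', o) :: (A ++ (y', o') :: B) = ((y', o) :: A) ++ (y', o') :: B := rfl
    have hs'' : strandEnd i (((y', o) :: A) ++ (y', o') :: B) = i := by
      rw [strandEnd_append]; exact hs'
    rw [e', coe_strand_rotate hs''] at hν ⊢
    have hend := strandEnd_rotate hs''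
    set i' := strandEnd i ((y', o) :: A)
    rw [strandEnd_append] at hend
    obtain ⟨a, c, ha, h⟩ := ncl_cycle_chord (n := n) (A := B) (B := A) (y := y') (o := o') (o' := o)
      (i := i') rfl (hS.trans (Multiset.coe_eq_coe.2 (List.perm_append_comm.map _))) hν
    refine ⟨a, c, ?_, h⟩
    rintro rfl
    have hB : B = [] := List.length_eq_zero_iff.1 ha.symm
    have := congrArg Multiset.card hS
    simp only [hA, hB, Multiset.card_map, List.append_nil, List.map_nil, Multiset.coe_nil,
      Multiset.card_zero] at this
    omega
  · obtain ⟨a, c, ha, h⟩ := ncl_cycle_chord (n := n) hs' hS hν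
    refine ⟨a, c, ?_, h⟩
    rintro rfl
    exact hA (List.length_eq_zero_iff.1 ha.symm)

theorem wheelCl_of_length {a : List L} (h : a.length ≠ n) : wheelCl n a = 0 :=
  cl_of_not_isConn fun hJ => h (by simpa [iDeg, wheel] using hJ.2.1)

theorem thetaCl_of_length {a c d : List L} (h : a.length + c.length + d.length + 2 ≠ n) :
    thetaCl n a c d = 0 :=
  cl_of_not_isConn fun hJ => h ((theta_isConn a.get c.get d.get).2.1.symm.trans hJ.2.1)

theorem thetaCl_mem_thetaSubmodule {a c d : List L} (ha : a ≠ []) (hc : c ≠ []) (hd : d ≠ []) :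
    thetaCl n a c d ∈ thetaSubmodule L n := by
  by_cases h : a.length + c.length + d.length + 2 = n
  · rw [thetaCl, cl_of_isConn (h ▸ theta_isConn a.get c.get d.get)]
    exact Submodule.subset_span ⟨_, _, _, a.get, c.get, d.get, h, List.length_pos_iff.2 ha,
      List.length_pos_iff.2 hc, List.length_pos_iff.2 hd, rfl⟩
  · rw [thetaCl_of_length h]
    exact Submodule.zero_mem _

theorem span_wheelCl (hn : 1 ≤ n) : Submodule.span ℤ {x | ∃ a : List L, x = wheelCl n a} = ⊤ := by
  refine eq_top_of_cycle_mem le_rfl hn fun ε S s r hr hs => ?_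
  rcases ncl_cycle_one (n := n) (S := S) hr hs with h | ⟨a, h⟩
  · rw [h]; exact Submodule.zero_mem _
  · rw [h]; exact Submodule.subset_span ⟨a, rfl⟩

/-- The upper legs are moved to the lower strand one by one. The correction term has three non-empty
strands, or, if the lower strand was empty, it is up to sign again a theta graph with a shorter
upper strand and empty middle strand. -/
theorem thetaCl_mem {M : Submodule ℤ (JacobiModule L n 2)} (hΘ : thetaSubmodule L n ≤ M)
    (hM : ∀ x c, thetaCl n [x] [] c ∈ M) (a c : List L) (ha : a ≠ []) : thetaCl n a [] c ∈ M := by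
  induction a generalizing c with
  | nil => exact absurd rfl ha
  | cons x a ih =>
    by_cases ha : a = []
    · subst ha; exact hM x c
    · rw [thetaCl_move]
      refine M.sub_mem (ih _ ha) ?_
      by_cases hc : c = []
      · subst hc
        rw [thetaCl_swap]
        exact M.neg_mem (ih _ ha)
      · exact hΘ (thetaCl_mem_thetaSubmodule ha (by simp) hc)

theorem range_blowUpMap_sup (hn : 3 ≤ n) (hN : 0 < n - 2) :
    LinearMap.range (ConnDiagram.blowUpMap L (n - 2) n hN) ⊔ thetaSubmodule L n = ⊤ := by
  refine eq_top_of_cycle_mem (by norm_num) (by omega) fun ε S s r hr hs => ?_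
  rcases ncl_cycle_two hn (S := S) hr hs with h | ⟨a, c, ha, h⟩
  · rw [h]; exact Submodule.zero_mem _
  · rw [h]
    refine thetaCl_mem le_sup_right (fun x c => Submodule.mem_sup_left ?_) a c ha
    -- The lower strand is read against the direction of the wheel, hence the reversal.
    obtain ⟨m, y, v, hy, hv⟩ := exists_cl_blowUp_wheel x c.reverse
    have hm : m = c.length + 1 := by simpa using congrArg List.length hy
    rw [List.reverse_reverse] at hv
    by_cases hmn : m = n - 2
    · refine ⟨(ConnDiagram.wheel y (by omega) hmn).cls, ?_⟩
      rw [← hv, ConnDiagram.blowUpMap_cls hN _ v]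
      rfl
    · rw [thetaCl_of_length]
      · exact Submodule.zero_mem _
      · simp; omega

end JacobiDiagram

namespace JacobiDiagram

variable {L ε : Type} {n : ℕ} {b : ℤ}

/-! ### Symmetries of wheels -/

theorem ncl_lowerStrand (s : ε) (r : List (ε × ε)) (T : Multiset (ε × ε × ε)) (S : Multiset (ε × L)) :
    ncl n b ((lowerStrand s r : Multiset (ε × ε × ε)) + T) S =
      (-1 : ℤ) ^ r.length • ncl n b ((strand s r : Multiset (ε × ε × ε)) + T) S := by
  induction r generalizing s T with
  | nil => simp [lowerStrand, strand]
  | cons p r ih =>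
    obtain ⟨f, o⟩ := p
    rw [lowerStrand, strand, ← Multiset.cons_coe, ← Multiset.cons_coe, Multiset.cons_add,
      Multiset.cons_add, ncl_flip, ← Multiset.add_cons, ih, ← Multiset.add_cons, List.length_cons,
      pow_succ]
    simp

theorem wheelCl_append_comm (a c : List L) : wheelCl n (a ++ c) = wheelCl n (c ++ a) := by
  by_cases h : a ++ c = []
  · simp_all
  obtain ⟨ε, s, X, Y, Z, R, hR, hs, hd⟩ := exists_wheelNames (a ++ c)
  obtain ⟨A, C, rfl, rfl, rfl⟩ := List.map_eq_append_iff.1 hR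
  have hd' := (List.nodup_cons.1 (List.nodup_cons.1 (List.nodup_cons.1 hd).2).2).2
  have hs' := hs h
  have e1 := ncl_wheel (n := n) hs' hd'
  rw [List.map_append] at hs'
  have e2 := ncl_wheel (n := n) (R := C ++ A)
    (by rw [List.map_append]; exact strandEnd_rotate hs')
    ((List.Perm.nodup_iff ((List.perm_append_comm.map _).append (List.perm_append_comm.map _))).1 hd')
  rw [List.map_append] at e1 e2
  rw [coe_strand_rotate hs'] at e1
  have e3 : (strandLegs (C ++ A) : Multiset (ε × L)) = strandLegs (A ++ C) :=
    Multiset.coe_eq_coe.2 (List.perm_append_comm.map _)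
  rw [e3] at e2
  rw [← List.map_append, ← e1, e2, ← List.map_append]

theorem wheelCl_isRotated {a c : List L} (h : a ~r c) : wheelCl n a = wheelCl n c := by
  obtain ⟨k, hk, rfl⟩ := List.isRotated_iff_mod.1 h
  rw [List.rotate_eq_drop_append_take hk, ← wheelCl_append_comm, List.take_append_drop]

/-- Going around a wheel backwards reverses the cyclic order at each of its `n` vertices. -/
theorem wheelCl_reverse (a : List L) : wheelCl n a.reverse = (-1 : ℤ) ^ n • wheelCl n a := by
  by_cases hn : a.length = n
  swap
  · rw [wheelCl_of_length hn, wheelCl_of_length (by rwa [List.length_reverse]), smul_zero]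
  by_cases h : a = []
  · subst h; subst hn; simp
  obtain ⟨ε, s, X, Y, Z, R, rfl, hs, hd⟩ := exists_wheelNames a
  have hd' := (List.nodup_cons.1 (List.nodup_cons.1 (List.nodup_cons.1 hd).2).2).2
  have hs' := hs h
  obtain ⟨ν, hν⟩ := isModel_strand_wheel hs' hd'
  obtain ⟨C, h1, h2, h3, h4⟩ := exists_reverse_strand s R
  rw [hs'] at h2 h3
  have hC : (C.map (fun t => t.2.1) ++ C.map (fun t => t.2.2)).Nodup := by
    rw [← Multiset.coe_nodup, ← Multiset.coe_add]
    refine hν.nodup_of_names_eq ?_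
    rw [← names_wheel h2, h4, names_eq, names_eq, ← h3, ← add_left_inj {s}, add_right_comm]
    symm
    rw [add_right_comm]
    have e1 := tripleNames_lowerStrand s (C.map Prod.snd)
    have e2 := tripleNames_strand s (C.map Prod.snd)
    rw [h2] at e1 e2
    rw [e1, e2]
  have e0 := ncl_wheel (n := n) h2 hC
  have e1 := ncl_wheel (n := n) hs' hd'
  have e2 := ncl_lowerStrand (n := n) (b := 1) s (C.map Prod.snd) 0 (strandLegs C : Multiset (ε × L))
  rw [add_zero, add_zero, e0, h3, h4, e1, h1] at e2
  have hl : (C.map Prod.snd).length = n := by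
    rw [← hn]; simpa using congrArg List.length h1
  rw [e2, hl, smul_smul, ← pow_add, Even.neg_one_pow ⟨n, rfl⟩, one_smul]

/-! ### Orbits -/

section orbits

variable {X Y : Type*}

/-- The list `c` is an orbit of `F`, in cyclic order. -/
structure IsOrbit (F : X → X) (c : List X) : Prop where
  ne_nil : c ≠ []
  nodup : c.Nodup
  map_eq : c.map F = c.rotate 1

theorem IsOrbit.rotate {F : X → X} {c : List X} (h : IsOrbit F c) (k : ℕ) :
    IsOrbit F (c.rotate k) :=
  ⟨by simpa using h.ne_nil, by simpa using h.nodup, by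
    rw [List.map_rotate, h.map_eq, List.rotate_rotate, List.rotate_rotate, add_comm]⟩

theorem IsOrbit.isRotated {F : X → X} {c c' : List X} (h : IsOrbit F c) (hc : c ~r c') :
    IsOrbit F c' := by
  obtain ⟨k, rfl⟩ := hc
  exact h.rotate k

theorem IsOrbit.exists_cons {F : X → X} {c : List X} (h : IsOrbit F c) {x : X} (hx : x ∈ c) :
    ∃ l, IsOrbit F (x :: l) ∧ c ~r x :: l := by
  obtain ⟨l₁, l₂, rfl⟩ := List.append_of_mem hx
  have : (l₁ ++ x :: l₂) ~r (x :: l₂ ++ l₁) := List.isRotated_append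
  exact ⟨l₂ ++ l₁, h.isRotated this, this⟩

theorem isOrbit_cons_iff {F : X → X} {x : X} {l : List X} :
    IsOrbit F (x :: l) ↔ (x :: l).Nodup ∧ F x :: l.map F = l ++ [x] :=
  ⟨fun h => ⟨h.nodup, by simpa using h.map_eq⟩, fun h => ⟨by simp, h.1, by simpa using h.2⟩⟩

/-- The equation says that `l` lists the iterates of `F` from `F y` on until `x` is reached. Since
`x` is not in the list, the stopping point is determined. -/
theorem eq_of_map_eq {F : X → X} {x y : X} {l l' : List X} (h : F y :: l.map F = l ++ [x])
    (h' : F y :: l'.map F = l' ++ [x]) (hx : x ∉ l) (hx' : x ∉ l') : l = l' := by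
  induction l generalizing y l' with
  | nil =>
    rcases l' with _ | ⟨z, t⟩
    · rfl
    · simp at h h'
      exact absurd (h.symm.trans h'.1) (fun e => hx' (by simp [e]))
  | cons z t ih =>
    rcases l' with _ | ⟨z', t'⟩
    · simp at h h'
      exact absurd (h'.symm.trans h.1) (fun e => hx (by simp [e]))
    · simp only [List.map_cons, List.cons_append, List.cons.injEq] at h h'
      obtain rfl : z = z' := h.1.symm.trans h'.1
      rw [ih h.2 h'.2 (fun e => hx (by simp [e])) (fun e => hx' (by simp [e]))]

theorem IsOrbit.isRotated_of_mem {F : X → X} {c c' : List X} (h : IsOrbit F c) (h' : IsOrbit F c')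
    {x : X} (hx : x ∈ c) (hx' : x ∈ c') : c ~r c' := by
  obtain ⟨l, hl, e⟩ := h.exists_cons hx
  obtain ⟨l', hl', e'⟩ := h'.exists_cons hx'
  rw [isOrbit_cons_iff] at hl hl'
  have := eq_of_map_eq hl.2 hl'.2 (List.nodup_cons.1 hl.1).1 (List.nodup_cons.1 hl'.1).1
  subst this
  exact e.trans e'.symm

theorem mem_of_map_eq {F : X → X} {x y : X} {l : List X} {A : Set X}
    (hA : ∀ z, z ∈ A → F z ∈ A) (h : F y :: l.map F = l ++ [x]) (hy : y ∈ A) : ∀ z ∈ l, z ∈ A := by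
  induction l generalizing y with
  | nil => simp
  | cons z t ih =>
    simp only [List.map_cons, List.cons_append, List.cons.injEq] at h
    have hz : z ∈ A := h.1 ▸ hA y hy
    intro w hw
    rcases List.mem_cons.1 hw with rfl | hw
    · exact hz
    · exact ih h.2 hz w hw

theorem IsOrbit.subset {F : X → X} {c : List X} (h : IsOrbit F c) {A : Set X}
    (hA : ∀ z, z ∈ A → F z ∈ A) {x : X} (hx : x ∈ c) (hxA : x ∈ A) : ∀ z ∈ c, z ∈ A := by
  obtain ⟨l, hl, e⟩ := h.exists_cons hx
  rw [isOrbit_cons_iff] at hl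
  intro z hz
  rcases List.mem_cons.1 (e.mem_iff.1 hz) with rfl | hz
  · exact hxA
  · exact mem_of_map_eq hA hl.2 hxA z hz

theorem IsOrbit.apply_mem_iff {F : X → X} (hF : Function.Injective F) {c : List X}
    (h : IsOrbit F c) {x : X} : F x ∈ c ↔ x ∈ c := by
  rw [← List.mem_rotate (n := 1), ← h.map_eq, List.mem_map_of_injective hF]

theorem exists_isOrbit [Finite X] {F : X → X} (hF : Function.Injective F) (x : X) :
    ∃ c, IsOrbit F c ∧ x ∈ c := by
  have hx : x ∈ Function.periodicPts F := hF.mem_periodicPts x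
  have hpos := Function.minimalPeriod_pos_of_mem_periodicPts hx
  refine ⟨(List.range (Function.minimalPeriod F x)).map fun k => F^[k] x, ⟨?_, ?_, ?_⟩, ?_⟩
  · simp; omega
  · have := Function.nodup_periodicOrbit (f := F) (x := x)
    rwa [Function.periodicOrbit_def, Cycle.nodup_coe_iff] at this
  · apply List.ext_getElem
    · simp
    · intro i h1 h2
      simp only [List.getElem_map, List.getElem_range, List.getElem_rotate, List.length_map,
        List.length_range, Function.iterate_mod_minimalPeriod_eq]
      rw [Function.iterate_succ_apply']
  · exact List.mem_map.2 ⟨0, by simpa using hpos, rfl⟩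

theorem IsOrbit.map {F : X → X} {G : Y → Y} {c : List X} (h : IsOrbit F c) (e : X ≃ Y)
    (he : ∀ x, e (F x) = G (e x)) : IsOrbit G (c.map e) :=
  ⟨by simpa using h.ne_nil, h.nodup.map e.injective, by
    rw [← List.map_rotate, ← h.map_eq, List.map_map, List.map_map]
    exact List.map_congr_left fun x _ => (he x).symm⟩

theorem IsOrbit.reverse {F : Equiv.Perm X} {c : List X} (h : IsOrbit F c) :
    IsOrbit (F⁻¹ : Equiv.Perm X) c.reverse := by
  obtain ⟨x, l, rfl⟩ := List.exists_cons_of_ne_nil h.ne_nil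
  refine ⟨by simp, List.nodup_reverse.2 h.nodup, ?_⟩
  apply List.map_injective_iff.2 F.injective
  have := (isOrbit_cons_iff.1 h).2
  rw [List.map_map, ← Equiv.Perm.coe_mul, mul_inv_cancel, Equiv.Perm.coe_one, List.map_id,
    List.map_rotate, List.map_reverse, List.map_cons, this]
  simp

theorem IsRotated.filterMap {c c' : List X} (h : c ~r c') (lab : X → Option Y) :
    c.filterMap lab ~r c'.filterMap lab := by
  obtain ⟨k, hk, rfl⟩ := List.isRotated_iff_mod.1 h
  rw [List.rotate_eq_drop_append_take hk]
  conv_lhs => rw [← List.take_append_drop k c]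
  rw [List.filterMap_append, List.filterMap_append]
  exact List.isRotated_append

/-- After composition with the transposition, the predecessor of `h` is sent to `F h` and `h`
becomes a fixed point: the orbit bypasses `h`. Since `h` is unlabelled, the word is unchanged, and
`F h ≠ h` keeps the shortened orbit non-empty. -/
theorem IsOrbit.delete [DecidableEq X] {F : Equiv.Perm X} {h : X} (hF : F h ≠ h) {c : List X}
    (hc : IsOrbit F c) {lab : X → Option Y} (hl : lab h = none) :
    ∃ c', IsOrbit (Equiv.swap h (F h) * F : Equiv.Perm X) c' ∧ (∀ x, x ∈ c' ↔ x ∈ c ∧ x ≠ h) ∧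
      c'.filterMap lab ~r c.filterMap lab := by
  by_cases hh : h ∈ c
  · obtain ⟨l, hl', e⟩ := hc.exists_cons hh
    rw [isOrbit_cons_iff] at hl'
    rcases l with _ | ⟨y, t⟩
    · simp [hF] at hl'
    obtain ⟨hnd, hm⟩ := hl'
    simp only [List.map_cons, List.cons_append, List.cons.injEq] at hm
    obtain ⟨rfl, hm⟩ := hm
    rw [List.nodup_cons] at hnd
    refine ⟨F h :: t, isOrbit_cons_iff.2 ⟨hnd.2, ?_⟩, fun x => ?_, ?_⟩
    · have ht : t.map (Equiv.swap h (F h)) = t := by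
        conv_rhs => rw [← List.map_id t]
        refine List.map_congr_left fun z hz => Equiv.swap_apply_of_ne_of_ne ?_ ?_
        · rintro rfl; exact hnd.1 (by simp [hz])
        · rintro rfl; exact (List.nodup_cons.1 hnd.2).1 hz
      have := congrArg (List.map (Equiv.swap h (F h))) hm
      rw [List.map_append, ht, List.map_cons, List.map_map] at this
      simpa using this
    · rw [e.mem_iff, List.mem_cons (b := h)]
      constructor
      · intro hx
        refine ⟨.inr hx, ?_⟩
        rintro rfl
        exact hnd.1 hx
      · rintro ⟨rfl | hx, hne⟩
        · exact absurd rfl hne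
        · exact hx
    · refine .trans ?_ (IsRotated.filterMap e lab).symm
      rw [List.filterMap_cons_none hl]
  · have hF' : F h ∉ c := fun h' => hh ((hc.apply_mem_iff F.injective).1 h')
    refine ⟨c, ⟨hc.ne_nil, hc.nodup, ?_⟩, fun x => ?_, .refl _⟩
    · rw [Equiv.Perm.coe_mul, ← List.map_map, hc.map_eq]
      conv_rhs => rw [← List.map_id (c.rotate 1)]
      refine List.map_congr_left fun z hz => Equiv.swap_apply_of_ne_of_ne ?_ ?_
      · rintro rfl; exact hh (List.mem_rotate.1 hz)
      · rintro rfl; exact hF' (List.mem_rotate.1 hz)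
    · constructor
      · intro hx
        exact ⟨hx, by rintro rfl; exact hh hx⟩
      · exact fun hx => hx.1

/-! ### Orbits that contain all labels -/

/-- All labelled points lie in one orbit of `F`, some point of `S` does not, and `w` is the word of the
labels on that orbit. -/
def Reads (F : X → X) (lab : X → Option Y) (S : Set X) (w : List Y) : Prop :=
  ∃ c, IsOrbit F c ∧ w = c.filterMap lab ∧ w ≠ [] ∧ (∀ x, lab x ≠ none → x ∈ c) ∧ ∃ z ∈ S, z ∉ c

theorem exists_mem_of_filterMap_ne_nil {c : List X} {lab : X → Option Y}
    (h : c.filterMap lab ≠ []) : ∃ x ∈ c, lab x ≠ none := by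
  by_contra! h'
  exact h (List.filterMap_eq_nil_iff.2 h')

/-- A non-empty word provides a labelled point, which lies on both orbits; so they agree up to
rotation. This makes `readCl` independent of choices, wheels being invariant under rotation. -/
theorem Reads.isRotated {F : X → X} {lab : X → Option Y} {S : Set X} {w w' : List Y}
    (h : Reads F lab S w) (h' : Reads F lab S w') : w ~r w' := by
  obtain ⟨c, hc, rfl, hw, hx, -⟩ := h
  obtain ⟨c', hc', rfl, -, hx', -⟩ := h'
  obtain ⟨x, hxc, hxl⟩ := exists_mem_of_filterMap_ne_nil hw
  exact IsRotated.filterMap (hc.isRotated_of_mem hc' hxc (hx' x hxl)) lab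

open Classical in
/-- The class of the wheel with the word on the orbit of `F` that contains all labels, if there are
such an orbit and a point of `S` outside of it. -/
noncomputable def readCl (N : ℕ) (F : X → X) (lab : X → Option L) (S : Set X) : JacobiModule L N 1 :=
  if h : ∃ w, Reads F lab S w then wheelCl N h.choose else 0

theorem Reads.readCl_eq {N : ℕ} {F : X → X} {lab : X → Option L} {S : Set X} {w : List L}
    (h : Reads F lab S w) : readCl N F lab S = wheelCl N w := by
  have h' : ∃ w, Reads F lab S w := ⟨w, h⟩
  rw [readCl, dif_pos h']
  exact wheelCl_isRotated (h'.choose_spec.isRotated h)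

theorem readCl_of_not {N : ℕ} {F : X → X} {lab : X → Option L} {S : Set X}
    (h : ∀ w, ¬ Reads F lab S w) : readCl N F lab S = 0 :=
  dif_neg fun ⟨w, hw⟩ => h w hw

theorem readCl_congr {N : ℕ} {F : X → X} {lab : X → Option L} {S : Set X} {F' : Y → Y}
    {lab' : Y → Option L} {S' : Set Y} (k : ℤ)
    (h : ∀ w, Reads F lab S w → ∃ w', Reads F' lab' S' w' ∧ wheelCl N w' = k • wheelCl N w)
    (h' : ∀ w, Reads F' lab' S' w → ∃ w', Reads F lab S w') :
    readCl N F' lab' S' = k • readCl N F lab S := by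
  by_cases hw : ∃ w, Reads F lab S w
  · obtain ⟨w, hw⟩ := hw
    obtain ⟨w', hw', e⟩ := h w hw
    rw [hw.readCl_eq, hw'.readCl_eq, e]
  · push Not at hw
    rw [readCl_of_not hw, readCl_of_not, smul_zero]
    intro w hw'
    obtain ⟨w', h''⟩ := h' w hw'
    exact hw _ h''

theorem Reads.map {F : X → X} {G : Y → Y} {lab : X → Option L} {lab' : Y → Option L} {S : Set X}
    {S' : Set Y} (e : X ≃ Y) (he : ∀ x, e (F x) = G (e x)) (hl : ∀ x, lab' (e x) = lab x)
    (hS : ∀ x, x ∈ S → e x ∈ S') {w : List L} (h : Reads F lab S w) : Reads G lab' S' w := by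
  obtain ⟨c, hc, rfl, hw, hx, z, hz, hzc⟩ := h
  refine ⟨c.map e, hc.map e he, ?_, hw, fun y hy => ?_, e z, hS z hz, ?_⟩
  · rw [List.filterMap_map]
    exact List.filterMap_congr fun x _ => (hl x).symm
  · obtain ⟨x, rfl⟩ := e.surjective y
    exact List.mem_map_of_mem (hx x (by rwa [hl] at hy))
  · rwa [List.mem_map_of_injective e.injective]

theorem readCl_map {N : ℕ} {F : X → X} {G : Y → Y} {lab : X → Option L} {lab' : Y → Option L}
    {S : Set X} {S' : Set Y} (e : X ≃ Y) (he : ∀ x, e (F x) = G (e x))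
    (hl : ∀ x, lab' (e x) = lab x) (hS : ∀ x, x ∈ S ↔ e x ∈ S') :
    readCl N G lab' S' = readCl N F lab S := by
  rw [← one_smul ℤ (readCl N F lab S)]
  refine readCl_congr 1 (fun w h => ⟨w, h.map e he hl fun x => (hS x).1, by rw [one_smul]⟩)
    fun w h => ⟨w, h.map e.symm (fun y => ?_) (fun y => ?_) fun y => ?_⟩
  · rw [Equiv.symm_apply_eq, he, Equiv.apply_symm_apply]
  · rw [← hl, Equiv.apply_symm_apply]
  · rw [hS, Equiv.apply_symm_apply]; exact id

theorem Reads.inv {F : Equiv.Perm X} {lab : X → Option L} {S : Set X} {w : List L}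
    (h : Reads F lab S w) : Reads (F⁻¹ : Equiv.Perm X) lab S w.reverse := by
  obtain ⟨c, hc, rfl, hw, hx, z, hz, hzc⟩ := h
  exact ⟨c.reverse, hc.reverse, List.filterMap_reverse.symm, by simpa using hw,
    fun x hx' => List.mem_reverse.2 (hx x hx'), z, hz, by rwa [List.mem_reverse]⟩

/-- The orbits of the inverse are the same ones read backwards, and the sign is that of
`wheelCl_reverse`. -/
theorem readCl_inv {N : ℕ} {F : Equiv.Perm X} {lab : X → Option L} {S : Set X} :
    readCl N (F⁻¹ : Equiv.Perm X) lab S = (-1 : ℤ) ^ N • readCl N F lab S :=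
  readCl_congr _ (fun w h => ⟨w.reverse, h.inv, wheelCl_reverse w⟩)
    fun w h => ⟨w.reverse, by simpa using h.inv⟩

/-- The new fixed point `h` must not count as a second orbit, so it is removed from `S`. Conversely,
if `h` was the point that witnessed a second orbit, then `F h`, which is in `S`, takes its place. -/
theorem readCl_delete [Finite X] [DecidableEq X] {N : ℕ} {F : Equiv.Perm X} {lab : X → Option L}
    {S : Set X} {h : X} (hF : F h ≠ h) (hl : lab h = none) (hS : F h ∈ S) :
    readCl N (Equiv.swap h (F h) * F : Equiv.Perm X) lab (S \ {h}) = readCl N F lab S := by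
  rw [← one_smul ℤ (readCl N F lab S)]
  refine readCl_congr 1 ?_ ?_
  · rintro w ⟨c, hc, rfl, hw, hx, z, hz, hzc⟩
    obtain ⟨c', hc', hm, hr⟩ := hc.delete hF hl
    refine ⟨_, ⟨c', hc', rfl, ?_, fun x hx' => ?_, ?_⟩, by rw [one_smul]; exact wheelCl_isRotated hr⟩
    · intro e
      rw [e, List.isRotated_nil_iff'] at hr
      exact hw hr.symm
    · rw [hm]
      exact ⟨hx x hx', by rintro rfl; exact hx' hl⟩
    · by_cases hzh : z = h
      · subst hzh
        refine ⟨F z, ⟨hS, hF⟩, fun h' => ?_⟩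
        exact hzc ((hc.apply_mem_iff F.injective).1 ((hm _).1 h').1)
      · exact ⟨z, ⟨hz, hzh⟩, fun h' => hzc ((hm _).1 h').1⟩
  · rintro w ⟨c', hc', rfl, hw, hx, z, ⟨hz, hzh⟩, hzc⟩
    obtain ⟨x, hxc, hxl⟩ := exists_mem_of_filterMap_ne_nil hw
    obtain ⟨c, hc, hxc'⟩ := exists_isOrbit F.injective x
    obtain ⟨d, hd, hm, hr⟩ := hc.delete hF hl
    have hxd : x ∈ d := (hm x).2 ⟨hxc', by rintro rfl; exact hxl hl⟩
    have hdc := hd.isRotated_of_mem hc' hxd hxc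
    refine ⟨_, c, hc, rfl, fun e => ?_, fun y hy => ?_, z, hz, fun h' => ?_⟩
    · exact List.filterMap_eq_nil_iff.1 e x hxc' |> hxl
    · exact ((hm y).1 (hdc.mem_iff.2 (hx y hy))).1
    · exact hzc (hdc.mem_iff.1 ((hm z).2 ⟨h', hzh⟩))

end orbits

end JacobiDiagram

namespace JacobiDiagram

variable {L : Type}

/-! ### Sums over signs -/

section signs

variable {V W M : Type*} [AddCommGroup M]

open Classical in
/-- Changing the sign at `v`. -/
noncomputable def toggle (v : V) (σ : V → ℤˣ) : V → ℤˣ := fun w => if w = v then -σ w else σ w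

theorem toggle_self (v : V) (σ : V → ℤˣ) : toggle v σ v = -σ v := if_pos rfl

theorem toggle_of_ne {v w : V} (h : w ≠ v) (σ : V → ℤˣ) : toggle v σ w = σ w := if_neg h

theorem toggle_toggle (v : V) (σ : V → ℤˣ) : toggle v (toggle v σ) = σ := by
  funext w
  by_cases h : w = v
  · subst h; rw [toggle_self, toggle_self, neg_neg]
  · rw [toggle_of_ne h, toggle_of_ne h]

/-- The product of the signs. -/
noncomputable def signProd (σ : V → ℤˣ) : ℤˣ := ∏ᶠ v, σ v

theorem signProd_comp (e : V ≃ W) (σ : W → ℤˣ) : signProd (σ ∘ e) = signProd σ :=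
  finprod_comp_equiv e

theorem signProd_toggle [Finite V] (v : V) (σ : V → ℤˣ) : signProd (toggle v σ) = -signProd σ := by
  classical
  have h : toggle v σ = fun w => (if w = v then -1 else 1) * σ w := by
    funext w
    by_cases h : w = v
    · subst h; rw [toggle_self]; simp
    · rw [toggle_of_ne h]; simp [h]
  rw [signProd, h, finprod_mul_distrib (Set.toFinite _) (Set.toFinite _),
    finprod_eq_single _ v (fun w hw => if_neg hw), if_pos rfl, neg_one_mul, signProd]

theorem signProd_neg [Finite V] (σ : V → ℤˣ) :
    signProd (-σ) = (-1) ^ Nat.card V * signProd σ := by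
  have := Fintype.ofFinite V
  rw [signProd, signProd, finprod_eq_prod_of_fintype, finprod_eq_prod_of_fintype,
    Nat.card_eq_fintype_card]
  simp only [Pi.neg_apply, Finset.prod_neg, Finset.card_univ]

/-- The sum over all signs with value `1` on `A`. -/
noncomputable def signSum (A : Set V) (f : (V → ℤˣ) → M) : M :=
  ∑ᶠ σ ∈ {σ : V → ℤˣ | ∀ v ∈ A, σ v = 1}, f σ

theorem signSum_congr {A : Set V} {f g : (V → ℤˣ) → M} (h : ∀ σ, (∀ v ∈ A, σ v = 1) → f σ = g σ) :
    signSum A f = signSum A g :=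
  finsum_mem_congr rfl h

theorem signSum_zero (A : Set V) : signSum A (fun _ => (0 : M)) = 0 := finsum_mem_zero _

theorem signSum_add [Finite V] (A : Set V) (f g : (V → ℤˣ) → M) :
    signSum A (fun σ => f σ + g σ) = signSum A f + signSum A g :=
  finsum_mem_add_distrib (Set.toFinite _)

/-- States that differ only at `v` are paired. The cancellations behind AS, self-loop and IHX take
place within such pairs, or within quadruples obtained by pairing twice. -/
theorem signSum_insert [Finite V] {A : Set V} {v : V} (hv : v ∉ A) (f : (V → ℤˣ) → M) :
    signSum A f = signSum (insert v A) fun σ => f σ + f (toggle v σ) := by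
  have hA : ∀ (σ : V → ℤˣ), (∀ u ∈ A, toggle v σ u = 1) ↔ ∀ u ∈ A, σ u = 1 := fun σ =>
    forall₂_congr fun u hu => by rw [toggle_of_ne (by rintro rfl; exact hv hu)]
  have h : {σ : V → ℤˣ | ∀ u ∈ A, σ u = 1} = {σ | ∀ u ∈ insert v A, σ u = 1} ∪
      {σ | σ v = -1 ∧ ∀ u ∈ A, σ u = 1} := by
    ext σ
    simp only [Set.mem_ofPred_eq, Set.mem_union, Set.forall_mem_insert]
    rcases Int.units_eq_one_or (σ v) with h | h <;> simp [h]
  have hd : Disjoint {σ : V → ℤˣ | ∀ u ∈ insert v A, σ u = 1}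
      {σ | σ v = -1 ∧ ∀ u ∈ A, σ u = 1} := by
    rw [Set.disjoint_left]
    rintro σ h1 h2
    have := h1 v (Set.mem_insert _ _)
    rw [h2.1] at this
    exact absurd this (by decide)
  rw [signSum_add, signSum, h, finsum_mem_union hd (Set.toFinite _) (Set.toFinite _)]
  congr 1
  refine (finsum_mem_eq_of_bijOn (toggle v) ⟨fun σ hσ => ?_, fun σ _ σ' _ e => ?_, fun σ hσ => ?_⟩
    fun σ _ => rfl).symm
  · rw [Set.mem_ofPred_eq, Set.forall_mem_insert] at hσ
    exact ⟨by rw [toggle_self, hσ.1], (hA σ).2 hσ.2⟩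
  · rw [← toggle_toggle v σ, e, toggle_toggle]
  · refine ⟨toggle v σ, ?_, toggle_toggle v σ⟩
    rw [Set.mem_ofPred_eq, Set.forall_mem_insert]
    exact ⟨by rw [toggle_self, hσ.1, neg_neg], (hA σ).2 hσ.2⟩

theorem signSum_comp (e : V ≃ W) (A : Set V) (f : (V → ℤˣ) → M) :
    signSum (e '' A) (fun σ => f (σ ∘ e)) = signSum A f := by
  refine finsum_mem_eq_of_bijOn (fun σ : W → ℤˣ => σ ∘ e) ⟨fun σ hσ u hu => ?_, fun σ _ σ' _ h => ?_,
    fun σ hσ => ?_⟩ fun σ _ => rfl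
  · exact hσ (e u) (Set.mem_image_of_mem _ hu)
  · exact e.surjective.injective_comp_right h
  · refine ⟨σ ∘ e.symm, ?_, ?_⟩
    · rintro _ ⟨u, hu, rfl⟩
      simpa using hσ u hu
    · funext u; simp

/-- States up to a global sign have one representative that is `1` at `v` and one that is `1` at
`w`; passing between them is a bijection that preserves the summand. -/
theorem signSum_singleton (f : (V → ℤˣ) → M) (hf : ∀ σ, f (-σ) = f σ) (v w : V) :
    signSum {v} f = signSum {w} f := by
  have key : ∀ (v w : V), Set.MapsTo (fun σ : V → ℤˣ => if σ w = 1 then σ else -σ)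
      {σ | ∀ u ∈ ({v} : Set V), σ u = 1} {σ | ∀ u ∈ ({w} : Set V), σ u = 1} := by
    intro v w σ hσ u hu
    obtain rfl : u = w := hu
    dsimp only
    split_ifs with h
    · exact h
    · rw [Pi.neg_apply, (Int.units_eq_one_or (σ u)).resolve_left h, neg_neg]
  have inv : ∀ (v w : V) (σ : V → ℤˣ), σ v = 1 →
      (fun σ : V → ℤˣ => if σ v = 1 then σ else -σ)
        ((fun σ : V → ℤˣ => if σ w = 1 then σ else -σ) σ) = σ := by
    intro v w σ hσ
    dsimp only
    split_ifs with h1 h2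
    · rfl
    · rw [Pi.neg_apply, hσ] at h2; exact absurd h2 (by decide)
    · rw [neg_neg]
  refine finsum_mem_eq_of_bijOn (fun σ : V → ℤˣ => if σ w = 1 then σ else -σ)
    (Set.InvOn.bijOn ⟨fun σ hσ => inv v w σ (hσ v rfl), fun σ hσ => inv w v σ (hσ w rfl)⟩
      (key v w) (key w v)) fun σ _ => ?_
  split_ifs
  · rfl
  · rw [hf]

end signs

/-! ### Contracting an edge -/

section contract

variable {X : Type*} [DecidableEq X]

/-- The cyclic permutation of four points. -/
def quad (p q r s : X) : Equiv.Perm X := Equiv.swap p q * Equiv.swap q r * Equiv.swap r s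

theorem quad_rotate {p q r s : X} (h : [p, q, r, s].Nodup) : quad p q r s = quad q r s p := by
  simp only [List.nodup_cons, List.mem_cons, List.not_mem_nil, or_false, not_or] at h
  obtain ⟨⟨h1, h2, h3⟩, ⟨h4, h5⟩, h6, -⟩ := h
  ext x
  simp only [quad, Equiv.Perm.mul_apply, Equiv.swap_apply_def]
  grind

theorem quad_apply {p q r s : X} (h : [p, q, r, s].Nodup) : quad p q r s p = q ∧ quad p q r s q = r ∧
    quad p q r s r = s ∧ quad p q r s s = p := by
  simp only [List.nodup_cons, List.mem_cons, List.not_mem_nil, or_false, not_or] at h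
  obtain ⟨⟨h1, h2, h3⟩, ⟨h4, h5⟩, h6, -⟩ := h
  simp only [quad, Equiv.Perm.mul_apply, Equiv.swap_apply_def]
  grind

theorem quad_apply_of_ne {p q r s x : X} (hp : x ≠ p) (hq : x ≠ q) (hr : x ≠ r) (hs : x ≠ s) :
    quad p q r s x = x := by
  simp only [quad, Equiv.Perm.mul_apply, Equiv.swap_apply_def]
  grind

/-- Deleting the two unlabelled half-edges `h` and `h'` from the faces merges their vertices into a
four-valent one with cyclic order `p, q, r, s`. The factor `Equiv.swap h h'` merely keeps both
deleted points fixed, and the complement excludes them as a second face. -/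
theorem readCl_contract [Finite X] {N : ℕ} {h h' p q r s : X} (hd : [h, h', p, q, r, s].Nodup)
    {α κ κ₀ : Equiv.Perm X} {lab : X → Option L} (hα : α h = h') (hα' : α h' = h)
    (hl : lab h = none) (hl' : lab h' = none) (h1 : κ h = p) (h2 : κ p = q) (h3 : κ q = h)
    (h4 : κ h' = r) (h5 : κ r = s) (h6 : κ s = h') (h0 : ∀ x ∈ [h, h', p, q, r, s], κ₀ x = x)
    (hκ : ∀ x ∉ [h, h', p, q, r, s], κ x = κ₀ x) :
    readCl N (κ * α : Equiv.Perm X) lab Set.univ =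
      readCl N (κ₀ * (Equiv.swap h h' * quad p q r s) * α : Equiv.Perm X) lab {h, h'}ᶜ := by
  have h0' : ∀ x, x ∉ [h, h', p, q, r, s] → κ₀ x ∉ [h, h', p, q, r, s] := fun x hx hx' =>
    hx (by rwa [κ₀.injective (h0 _ hx')] at hx')
  have hm : h ∈ [h, h', p, q, r, s] ∧ h' ∈ [h, h', p, q, r, s] ∧ p ∈ [h, h', p, q, r, s] ∧
      q ∈ [h, h', p, q, r, s] ∧ r ∈ [h, h', p, q, r, s] ∧ s ∈ [h, h', p, q, r, s] := by simp
  obtain ⟨m1, m2, m3, m4, m5, m6⟩ := hm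
  have hd' := hd
  simp only [List.nodup_cons, List.mem_cons, List.not_mem_nil, or_false, not_or] at hd'
  obtain ⟨⟨n1, n2, n3, n4, n5⟩, ⟨n6, n7, n8, n9⟩, ⟨n10, n11, n12⟩, ⟨n13, n14⟩, n15, -⟩ := hd'
  have e1 : (κ * α) h = r := by rw [Equiv.Perm.mul_apply, hα, h4]
  rw [← readCl_delete (F := κ * α) (h := h) (by rw [e1]; exact Ne.symm n4) hl (Set.mem_univ _), e1]
  have e2 : (Equiv.swap h r * (κ * α)) h' = p := by
    rw [Equiv.Perm.mul_apply, Equiv.Perm.mul_apply, hα', h1,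
      Equiv.swap_apply_of_ne_of_ne (Ne.symm n2) n11]
  rw [← readCl_delete (F := Equiv.swap h r * (κ * α)) (h := h') (by rw [e2]; exact Ne.symm n6) hl'
    (by rw [e2]; simp [Ne.symm n2]), e2]
  have hS : (Set.univ \ {h}) \ {h'} = ({h, h'}ᶜ : Set X) := by ext x; simp
  suffices key : Equiv.swap h' p * (Equiv.swap h r * κ) =
      κ₀ * (Equiv.swap h h' * quad p q r s) by
    rw [hS, ← key, mul_assoc, mul_assoc]
  ext x
  obtain ⟨q1, q2, q3, q4⟩ := quad_apply (p := p) (q := q) (r := r) (s := s)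
    (by simp [n10, n11, n12, n13, n14, n15])
  simp only [Equiv.Perm.mul_apply]
  by_cases hx : x ∈ [h, h', p, q, r, s]
  · simp only [List.mem_cons, List.not_mem_nil, or_false] at hx
    rcases hx with rfl | rfl | rfl | rfl | rfl | rfl
    · rw [h1, quad_apply_of_ne n2 n3 n4 n5, Equiv.swap_apply_left, h0 _ m2,
        Equiv.swap_apply_of_ne_of_ne (Ne.symm n2) n11, Equiv.swap_apply_right]
    · rw [h4, quad_apply_of_ne n6 n7 n8 n9, Equiv.swap_apply_right, Equiv.swap_apply_right,
        h0 _ m1, Equiv.swap_apply_of_ne_of_ne n1 n2]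
    · rw [h2, q1, Equiv.swap_apply_of_ne_of_ne (Ne.symm n3) (Ne.symm n7), h0 _ m4,
        Equiv.swap_apply_of_ne_of_ne (Ne.symm n3) n13,
        Equiv.swap_apply_of_ne_of_ne (Ne.symm n7) (Ne.symm n10)]
    · rw [h3, q2, Equiv.swap_apply_of_ne_of_ne (Ne.symm n4) (Ne.symm n8), h0 _ m5,
        Equiv.swap_apply_left, Equiv.swap_apply_of_ne_of_ne (Ne.symm n8) (Ne.symm n11)]
    · rw [h5, q3, Equiv.swap_apply_of_ne_of_ne (Ne.symm n5) (Ne.symm n9), h0 _ m6,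
        Equiv.swap_apply_of_ne_of_ne (Ne.symm n5) (Ne.symm n15),
        Equiv.swap_apply_of_ne_of_ne (Ne.symm n9) (Ne.symm n12)]
    · rw [h6, q4, Equiv.swap_apply_of_ne_of_ne (Ne.symm n2) (Ne.symm n6), h0 _ m3,
        Equiv.swap_apply_of_ne_of_ne (Ne.symm n1) n8, Equiv.swap_apply_left]
  · have hx' := h0' x hx
    rw [← hκ x hx] at hx'
    simp only [List.mem_cons, List.not_mem_nil, or_false, not_or] at hx hx'
    rw [quad_apply_of_ne hx.2.2.1 hx.2.2.2.1 hx.2.2.2.2.1 hx.2.2.2.2.2,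
      Equiv.swap_apply_of_ne_of_ne hx.1 hx.2.1, ← hκ x (by simp [hx]),
      Equiv.swap_apply_of_ne_of_ne hx'.1 hx'.2.2.2.2.1, Equiv.swap_apply_of_ne_of_ne hx'.2.1 hx'.2.2.1]

end contract

end JacobiDiagram

namespace JacobiDiagram

variable {L : Type} {N : ℕ}

/-! ### The state sum -/

/-- The turn to the left or to the right at a trivalent vertex. -/
def turn (s : ℤˣ) : Fin 3 := if s = 1 then 2 else 1

theorem turn_neg (s : ℤˣ) : turn (-s) = -turn s := by
  revert s; decide

/-- The involution `α` as a permutation. -/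
def αPerm (J : JacobiDiagram L) : Equiv.Perm J.H := Function.Involutive.toPerm J.α J.α_α

/-- The turns at all trivalent vertices. -/
def turnPerm (J : JacobiDiagram L) (σ : J.V → ℤˣ) : Equiv.Perm J.H := J.rotPerm fun v => turn (σ v)

/-- The labels as a partial function on the half-edges. -/
def legLabel (J : JacobiDiagram L) : J.H → Option L
  | .inl _ => none
  | .inr u => some (J.label u)

/-- The contribution of `κ * α`, whose orbits are the boundary components of the thickening of `J` with
turns `κ` at the vertices. -/
noncomputable def permCl (N : ℕ) (J : JacobiDiagram L) (κ : Equiv.Perm J.H) : JacobiModule L N 1 :=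
  readCl N (κ * J.αPerm : Equiv.Perm J.H) J.legLabel Set.univ

/-- The contribution of a state to the state sum. -/
noncomputable def stateCl (N : ℕ) (J : JacobiDiagram L) (σ : J.V → ℤˣ) : JacobiModule L N 1 :=
  (signProd σ : ℤ) • J.permCl N (J.turnPerm σ)

/-- The sum over all states with sign `1` at `v`. -/
noncomputable def stateSum (N : ℕ) (J : JacobiDiagram L) (v : J.V) : JacobiModule L N 1 :=
  signSum {v} (J.stateCl N)

section

variable (J : JacobiDiagram L)

theorem turnPerm_inl (σ : J.V → ℤˣ) (v : J.V) (i : Fin 3) :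
    J.turnPerm σ (.inl (v, i)) = .inl (v, i + turn (σ v)) := rfl

theorem turnPerm_inr (σ : J.V → ℤˣ) (u : J.U) : J.turnPerm σ (.inr u) = .inr u := rfl

theorem αPerm_mul_self : J.αPerm * J.αPerm = 1 := by
  ext1 h; exact J.α_α h

theorem turnPerm_neg (σ : J.V → ℤˣ) : J.turnPerm (-σ) = (J.turnPerm σ)⁻¹ := by
  rw [eq_inv_iff_mul_eq_one]
  ext1 h
  rcases h with ⟨v, i⟩ | u
  · rw [Equiv.Perm.mul_apply, turnPerm_inl, turnPerm_inl, Pi.neg_apply, turn_neg,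
      add_neg_cancel_right]
    rfl
  · rfl

/-- Changing all signs inverts the turns, so the face permutation becomes conjugate to its inverse
and the word is reversed, with sign `(-1) ^ N`. The product of the signs changes by `(-1)` to the
number of vertices, and the parities agree. -/
theorem stateCl_neg (hN : Even (Nat.card J.V + N)) (σ : J.V → ℤˣ) :
    J.stateCl N (-σ) = J.stateCl N σ := by
  have h : J.permCl N (J.turnPerm (-σ)) = (-1 : ℤ) ^ N • J.permCl N (J.turnPerm σ) := by
    rw [permCl, permCl, ← readCl_inv, turnPerm_neg]
    refine readCl_map ((J.turnPerm σ)⁻¹) (fun x => ?_) (fun x => ?_) (fun x => by simp)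
    · have : J.αPerm⁻¹ = J.αPerm := inv_eq_of_mul_eq_one_left J.αPerm_mul_self
      rw [mul_inv_rev, this]
      simp
    · have : ∀ y, J.legLabel (J.turnPerm σ y) = J.legLabel y := by rintro (⟨v, i⟩ | u) <;> rfl
      rw [← this, ← Equiv.Perm.mul_apply, mul_inv_cancel, Equiv.Perm.one_apply]
  rw [stateCl, stateCl, h, signProd_neg, smul_smul]
  congr 1
  push_cast
  rw [mul_right_comm, ← pow_add, hN.neg_one_pow, one_mul]

theorem stateSum_eq (hN : Even (Nat.card J.V + N)) (v w : J.V) : J.stateSum N v = J.stateSum N w :=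
  signSum_singleton _ (J.stateCl_neg hN) v w

theorem stateCl_iso {J K : JacobiDiagram L} (e : Iso J K) (σ : K.V → ℤˣ) :
    K.stateCl N σ = J.stateCl N (σ ∘ e.eV) := by
  rw [stateCl, stateCl, signProd_comp, permCl, permCl]
  congr 1
  refine readCl_map e.hmap (fun x => ?_) (fun x => ?_) (fun x => by simp)
  · have h : ∀ y, e.hmap (J.turnPerm (σ ∘ e.eV) y) = K.turnPerm σ (e.hmap y) := by
      rintro (⟨v, i⟩ | u)
      · exact congrArg Sum.inl (Prod.ext rfl (add_right_comm i _ _))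
      · rfl
    have h' : ∀ y, e.hmap (J.αPerm y) = K.αPerm (e.hmap y) := fun y => (e.α_hmap y).symm
    rw [Equiv.Perm.mul_apply, Equiv.Perm.mul_apply, h, h']
  · rcases x with ⟨v, i⟩ | u
    · rfl
    · exact congrArg some (e.label_comm u)

theorem stateSum_iso {J K : JacobiDiagram L} (e : Iso J K) (v : J.V) :
    K.stateSum N (e.eV v) = J.stateSum N v := by
  rw [stateSum, stateSum, ← signSum_comp e.eV, Set.image_singleton]
  exact signSum_congr fun σ _ => stateCl_iso e σ

/-- Renaming the half-edges by `ρ` shifts a conjugation of the edges to one of the turns; the labels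
are unaffected because legs are fixed. -/
theorem readCl_conj (κ ρ : Equiv.Perm J.H) (hρ : ∀ u, ρ (.inr u) = .inr u) :
    readCl N (κ * (ρ * J.αPerm * ρ⁻¹) : Equiv.Perm J.H) J.legLabel Set.univ =
      J.permCl N (ρ⁻¹ * κ * ρ) := by
  have hl : ∀ x, ρ x = x ∨ ∃ y, ρ x = .inl y := by
    intro x
    rcases h : ρ x with y | u
    · exact .inr ⟨y, rfl⟩
    · rw [← hρ u, ρ.injective.eq_iff] at h
      rw [h]; exact .inl rfl
  have hlab : ∀ x, J.legLabel (ρ x) = J.legLabel x := by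
    intro x
    rcases x with y | u
    · rcases hl (.inl y) with h | ⟨z, h⟩
      · rw [h]
      · rw [h]; rfl
    · rw [hρ]
  refine readCl_map ρ (fun x => ?_) hlab (fun x => by simp)
  simp only [Equiv.Perm.mul_apply]
  simp

theorem permCl_permute (κ ρ : Equiv.Perm J.H) (hρ : ∀ u, ρ (.inr u) = .inr u) :
    (J.permute ρ).permCl N κ = J.permCl N (ρ⁻¹ * κ * ρ) := by
  have hl : (J.permute ρ).legLabel = J.legLabel := by
    funext x; rcases x with x | u <;> rfl
  rw [← J.readCl_conj κ ρ hρ, ← hl]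
  rfl

-- Conjugation by a transposition inverts a 3-cycle, so exchanging two half-edges at `v` exchanges
-- the left and the right turn there.
open Classical in
theorem swap_mul_turnPerm_mul_swap (σ : J.V → ℤˣ) (v : J.V) {i j : Fin 3} (hij : i ≠ j) :
    Equiv.swap (.inl (v, i)) (.inl (v, j)) * J.turnPerm σ * Equiv.swap (.inl (v, i)) (.inl (v, j)) =
      J.turnPerm (toggle v σ) := by
  have h1 : ∀ k, Equiv.swap (.inl (v, i)) (.inl (v, j)) (.inl (v, k) : J.H) =
      .inl (v, Equiv.swap i j k) := by
    intro k
    simp only [Equiv.swap_apply_def, Sum.inl.injEq, Prod.mk.injEq, true_and]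
    split_ifs <;> rfl
  have h2 : ∀ w k, w ≠ v → Equiv.swap (.inl (v, i)) (.inl (v, j)) (.inl (w, k) : J.H) =
      .inl (w, k) := fun w k hw => Equiv.swap_apply_of_ne_of_ne (by simp [hw]) (by simp [hw])
  have h3 : ∀ i j : Fin 3, i ≠ j → ∀ (k : Fin 3) (s : ℤˣ),
      Equiv.swap i j (Equiv.swap i j k + turn s) = k + turn (-s) := by decide
  ext1 h
  simp only [Equiv.Perm.mul_apply]
  rcases h with ⟨w, k⟩ | u
  · by_cases hw : w = v
    · subst hw
      rw [h1, turnPerm_inl, h1, turnPerm_inl, toggle_self, h3 i j hij]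
    · rw [h2 w k hw, turnPerm_inl, h2 w _ hw, turnPerm_inl, toggle_of_ne hw]
  · have : Equiv.swap (.inl (v, i)) (.inl (v, j)) (.inr u : J.H) = .inr u :=
      Equiv.swap_apply_of_ne_of_ne (by simp) (by simp)
    rw [this, turnPerm_inr, this, turnPerm_inr]

theorem stateCl_toggle (v : J.V) (σ : J.V → ℤˣ) (X : JacobiModule L N 1)
    (h : J.permCl N (J.turnPerm (toggle v σ)) = X) :
    J.stateCl N (toggle v σ) = -((signProd σ : ℤ) • X) := by
  rw [stateCl, signProd_toggle, h, Units.val_neg, neg_smul]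

theorem stateCl_flip (v : J.V) (σ : J.V → ℤˣ) :
    (J.permute (J.asPerm v)).stateCl N σ = -J.stateCl N (toggle v σ) := by
  classical
  have h : (J.permute (J.asPerm v)).permCl N ((J.permute (J.asPerm v)).turnPerm σ) =
      J.permCl N (J.turnPerm (toggle v σ)) := by
    rw [← J.swap_mul_turnPerm_mul_swap σ v (i := 1) (j := 2) (by decide)]
    refine (J.permCl_permute (J.turnPerm σ) (J.asPerm v) fun u => ?_).trans ?_
    · exact Equiv.swap_apply_of_ne_of_ne (by simp) (by simp)
    · rw [asPerm, Equiv.swap_inv]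
  rw [J.stateCl_toggle v σ _ h.symm, neg_neg]
  rfl

/-- The states of the flipped diagram are those of `J` with the sign at `v` toggled and the opposite
contribution. The base vertex `w` differs from `v`, so both signs at `v` occur in the sums. -/
theorem stateSum_flip {v w : J.V} (hvw : v ≠ w) :
    J.stateSum N w + (J.permute (J.asPerm v)).stateSum N w = 0 := by
  have e : (J.permute (J.asPerm v)).stateSum N w =
      signSum {w} fun σ => -J.stateCl N (toggle v σ) :=
    signSum_congr fun σ _ => J.stateCl_flip v σ
  rw [e, stateSum, ← signSum_add, signSum_insert (v := v) (by simpa using hvw)]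
  refine (signSum_congr fun σ _ => ?_).trans (signSum_zero _)
  rw [toggle_toggle]
  abel

/-- Exchanging the two ends of the loop commutes with `α`. Toggling the sign at `v` thus leaves the
faces unchanged up to renaming and reverses the sign of the contribution. -/
theorem stateSum_selfLoop {v w : J.V} (hvw : v ≠ w) {i j : Fin 3}
    (he : J.α (.inl (v, i)) = .inl (v, j)) : J.stateSum N w = 0 := by
  classical
  have hij : i ≠ j := by rintro rfl; exact J.α_ne _ he
  rw [stateSum, signSum_insert (v := v) (by simpa using hvw)]
  refine (signSum_congr fun σ _ => ?_).trans (signSum_zero _)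
  have h : J.permCl N (J.turnPerm (toggle v σ)) = J.permCl N (J.turnPerm σ) := by
    rw [← J.swap_mul_turnPerm_mul_swap σ v hij]
    set s : Equiv.Perm J.H := Equiv.swap (.inl (v, i)) (.inl (v, j)) with hs
    have hss : s⁻¹ = s := Equiv.swap_inv _ _
    have hsu : ∀ u, s (.inr u) = .inr u := fun u => Equiv.swap_apply_of_ne_of_ne (by simp) (by simp)
    have hc : J.αPerm * s = s * J.αPerm := by
      have h1 : J.αPerm (.inl (v, i)) = .inl (v, j) := he
      have h2 : J.αPerm (.inl (v, j)) = .inl (v, i) := by rw [← h1]; exact J.α_α _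
      rw [hs, Equiv.mul_swap_eq_swap_mul, h1, h2, Equiv.swap_comm]
    have := J.readCl_conj (N := N) (J.turnPerm σ) s hsu
    rw [← hc, mul_inv_cancel_right, hss] at this
    exact this.symm
  rw [J.stateCl_toggle v σ _ h, stateCl, add_neg_cancel]

end

end JacobiDiagram

/-! ### IHX for the state sum -/

namespace JacobiDiagram

variable {L : Type} {N : ℕ} {J : JacobiDiagram L}

open Classical in
/-- The turns at all trivalent vertices other than `v` and `w`. -/
noncomputable def outerPerm (v w : J.V) (σ : J.V → ℤˣ) : Equiv.Perm J.H :=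
  J.rotPerm fun x => if x = v ∨ x = w then 0 else turn (σ x)

open Classical in
/-- The contribution of a state after contracting the edge between `h` and `h'`, when the other
half-edges at `v` and `w` follow each other in the order `p, q, r, s`. -/
noncomputable def contractCl (N : ℕ) (v w : J.V) (h h' : J.H) (σ : J.V → ℤˣ) (p q r s : J.H) :
    JacobiModule L N 1 :=
  readCl N (outerPerm v w σ * (Equiv.swap h h' * quad p q r s) * J.αPerm : Equiv.Perm J.H)
    J.legLabel {h, h'}ᶜ

theorem contractCl_rotate {v w : J.V} {h h' : J.H} {σ : J.V → ℤˣ} {p q r s : J.H}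
    (hd : [p, q, r, s].Nodup) :
    contractCl N v w h h' σ p q r s = contractCl N v w h h' σ q r s p := by
  classical
  unfold contractCl
  rw [quad_rotate hd]

/-- After contraction only the cyclic order of the four other half-edges at `v` and `w` matters, as
dictated by the two turns. The conjugation by `μ` accounts for the permutations of half-edges in the
IHX relation. -/
theorem permCl_contract {v w : J.V} (hvw : v ≠ w) {i j : Fin 3}
    (he : J.α (.inl (v, i)) = .inl (w, j)) {σ σ' : J.V → ℤˣ}
    (hσ : ∀ x, x ≠ v → x ≠ w → σ' x = σ x) (μ : Equiv.Perm J.H)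
    (hμ : ∀ x k, x ≠ v → x ≠ w → μ (.inl (x, k)) = .inl (x, k)) (hμu : ∀ u, μ (.inr u) = .inr u)
    (hh : μ (.inl (v, i)) = .inl (v, i)) (hh' : μ (.inl (w, j)) = .inl (w, j)) :
    J.permCl N (μ * J.turnPerm σ' * μ⁻¹) =
      contractCl N v w (.inl (v, i)) (.inl (w, j)) σ (μ (.inl (v, i + turn (σ' v))))
        (μ (.inl (v, i + turn (σ' v) + turn (σ' v)))) (μ (.inl (w, j + turn (σ' w))))
        (μ (.inl (w, j + turn (σ' w) + turn (σ' w)))) := by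
  classical
  set s := turn (σ' v) with hs
  set t := turn (σ' w) with ht
  have three : ∀ (z : ℤˣ) (i : Fin 3), i + turn z + turn z + turn z = i := by decide
  have ne : ∀ (z : ℤˣ) (i : Fin 3), i ≠ i + turn z ∧ i ≠ i + turn z + turn z ∧
      i + turn z ≠ i + turn z + turn z := by decide
  have all : ∀ (z : ℤˣ) (i k : Fin 3), k = i ∨ k = i + turn z ∨ k = i + turn z + turn z := by decide
  let B : Set J.H := {x | ∃ k, x = .inl (v, k) ∨ x = .inl (w, k)}
  have hfix : ∀ x, x ∉ B → μ x = x ∧ outerPerm v w σ x = J.turnPerm σ' x ∧ J.turnPerm σ' x ∉ B := by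
    rintro (⟨x, k⟩ | u) hx
    · have h1 : x ≠ v := by rintro rfl; exact hx ⟨k, .inl rfl⟩
      have h2 : x ≠ w := by rintro rfl; exact hx ⟨k, .inr rfl⟩
      refine ⟨hμ x k h1 h2, ?_, ?_⟩
      · change Sum.inl (x, k + if x = v ∨ x = w then 0 else turn (σ x)) = _
        rw [if_neg (by tauto), turnPerm_inl, hσ x h1 h2]
      · rw [turnPerm_inl]
        rintro ⟨k', h | h⟩ <;> simp_all
    · refine ⟨hμu u, rfl, ?_⟩
      rw [turnPerm_inr]; exact hx
  have hout : ∀ x ∈ B, outerPerm v w σ x = x := by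
    rintro _ ⟨k, rfl | rfl⟩
    · change Sum.inl (v, k + if v = v ∨ v = w then 0 else turn (σ v)) = _
      rw [if_pos (.inl rfl), add_zero]
    · change Sum.inl (w, k + if w = v ∨ w = w then 0 else turn (σ w)) = _
      rw [if_pos (.inr rfl), add_zero]
  have hμB : ∀ x, μ x ∈ B ↔ x ∈ B := by
    intro x
    constructor
    · intro h; by_contra hx; rw [(hfix x hx).1] at h; exact hx h
    · intro h; by_contra hx; rw [μ.injective (hfix _ hx).1] at hx; exact hx h
  have hmem : ∀ x, x ∈ B ↔ x ∈ ([.inl (v, i), .inl (w, j), .inl (v, i + s), .inl (v, i + s + s),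
      .inl (w, j + t), .inl (w, j + t + t)] : List J.H) := by
    intro x
    constructor
    · rintro ⟨k, rfl | rfl⟩
      · rcases all (σ' v) i k with h | h | h <;> rw [h] <;> simp [hs]
      · rcases all (σ' w) j k with h | h | h <;> rw [h] <;> simp [ht]
    · intro h
      simp only [List.mem_cons, List.not_mem_nil, or_false] at h
      rcases h with rfl | rfl | rfl | rfl | rfl | rfl
      exacts [⟨_, .inl rfl⟩, ⟨_, .inr rfl⟩, ⟨_, .inl rfl⟩, ⟨_, .inl rfl⟩, ⟨_, .inr rfl⟩,
        ⟨_, .inr rfl⟩]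
  have hmap : ([.inl (v, i), .inl (w, j), .inl (v, i + s), .inl (v, i + s + s),
      .inl (w, j + t), .inl (w, j + t + t)] : List J.H).map μ = [.inl (v, i), .inl (w, j),
      μ (.inl (v, i + s)), μ (.inl (v, i + s + s)), μ (.inl (w, j + t)), μ (.inl (w, j + t + t))] := by
    simp [hh, hh']
  have hmem' : ∀ x, x ∈ B ↔ x ∈ [.inl (v, i), .inl (w, j), μ (.inl (v, i + s)),
      μ (.inl (v, i + s + s)), μ (.inl (w, j + t)), μ (.inl (w, j + t + t))] := by
    intro x
    rw [← hmap]
    obtain ⟨y, rfl⟩ := μ.surjective x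
    rw [hμB, List.mem_map_of_injective μ.injective, hmem]
  have hinv : ∀ x, (μ * J.turnPerm σ' * μ⁻¹) (μ x) = μ (J.turnPerm σ' x) := fun x => by
    simp [Equiv.Perm.mul_apply]
  refine readCl_contract ?_ he (by change J.α _ = _; rw [← he, J.α_α]) rfl rfl ?_ ?_ ?_ ?_ ?_ ?_ ?_ ?_
  · rw [← hmap]
    refine List.Nodup.map μ.injective ?_
    obtain ⟨a1, a2, a3⟩ := ne (σ' v) i
    obtain ⟨b1, b2, b3⟩ := ne (σ' w) j
    simp only [← hs, ← ht] at a1 a2 a3 b1 b2 b3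
    simp only [List.nodup_cons, List.mem_cons, List.not_mem_nil, or_false, not_or, Sum.inl.injEq,
      Prod.mk.injEq, not_and, not_false_eq_true, List.nodup_nil, and_true]
    exact ⟨⟨fun h => absurd h hvw, fun _ => a1, fun _ => a2, fun h => absurd h hvw,
      fun h => absurd h hvw⟩, ⟨fun h => absurd h hvw.symm, fun h => absurd h hvw.symm, fun _ => b1,
      fun _ => b2⟩, ⟨fun _ => a3, fun h => absurd h hvw, fun h => absurd h hvw⟩,
      ⟨fun h => absurd h hvw, fun h => absurd h hvw⟩, fun _ => b3⟩
  · conv_lhs => rw [← hh]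
    rw [hinv, turnPerm_inl]
  · rw [hinv, turnPerm_inl]
  · rw [hinv, turnPerm_inl, three, hh]
  · conv_lhs => rw [← hh']
    rw [hinv, turnPerm_inl]
  · rw [hinv, turnPerm_inl]
  · rw [hinv, turnPerm_inl, three, hh']
  · intro x hx
    exact hout x ((hmem' x).2 hx)
  · intro x hx
    have hxB : x ∉ B := fun h => hx ((hmem' x).1 h)
    obtain ⟨h1, h2, h3⟩ := hfix x hxB
    rw [h2]
    conv_lhs => rw [← h1]
    rw [hinv, (hfix _ h3).1]

/-- The contributions of the four states that differ only at `v` and `w`. -/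
theorem permCl_four {v w : J.V} (hvw : v ≠ w) {i j : Fin 3}
    (he : J.α (.inl (v, i)) = .inl (w, j)) {σ : J.V → ℤˣ} (hv : σ v = 1) (hw : σ w = 1)
    (μ : Equiv.Perm J.H)
    (hμ : ∀ x k, x ≠ v → x ≠ w → μ (.inl (x, k)) = .inl (x, k)) (hμu : ∀ u, μ (.inr u) = .inr u)
    (hh : μ (.inl (v, i)) = .inl (v, i)) (hh' : μ (.inl (w, j)) = .inl (w, j))
    (f : (J.V → ℤˣ) → JacobiModule L N 1)
    (hf : ∀ τ, f τ = (signProd τ : ℤ) • J.permCl N (μ * J.turnPerm τ * μ⁻¹)) {a b c d : J.H}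
    (ha : μ (.inl (v, i + 1)) = a) (hb : μ (.inl (v, i + 2)) = b) (hc : μ (.inl (w, j + 1)) = c)
    (hd : μ (.inl (w, j + 2)) = d) :
    f σ + f (toggle v σ) + (f (toggle w σ) + f (toggle v (toggle w σ))) =
      (signProd σ : ℤ) •
        (contractCl N v w (.inl (v, i)) (.inl (w, j)) σ b a d c -
          contractCl N v w (.inl (v, i)) (.inl (w, j)) σ a b d c -
          contractCl N v w (.inl (v, i)) (.inl (w, j)) σ b a c d +
          contractCl N v w (.inl (v, i)) (.inl (w, j)) σ a b c d) := by
  have t1 : turn 1 = 2 := rfl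
  have t2 : turn (-1) = 1 := rfl
  have e1 : ∀ k : Fin 3, k + 2 + 2 = k + 1 := by decide
  have e2 : ∀ k : Fin 3, k + 1 + 1 = k + 2 := by decide
  rw [hf, hf, hf, hf, permCl_contract hvw he (σ := σ) (fun _ _ _ => rfl) μ hμ hμu hh hh',
    permCl_contract hvw he (σ := σ) (fun x hx _ => toggle_of_ne hx σ) μ hμ hμu hh hh',
    permCl_contract hvw he (σ := σ) (fun x _ hx => toggle_of_ne hx σ) μ hμ hμu hh hh',
    permCl_contract hvw he (σ := σ) (fun x hx hx' => (toggle_of_ne hx _).trans (toggle_of_ne hx' σ))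
      μ hμ hμu hh hh', toggle_self, toggle_self,
      toggle_self, toggle_of_ne hvw, toggle_of_ne hvw.symm, toggle_of_ne hvw.symm, toggle_self, hv,
      hw, t1, t2, e1, e2, e1, e2, ha, hb, hc, hd]
  simp only [signProd_toggle, neg_neg, Units.val_neg, neg_smul, smul_add, smul_sub]
  abel

/-- Summing over the signs at `v` and `w` after contracting their edge gives `(ba - ab)(dc - cd)`,
read as a combination of cyclic words in the outer half-edges. The sum over the cyclic permutations
of `a, b, c` vanishes, as in the Jacobi identity for commutators under a trace. The base vertex `x`
leaves both signs at `v` and at `w` free. -/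
theorem stateSum_ihx {v w x : J.V} (hvw : v ≠ w) (hxv : v ≠ x) (hxw : w ≠ x) {i j : Fin 3}
    (he : J.α (.inl (v, i)) = .inl (w, j)) :
    J.stateSum N x + (J.permute (J.ihxPerm v w i j)).stateSum N x +
      (J.permute (J.ihxPerm v w i j)⁻¹).stateSum N x = 0 := by
  classical
  set ρ := J.ihxPerm v w i j with hρ
  obtain ⟨r1, r2, r3, r4⟩ := ihxPerm_apply hvw i j
  rw [← hρ] at r1 r2 r3 r4
  have r5 : ρ (.inl (v, i)) = .inl (v, i) := by
    simp [hρ, ihxPerm, Equiv.Perm.mul_apply, Equiv.swap_apply_def, hvw]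
  have r6 : ρ (.inl (w, j)) = .inl (w, j) := by
    simp [hρ, ihxPerm, Equiv.Perm.mul_apply, Equiv.swap_apply_def, hvw.symm]
  have r7 : ∀ x k, x ≠ v → x ≠ w → ρ (.inl (x, k)) = .inl (x, k) := fun x k h1 h2 =>
    ihxPerm_apply_of_ne h1 h2 i j k
  have r8 : ∀ u, ρ (.inr u) = .inr u := ihxPerm_apply_inr i j
  have inv : ∀ {y z : J.H}, ρ y = z → ρ⁻¹ z = y := fun h => by rw [← h]; simp
  -- All three diagrams are put on the edges of `J`; reattaching by a permutation is traded for
  -- conjugating the turns by its inverse.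
  let f : Equiv.Perm J.H → (J.V → ℤˣ) → JacobiModule L N 1 := fun μ τ =>
    (signProd τ : ℤ) • J.permCl N (μ * J.turnPerm τ * μ⁻¹)
  have s0 : J.stateSum N x = signSum {x} (f 1) := signSum_congr fun τ _ => by
    simp only [f, one_mul, inv_one, mul_one]; rfl
  have s1 : (J.permute ρ).stateSum N x = signSum {x} (f ρ⁻¹) := signSum_congr fun τ _ => by
    simp only [f]
    rw [inv_inv, ← J.permCl_permute _ _ r8]; rfl
  have s2 : (J.permute ρ⁻¹).stateSum N x = signSum {x} (f ρ) := signSum_congr fun τ _ => by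
    have := J.permCl_permute (N := N) (J.turnPerm τ) ρ⁻¹ fun u => inv (r8 u)
    rw [inv_inv] at this
    simp only [f]
    rw [← this]; rfl
  refine (congrArg₂ (· + ·) (congrArg₂ (· + ·) s0 s1) s2).trans ?_
  rw [← signSum_add, ← signSum_add, signSum_insert (v := v) (by simpa using hxv),
    signSum_insert (v := w) (by simp [hvw.symm, hxw])]
  refine (signSum_congr fun σ hσ => ?_).trans (signSum_zero _)
  have hv : σ v = 1 := hσ v (by simp)
  have hw : σ w = 1 := hσ w (by simp)
  have g0 := permCl_four hvw he hv hw 1 (fun _ _ _ _ => rfl) (fun _ => rfl) rfl rfl (f 1)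
    (fun _ => rfl) rfl rfl rfl rfl
  have g1 := permCl_four hvw he hv hw ρ⁻¹ (fun x k h1 h2 => inv (r7 x k h1 h2)) (fun u => inv (r8 u))
    (inv r5) (inv r6) (f ρ⁻¹) (fun _ => rfl) (inv r3) (inv r1) (inv r2) (inv r4)
  have g2 := permCl_four hvw he hv hw ρ r7 r8 r5 r6 (f ρ) (fun _ => rfl) r1 r2 r3 r4
  simp only [Equiv.Perm.one_apply] at g0
  have hnd : ([.inl (v, i + 1), .inl (v, i + 2), .inl (w, j + 1), .inl (w, j + 2)] :
      List J.H).Nodup := by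
    simp [hvw]
  generalize (.inl (v, i + 1) : J.H) = a at g0 g1 g2 hnd
  generalize (.inl (v, i + 2) : J.H) = b at g0 g1 g2 hnd
  generalize (.inl (w, j + 1) : J.H) = c at g0 g1 g2 hnd
  generalize (.inl (w, j + 2) : J.H) = d at g0 g1 g2 hnd
  simp only [List.nodup_cons, List.mem_cons, List.not_mem_nil, or_false, not_or] at hnd
  obtain ⟨⟨hab, hac, had⟩, ⟨hbc, hbd⟩, hcd, -⟩ := hnd
  -- The twelve terms are rotated to representatives of the six cyclic orders of four elements; each
  -- of these occurs once with each sign.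
  have w1 := contractCl_rotate (N := N) (v := v) (w := w) (h := .inl (v, i)) (h' := .inl (w, j))
    (σ := σ) (p := b) (q := a) (r := d) (s := c) (by grind)
  have w2 := contractCl_rotate (N := N) (v := v) (w := w) (h := .inl (v, i)) (h' := .inl (w, j))
    (σ := σ) (p := b) (q := a) (r := c) (s := d) (by grind)
  have w3 := contractCl_rotate (N := N) (v := v) (w := w) (h := .inl (v, i)) (h' := .inl (w, j))
    (σ := σ) (p := c) (q := a) (r := d) (s := b) (by grind)
  have w4 := contractCl_rotate (N := N) (v := v) (w := w) (h := .inl (v, i)) (h' := .inl (w, j))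
    (σ := σ) (p := c) (q := a) (r := b) (s := d) (by grind)
  have w5 := contractCl_rotate (N := N) (v := v) (w := w) (h := .inl (v, i)) (h' := .inl (w, j))
    (σ := σ) (p := a) (q := c) (r := b) (s := d) (by grind)
  have w6 := contractCl_rotate (N := N) (v := v) (w := w) (h := .inl (v, i)) (h' := .inl (w, j))
    (σ := σ) (p := a) (q := b) (r := c) (s := d) (by grind)
  have w7 := contractCl_rotate (N := N) (v := v) (w := w) (h := .inl (v, i)) (h' := .inl (w, j))
    (σ := σ) (p := c) (q := b) (r := a) (s := d) (by grind)
  have w8 := contractCl_rotate (N := N) (v := v) (w := w) (h := .inl (v, i)) (h' := .inl (w, j))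
    (σ := σ) (p := b) (q := c) (r := a) (s := d) (by grind)
  rw [w1, w2] at g0
  rw [w3, w4] at g1
  rw [← w5, ← w6, w7, w8, w1, w3] at g2
  have key := congrArg₂ (· + ·) (congrArg₂ (· + ·) g0 g1) g2
  rw [← smul_add, ← smul_add] at key
  refine (Eq.trans ?_ key).trans ?_
  · abel
  · convert smul_zero (M := ℤ) (A := JacobiModule L N 1) _
    abel

end JacobiDiagram

namespace JacobiDiagram

variable {L : Type} {N : ℕ}

/-! ### The faces of theta graphs -/

section thetaFaces

variable {m : Fin 3 → ℕ} (σ : ThetaV m → ℤˣ)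

/-- The turn at a half-edge of a theta graph. -/
def thetaTurn : ThetaH m → ThetaH m
  | .inl (v, i) => .inl (v, i + turn (σ v))
  | .inr u => .inr u

/-- The face permutation of a theta graph. -/
def thetaFace (h : ThetaH m) : ThetaH m := thetaTurn σ (thetaα m h)

/-- The labels of a theta graph. -/
def thetaLabel (lab : (Σ k : Fin 3, Fin (m k)) → L) : ThetaH m → Option L
  | .inl _ => none
  | .inr u => some (lab u)

/-- Whether the legs of sign `s` on the strand `k` are met on the way from left to right. -/
def OnRight (k : Fin 3) (s : ℤˣ) : Prop := k ≠ 2 ↔ s = 1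

instance (k : Fin 3) (s : ℤˣ) : Decidable (OnRight k s) := by unfold OnRight; infer_instance

theorem pos_add_turn (k : Fin 3) (s : ℤˣ) :
    (OnRight k s → leftPos k + turn s = 0 ∧ turn s = rightPos k ∧ rightPos k + turn s = leftPos k) ∧
    (¬ OnRight k s →
      leftPos k + turn s = rightPos k ∧ turn s = leftPos k ∧ rightPos k + turn s = 0) := by
  revert k s; decide

theorem thetaFace_leg (u : Σ k : Fin 3, Fin (m k)) :
    thetaFace σ (.inl (.inl u, 0)) = .inr u := rfl

theorem thetaL_of_lt {k : Fin 3} {j : ℕ} (hj : j < m k) :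
    thetaL m k j = .inl (.inl ⟨k, ⟨j, hj⟩⟩, leftPos k) := by simp [thetaL, hj]

theorem thetaR_succ {k : Fin 3} {j : ℕ} (hj : j < m k) :
    thetaR m k (j + 1) = .inl (.inl ⟨k, ⟨j, hj⟩⟩, rightPos k) := by simp [thetaR, hj]

theorem thetaL_last (k : Fin 3) : thetaL m k (m k) = .inl (.inr true, k) := by simp [thetaL]

/-- Here `thetaR m k j` stands for travelling to the right along the edge `j` of the strand, and
`thetaL m k j` for travelling to the left. A leg on this side is visited, out and back, on the way
to the right and bypassed on the way to the left; `thetaFace_onLeft` is the mirror image. -/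
theorem thetaFace_onRight {k : Fin 3} {j : ℕ} (hj : j < m k)
    (h : OnRight k (σ (.inl ⟨k, ⟨j, hj⟩⟩))) :
    thetaFace σ (thetaR m k j) = .inl (.inl ⟨k, ⟨j, hj⟩⟩, 0) ∧
    thetaFace σ (.inr ⟨k, ⟨j, hj⟩⟩) = thetaR m k (j + 1) ∧
    thetaFace σ (thetaL m k (j + 1)) = thetaL m k j := by
  obtain ⟨h1, h2, h3⟩ := (pos_add_turn k _).1 h
  refine ⟨?_, ?_, ?_⟩
  · rw [thetaFace, thetaα_R m k j hj.le, thetaL_of_lt hj, thetaTurn, h1]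
  · rw [thetaFace, thetaα, thetaTurn, zero_add, h2, thetaR_succ hj]
  · rw [thetaFace, thetaα_L m k (j + 1) hj, thetaR_succ hj, thetaTurn, h3, thetaL_of_lt hj]

theorem thetaFace_onLeft {k : Fin 3} {j : ℕ} (hj : j < m k)
    (h : ¬ OnRight k (σ (.inl ⟨k, ⟨j, hj⟩⟩))) :
    thetaFace σ (thetaL m k (j + 1)) = .inl (.inl ⟨k, ⟨j, hj⟩⟩, 0) ∧
    thetaFace σ (.inr ⟨k, ⟨j, hj⟩⟩) = thetaL m k j ∧
    thetaFace σ (thetaR m k j) = thetaR m k (j + 1) := by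
  obtain ⟨h1, h2, h3⟩ := (pos_add_turn k _).2 h
  refine ⟨?_, ?_, ?_⟩
  · rw [thetaFace, thetaα_L m k (j + 1) hj, thetaR_succ hj, thetaTurn, h3]
  · rw [thetaFace, thetaα, thetaTurn, zero_add, h2, thetaL_of_lt hj]
  · rw [thetaFace, thetaα_R m k j hj.le, thetaL_of_lt hj, thetaTurn, h1, thetaR_succ hj]

theorem thetaFace_R_last (k : Fin 3) : thetaFace σ (thetaR m k (m k)) =
    thetaL m (k + turn (σ (.inr true))) (m (k + turn (σ (.inr true)))) := by
  rw [thetaFace, thetaα_R m k _ le_rfl, thetaL_last, thetaL_last, thetaTurn]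

theorem thetaFace_L_zero (k : Fin 3) : thetaFace σ (thetaL m k 0) =
    thetaR m (k - turn (σ (.inr false))) 0 := by
  rw [thetaFace, thetaα_L m k 0 (Nat.zero_le _), thetaR, thetaTurn, thetaR]
  congr 2
  abel

section invariant

variable {σ} {A : Set (ThetaH m)}

theorem thetaR_mem_iff (hA : ∀ x, thetaFace σ x ∈ A ↔ x ∈ A) (k : Fin 3)
    (j : ℕ) (hj : j ≤ m k) : thetaR m k j ∈ A ↔ thetaR m k 0 ∈ A := by
  induction j with
  | zero => rfl
  | succ j ih =>
    rw [← ih (by omega)]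
    by_cases h : OnRight k (σ (.inl ⟨k, ⟨j, hj⟩⟩))
    · obtain ⟨h1, h2, -⟩ := thetaFace_onRight σ hj h
      rw [← h2, hA, ← thetaFace_leg σ, hA, ← h1, hA]
    · rw [← (thetaFace_onLeft σ hj h).2.2, hA]

theorem thetaL_mem_iff (hA : ∀ x, thetaFace σ x ∈ A ↔ x ∈ A) (k : Fin 3)
    (j : ℕ) (hj : j ≤ m k) : thetaL m k j ∈ A ↔ thetaL m k 0 ∈ A := by
  induction j with
  | zero => rfl
  | succ j ih =>
    rw [← ih (by omega)]
    by_cases h : OnRight k (σ (.inl ⟨k, ⟨j, hj⟩⟩))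
    · rw [← (thetaFace_onRight σ hj h).2.2, hA]
    · obtain ⟨h1, h2, -⟩ := thetaFace_onLeft σ hj h
      rw [← h2, hA, ← thetaFace_leg σ, hA, ← h1, hA]

/-- If the cyclic orders at the two ends of the strands disagree, there is only one face. -/
theorem mem_of_opposite (hA : ∀ x, thetaFace σ x ∈ A ↔ x ∈ A) (h1 : σ (.inr false) = 1)
    (h2 : σ (.inr true) = -1) {x : ThetaH m} (hx : x ∈ A) (y : ThetaH m) : y ∈ A := by
  have t1 : turn 1 = 2 := rfl
  have t2 : turn (-1) = 1 := rfl
  have hR : ∀ k, thetaR m k 0 ∈ A ↔ thetaL m (k + 1) 0 ∈ A := fun k => by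
    rw [← thetaR_mem_iff hA k _ le_rfl, ← hA, thetaFace_R_last, h2, t2, thetaL_mem_iff hA _ _ le_rfl]
  have hL : ∀ k, thetaL m k 0 ∈ A ↔ thetaR m (k + 1) 0 ∈ A := fun k => by
    have e : ∀ k : Fin 3, k - 2 = k + 1 := by decide
    rw [← hA, thetaFace_L_zero, h1, t1, e]
  -- Running to the right along strand `k`, the face comes back along `k + 1` and leaves along `k +
  -- 2`; steps of `2` generate `Fin 3`, so all strands are covered in both directions.
  have hRR : ∀ k, thetaR m k 0 ∈ A ↔ thetaR m 0 0 ∈ A := by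
    have h0 := (hR 0).trans (hL 1)
    have h1 := (hR 1).trans (hL 2)
    have h2 := (hR 2).trans (hL 0)
    have e1 : (1 : Fin 3) + 1 = 2 := rfl
    have e2 : (2 : Fin 3) + 1 = 0 := rfl
    rw [e1] at h0
    rw [e2] at h1
    intro k
    fin_cases k
    · rfl
    · exact h1
    · exact h0.symm
  have hLL : ∀ k, thetaL m k 0 ∈ A ↔ thetaR m 0 0 ∈ A := fun k => (hL k).trans (hRR _)
  have key : ∀ y, y ∈ A ↔ thetaR m 0 0 ∈ A := by
    have leg : ∀ k (j : Fin (m k)), (.inr ⟨k, j⟩ : ThetaH m) ∈ A ↔ thetaR m 0 0 ∈ A := by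
      intro k j
      by_cases h : OnRight k (σ (.inl ⟨k, j⟩))
      · rw [← hA, (thetaFace_onRight σ j.2 h).2.1, thetaR_mem_iff hA _ _ j.2, hRR]
      · rw [← hA, (thetaFace_onLeft σ j.2 h).2.1, thetaL_mem_iff hA _ _ j.2.le, hLL]
    intro y
    rcases theta_cases m y with ⟨⟨k, j⟩, rfl⟩ | ⟨⟨k, j⟩, rfl⟩ | ⟨k, j, hj, rfl | rfl⟩
    · exact leg k j
    · rw [← hA, thetaFace_leg]; exact leg k j
    · rw [thetaL_mem_iff hA _ _ hj, hLL]
    · rw [thetaR_mem_iff hA _ _ hj, hRR]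
  rw [key, ← key x]; exact hx

end invariant

/-- The face on which a leg of sign `s` on the strand `k` lies. -/
def legFace (k : Fin 3) (s : ℤˣ) : Fin 3 := if OnRight k s then k else k + 1

/-- The faces, when the cyclic orders at the ends of the strands agree. -/
def faceOf : ThetaH m → Fin 3
  | .inl (.inl u, i) => if i = 0 then legFace u.1 (σ (.inl u)) else if i = leftPos u.1 then u.1 + 1
      else u.1
  | .inl (.inr false, i) => -i
  | .inl (.inr true, i) => i + 1
  | .inr u => legFace u.1 (σ (.inl u))

theorem faceOf_R (k : Fin 3) (j : ℕ) (hj : j ≤ m k) : faceOf σ (thetaR m k j) = k := by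
  have := leftPos_ne k
  rcases j with _ | j
  · simp [thetaR, faceOf]
  · rw [thetaR_succ hj]; simp [faceOf, this]

theorem faceOf_L (k : Fin 3) (j : ℕ) (hj : j ≤ m k) : faceOf σ (thetaL m k j) = k + 1 := by
  have := leftPos_ne k
  rcases hj.lt_or_eq with hj | rfl
  · rw [thetaL_of_lt hj]; simp [faceOf, this]
  · rw [thetaL_last]; rfl

/-- With agreeing ends, the face `f` runs to the right along strand `f` and back along strand `f -
1`, visiting the legs on its side. -/
theorem faceOf_thetaFace (h1 : σ (.inr false) = 1) (h2 : σ (.inr true) = 1) (x : ThetaH m) :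
    faceOf σ (thetaFace σ x) = faceOf σ x := by
  have t1 : turn 1 = 2 := rfl
  have e1 : ∀ k : Fin 3, k + 2 + 1 = k := by decide
  have e2 : ∀ k : Fin 3, k - 2 = k + 1 := by decide
  have onR : ∀ {k s}, OnRight k s → legFace k s = k := fun h => if_pos h
  have onL : ∀ {k s}, ¬ OnRight k s → legFace k s = k + 1 := fun h => if_neg h
  rcases theta_cases m x with ⟨⟨k, j⟩, rfl⟩ | ⟨⟨k, j⟩, rfl⟩ | ⟨k, j, hj, rfl | rfl⟩
  · by_cases h : OnRight k (σ (.inl ⟨k, j⟩))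
    · rw [(thetaFace_onRight σ j.2 h).2.1, faceOf_R _ _ _ j.2]
      exact (onR h).symm
    · rw [(thetaFace_onLeft σ j.2 h).2.1, faceOf_L _ _ _ j.2.le]
      exact (onL h).symm
  · rw [thetaFace_leg]
    simp [faceOf]
  · rcases j with _ | j
    · rw [thetaFace_L_zero, h1, t1, e2, faceOf_R _ _ _ (Nat.zero_le _), faceOf_L _ _ _ hj]
    · by_cases h : OnRight k (σ (.inl ⟨k, ⟨j, hj⟩⟩))
      · rw [(thetaFace_onRight σ hj h).2.2, faceOf_L _ _ _ hj, faceOf_L _ _ _ (by omega)]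
      · rw [(thetaFace_onLeft σ hj h).1, faceOf_L _ _ _ hj]
        simpa [faceOf] using onL h
  · rcases hj.lt_or_eq with hj | rfl
    · by_cases h : OnRight k (σ (.inl ⟨k, ⟨j, hj⟩⟩))
      · rw [(thetaFace_onRight σ hj h).1, faceOf_R _ _ _ hj.le]
        simpa [faceOf] using onR h
      · rw [(thetaFace_onLeft σ hj h).2.2, faceOf_R _ _ _ hj, faceOf_R _ _ _ hj.le]
    · rw [thetaFace_R_last, h2, t1, faceOf_L _ _ _ le_rfl, faceOf_R _ _ _ le_rfl, e1]

end thetaFaces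

/-! ### The state sum of theta graphs -/

section thetaState

variable {p q r : ℕ} (a : Fin p → L) (b : Fin q → L) (c : Fin r → L)

theorem coe_turnPerm_mul_theta (σ : ThetaV ![p, q, r] → ℤˣ) :
    ⇑((theta a b c).turnPerm σ * (theta a b c).αPerm) = thetaFace σ := by
  funext h
  have key : ∀ y : ThetaH ![p, q, r], (theta a b c).turnPerm σ y = thetaTurn σ y := by
    rintro (⟨v, i⟩ | u) <;> rfl
  exact key _

theorem stateCl_theta (σ : ThetaV ![p, q, r] → ℤˣ) : (theta a b c).stateCl N σ =
    (signProd σ : ℤ) • readCl N (thetaFace σ) (thetaLabel (theta a b c).label) Set.univ := by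
  have : (theta a b c).legLabel = thetaLabel (theta a b c).label := by
    funext x; rcases x with x | u <;> rfl
  rw [← coe_turnPerm_mul_theta a b c σ, ← this]
  rfl

end thetaState

theorem thetaFace_injective {m : Fin 3 → ℕ} (σ : ThetaV m → ℤˣ) :
    Function.Injective (thetaFace σ) := by
  have h1 : Function.Injective (thetaTurn σ) := by
    rintro (⟨v, i⟩ | u) (⟨v', i'⟩ | u') h
    · simp only [thetaTurn, Sum.inl.injEq, Prod.mk.injEq] at h
      obtain ⟨rfl, h⟩ := h
      rw [add_right_cancel h]
    · simp [thetaTurn] at h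
    · simp [thetaTurn] at h
    · exact h
  have h2 : Function.Involutive (thetaα m) := by
    intro h
    rcases theta_cases _ h with ⟨u, rfl⟩ | ⟨u, rfl⟩ | ⟨k, j, hj, rfl | rfl⟩
    · simp [thetaα]
    · simp [thetaα]
    · rw [thetaα_L _ _ _ hj, thetaα_R _ _ _ hj]
    · rw [thetaα_R _ _ _ hj, thetaα_L _ _ _ hj]
  exact h1.comp h2.injective

/-- In a state that contributes, all legs lie on the same face. -/
theorem Reads.theta {m : Fin 3 → ℕ} {σ : ThetaV m → ℤˣ} {lab : (Σ k : Fin 3, Fin (m k)) → L}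
    (h1 : σ (.inr false) = 1) {w : List L}
    (h : Reads (thetaFace σ) (thetaLabel lab) Set.univ w) :
    σ (.inr true) = 1 ∧ ∃ f, ∀ u, legFace u.1 (σ (.inl u)) = f := by
  obtain ⟨l, hl, rfl, hw, hx, z, -, hz⟩ := h
  obtain ⟨x, hxl, -⟩ := exists_mem_of_filterMap_ne_nil hw
  have h2 : σ (.inr true) = 1 := by
    by_contra h2
    exact hz (mem_of_opposite (A := {y | y ∈ l}) (fun y => hl.apply_mem_iff (thetaFace_injective σ))
      h1 ((Int.units_eq_one_or _).resolve_left h2) hxl z)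
  refine ⟨h2, faceOf σ x, fun u => ?_⟩
  refine hl.subset (A := {y | faceOf σ y = faceOf σ x}) (fun y hy => ?_) hxl rfl (.inr u)
    (hx (.inr u) (by simp [thetaLabel]))
  exact (faceOf_thetaFace σ h1 h2 y).trans hy

section thetaSum

variable {p q r : ℕ} (a : Fin p → L) (b : Fin q → L) (c : Fin r → L)

theorem stateCl_theta_eq_zero {σ : ThetaV ![p, q, r] → ℤˣ} (h1 : σ (.inr false) = 1)
    (h : ¬ (σ (.inr true) = 1 ∧ ∃ f, ∀ u, legFace u.1 (σ (.inl u)) = f)) :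
    (theta a b c).stateCl N σ = 0 := by
  exact (stateCl_theta ..).trans
    ((congrArg _ (readCl_of_not fun w hw => h (hw.theta h1))).trans (smul_zero _))

/-- Each face borders only two of the three strands, so no face can meet legs on all of them; every
state contributes `0`. -/
theorem stateSum_theta (hp : 0 < p) (hq : 0 < q) (hr : 0 < r) :
    (theta a b c).stateSum N (.inr false) = 0 := by
  refine (signSum_congr fun σ hσ => ?_).trans (signSum_zero _)
  refine stateCl_theta_eq_zero a b c (hσ _ rfl) ?_
  rintro ⟨-, f, hf⟩
  have h0 := hf ⟨0, ⟨0, hp⟩⟩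
  have h1 := hf ⟨1, ⟨0, hq⟩⟩
  have h2 := hf ⟨2, ⟨0, hr⟩⟩
  have key : ∀ s t u : ℤˣ, legFace 0 s = legFace 1 t → legFace 0 s = legFace 2 u → False := by decide
  exact key _ _ _ (h0.trans h1.symm) (h0.trans h2.symm)

end thetaSum

/-! ### The word on the outer face -/

section outerFace

variable {m : Fin 3 → ℕ}

/-- The outer face along the lower strand, from right to left, without its first half-edge. -/
def lowerFace : (j : ℕ) → j ≤ m 2 → List (ThetaH m)
  | 0, _ => []
  | j + 1, h => .inl (.inl ⟨2, ⟨j, h⟩⟩, 0) :: .inr ⟨2, ⟨j, h⟩⟩ :: thetaL m 2 j ::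
      lowerFace j (Nat.le_of_succ_le h)

/-- The shape of the equation is that of `isOrbit_cons_iff`, so that this piece can be spliced into
the full orbit. -/
theorem map_lowerFace (j : ℕ) (hj : j ≤ m 2) :
    thetaFace (1 : ThetaV m → ℤˣ) (thetaL m 2 j) :: (lowerFace j hj).map (thetaFace 1) =
      lowerFace j hj ++ [thetaFace 1 (thetaL m 2 0)] := by
  induction j with
  | zero => rfl
  | succ j ih =>
    obtain ⟨h1, h2, -⟩ := thetaFace_onLeft (1 : ThetaV m → ℤˣ) hj
      (by simp only [Pi.one_apply]; decide)
    rw [h1, lowerFace, List.map_cons, List.map_cons, List.map_cons, h2, thetaFace_leg,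
      ih (Nat.le_of_succ_le hj), List.cons_append, List.cons_append, List.cons_append]

theorem mem_lowerFace {j : ℕ} {hj : j ≤ m 2} {x : ThetaH m} (hx : x ∈ lowerFace j hj) :
    ∃ i, ∃ h : i < j, x = .inl (.inl ⟨2, ⟨i, h.trans_le hj⟩⟩, 0) ∨
      x = .inr ⟨2, ⟨i, h.trans_le hj⟩⟩ ∨ x = thetaL m 2 i := by
  induction j with
  | zero => simp [lowerFace] at hx
  | succ j ih =>
    simp only [lowerFace, List.mem_cons] at hx
    rcases hx with h | h | h | h
    · exact ⟨j, by omega, .inl h⟩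
    · exact ⟨j, by omega, .inr (.inl h)⟩
    · exact ⟨j, by omega, .inr (.inr h)⟩
    · obtain ⟨i, hi, h⟩ := ih h
      exact ⟨i, by omega, h⟩

theorem inr_mem_lowerFace {j : ℕ} {hj : j ≤ m 2} (i : ℕ) (hi : i < j) :
    (.inr ⟨2, ⟨i, hi.trans_le hj⟩⟩ : ThetaH m) ∈ lowerFace j hj := by
  induction j with
  | zero => omega
  | succ j ih =>
    simp only [lowerFace, List.mem_cons]
    rcases Nat.lt_succ_iff_lt_or_eq.1 hi with h | rfl
    · exact .inr (.inr (.inr (ih h)))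
    · exact .inr (.inl rfl)

theorem thetaL_two_inj {i j : ℕ} (hi : i < j) (hj : j ≤ m 2) : thetaL m 2 j ≠ thetaL m 2 i := by
  rw [thetaL_of_lt (hi.trans_le hj)]
  rcases hj.lt_or_eq with hj | rfl
  · rw [thetaL_of_lt hj]; simp; omega
  · rw [thetaL_last]; simp

theorem nodup_lowerFace (j : ℕ) (hj : j ≤ m 2) : (thetaL m 2 j :: lowerFace j hj).Nodup := by
  have hl : leftPos 2 ≠ 0 := (leftPos_ne 2).1
  have hL : ∀ j u, thetaL m 2 j ≠ .inl (.inl u, 0) ∧ thetaL m 2 j ≠ .inr u := by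
    intro j u
    unfold thetaL
    split_ifs
    · simp [hl]
    · simp
  rw [List.nodup_cons]
  refine ⟨fun h => ?_, ?_⟩
  · obtain ⟨i, hi, h | h | h⟩ := mem_lowerFace h
    · exact (hL _ _).1 h
    · exact (hL _ _).2 h
    · exact thetaL_two_inj hi hj h
  · induction j with
    | zero => simp [lowerFace]
    | succ j ih =>
      simp only [lowerFace, List.nodup_cons, List.mem_cons, not_or]
      refine ⟨⟨by simp, (hL _ _).1.symm, fun h => ?_⟩, ⟨(hL _ _).2.symm, fun h => ?_⟩, fun h => ?_,
        ih _⟩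
      · obtain ⟨i, hi, h | h | h⟩ := mem_lowerFace h
        · simp at h; omega
        · simp at h
        · exact (hL _ _).1 h.symm
      · obtain ⟨i, hi, h | h | h⟩ := mem_lowerFace h
        · simp at h
        · simp at h; omega
        · exact (hL _ _).2 h.symm
      · obtain ⟨i, hi, h | h | h⟩ := mem_lowerFace h
        · exact (hL _ _).1 h
        · exact (hL _ _).2 h
        · exact thetaL_two_inj hi (by omega) h

theorem filterMap_lowerFace (lab : (Σ k : Fin 3, Fin (m k)) → L) (j : ℕ) (hj : j ≤ m 2) :
    (lowerFace j hj).filterMap (thetaLabel lab) =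
      (List.ofFn fun i : Fin j => lab ⟨2, ⟨i, i.2.trans_le hj⟩⟩).reverse := by
  induction j with
  | zero => simp [lowerFace]
  | succ j ih =>
    have hL : ∀ i, thetaLabel lab (thetaL m 2 i) = none := by
      intro i; unfold thetaL; split_ifs <;> rfl
    rw [lowerFace, List.filterMap_cons_none rfl, List.filterMap_cons_some
      (f := thetaLabel lab) (b := lab ⟨2, ⟨j, hj⟩⟩) rfl, List.filterMap_cons_none (hL j), ih (by omega),
      List.ofFn_succ', List.concat_eq_append, List.reverse_append]
    rfl

/-- The outer face passes the single upper leg on its way to the right and then the lower legs on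
its way back, hence the reversed order. -/
theorem reads_theta_one (lab : (Σ k : Fin 3, Fin (m k)) → L) (h0 : 0 < m 0) (hm0 : m 0 = 1)
    (hm1 : m 1 = 0) : Reads (thetaFace (1 : ThetaV m → ℤˣ)) (thetaLabel lab) Set.univ
    (lab ⟨0, ⟨0, h0⟩⟩ :: (List.ofFn fun i : Fin (m 2) => lab ⟨2, i⟩).reverse) := by
  obtain ⟨f1, f2, -⟩ := thetaFace_onRight (1 : ThetaV m → ℤˣ) h0
    (by simp only [Pi.one_apply]; decide)
  have f3 : thetaFace (1 : ThetaV m → ℤˣ) (thetaR m 0 (0 + 1)) = thetaL m 2 (m 2) := by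
    have := thetaFace_R_last (1 : ThetaV m → ℤˣ) 0
    rw [hm0] at this
    exact this
  have f4 : thetaFace (1 : ThetaV m → ℤˣ) (thetaL m 2 0) = thetaR m 0 0 :=
    thetaFace_L_zero (1 : ThetaV m → ℤˣ) 2
  have hR0 : thetaR m 0 0 = .inl (.inr false, 0) := by simp [thetaR]
  have hR1 : thetaR m 0 (0 + 1) = .inl (.inl ⟨0, ⟨0, h0⟩⟩, 2) := thetaR_succ h0
  set t := thetaL m 2 (m 2) :: lowerFace (m := m) (m 2) le_rfl with ht
  have hmem : ∀ y ∈ t, y ≠ .inl (.inr false, 0) ∧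
      (∀ i j, y ≠ .inl (.inl ⟨0, j⟩, i)) ∧ ∀ j, y ≠ .inr ⟨0, j⟩ := by
    have hL : ∀ i, thetaL m 2 i ≠ .inl (.inr false, 0) ∧
        (∀ i' j, thetaL m 2 i ≠ .inl (.inl ⟨0, j⟩, i')) ∧ ∀ j, thetaL m 2 i ≠ .inr ⟨0, j⟩ := by
      intro i
      unfold thetaL
      split_ifs <;> simp
    intro y hy
    rcases List.mem_cons.1 hy with rfl | hy
    · exact hL _
    · obtain ⟨i, hi, rfl | rfl | rfl⟩ := mem_lowerFace hy
      · simp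
      · simp
      · exact hL i
  -- The half-edge `thetaL m 0 0` on the inner side of the upper strand witnesses a second face.
  refine ⟨thetaR m 0 0 :: .inl (.inl ⟨0, ⟨0, h0⟩⟩, 0) :: .inr ⟨0, ⟨0, h0⟩⟩ :: thetaR m 0 (0 + 1) :: t,
    isOrbit_cons_iff.2 ⟨?_, ?_⟩, ?_, by simp, ?_, thetaL m 0 0, Set.mem_univ _, ?_⟩
  · have hn : t.Nodup := nodup_lowerFace (m 2) le_rfl
    have n0 : (.inl (.inr false, 0) : ThetaH m) ∉ t := fun h => (hmem _ h).1 rfl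
    have n1 : ∀ i, (.inl (.inl ⟨0, ⟨0, h0⟩⟩, i) : ThetaH m) ∉ t := fun i h => (hmem _ h).2.1 _ _ rfl
    have n2 : (.inr ⟨0, ⟨0, h0⟩⟩ : ThetaH m) ∉ t := fun h => (hmem _ h).2.2 _ rfl
    rw [hR0, hR1]
    simp only [List.nodup_cons, List.mem_cons, not_or]
    simp [n0, n1, n2, hn]
  · have := map_lowerFace (m := m) (m 2) le_rfl
    rw [f4] at this
    rw [List.map_cons, List.map_cons, List.map_cons, thetaFace_leg, f1, f2, f3, ht, List.map_cons,
      this]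
    rfl
  · have hL : ∀ i, thetaLabel lab (thetaL m 2 i) = none := by
      intro i; unfold thetaL; split_ifs <;> rfl
    rw [hR0, hR1, List.filterMap_cons_none rfl, List.filterMap_cons_none rfl,
      List.filterMap_cons_some (f := thetaLabel lab) (b := lab ⟨0, ⟨0, h0⟩⟩) rfl, List.filterMap_cons_none rfl, ht,
      List.filterMap_cons_none (hL _), filterMap_lowerFace]
  · rintro (y | ⟨k, j⟩) hy
    · exact absurd rfl hy
    · have hk : k = 0 ∨ k = 1 ∨ k = 2 := by clear hy j; revert k; decide
      rcases hk with rfl | rfl | rfl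
      · obtain rfl : j = ⟨0, h0⟩ := Fin.ext (by have := j.2; simp only; omega)
        simp
      · exact absurd j.2 (by omega)
      · have := inr_mem_lowerFace (m := m) (hj := le_rfl) j.1 j.2
        simp only [ht, List.mem_cons]
        exact .inr (.inr (.inr (.inr (.inr this))))
  · have : thetaL m 0 0 = .inl (.inl ⟨0, ⟨0, h0⟩⟩, 1) := thetaL_of_lt h0
    rw [this, hR0, hR1]
    simp only [List.mem_cons, not_or]
    refine ⟨by simp, by simp, by simp, by simp, fun h => (hmem _ h).2.1 _ _ rfl⟩

end outerFace

theorem signSum_eq_single {V M : Type*} [AddCommGroup M] {A : Set V} {f : (V → ℤˣ) → M}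
    {τ : V → ℤˣ} (hτ : ∀ v ∈ A, τ v = 1) (h : ∀ σ, (∀ v ∈ A, σ v = 1) → σ ≠ τ → f σ = 0) :
    signSum A f = f τ := by
  have hS : signSum A f = ∑ᶠ σ ∈ ({τ} : Set (V → ℤˣ)), f σ := by
    refine finsum_mem_inter_support_eq _ _ _ (Set.ext fun σ => ?_)
    simp only [Set.mem_inter_iff, Function.mem_support, Set.mem_singleton_iff]
    refine and_congr_left fun hf => ⟨fun hA => ?_, ?_⟩
    · by_contra hne
      exact hf (h σ hA hne)
    · rintro rfl
      exact hτ
  rw [hS, finsum_mem_singleton]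

/-- The upper leg lies on face `0` or `1`, and a lower leg on face `2` or `0`. As both strands carry
legs, the common face is `0`, which forces every sign to be `1`; a single state remains. -/
theorem stateSum_theta_one {r : ℕ} (hr : 0 < r) (x : L) (c : Fin r → L) :
    (theta (fun _ : Fin 1 => x) (Fin.elim0 : Fin 0 → L) c).stateSum N (.inr false) =
      wheelCl N (x :: (List.ofFn c).reverse) := by
  have key : ∀ σ : ThetaV ![1, 0, r] → ℤˣ, (∀ v ∈ ({.inr false} : Set (ThetaV ![1, 0, r])), σ v = 1) →
      σ ≠ 1 → (theta (fun _ : Fin 1 => x) (Fin.elim0 : Fin 0 → L) c).stateCl N σ = 0 := by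
    intro σ hσ hne
    have h1 := hσ _ rfl
    refine stateCl_theta_eq_zero _ _ _ h1 ?_
    rintro ⟨h2, f, hf⟩
    refine hne (funext fun v => ?_)
    have h0 := hf ⟨0, ⟨0, Nat.one_pos⟩⟩
    have h3 := hf ⟨2, ⟨0, hr⟩⟩
    have e1 : ∀ s t : ℤˣ, legFace 0 s = legFace 2 t → legFace 0 s = 0 := by decide
    have e2 : ∀ s : ℤˣ, legFace 0 s = 0 → s = 1 := by decide
    have e3 : ∀ s : ℤˣ, legFace 2 s = 0 → s = 1 := by decide
    have hf0 : f = 0 := h0.symm.trans (e1 _ _ (h0.trans h3.symm))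
    rcases v with ⟨k, j⟩ | v
    · have hk : k = 0 ∨ k = 1 ∨ k = 2 := by clear j; revert k; decide
      have hu := (hf ⟨k, j⟩).trans hf0
      rcases hk with rfl | rfl | rfl
      · exact e2 _ hu
      · exact j.elim0
      · exact e3 _ hu
    · cases v
      · exact h1
      · exact h2
  have hsum : (theta (fun _ : Fin 1 => x) (Fin.elim0 : Fin 0 → L) c).stateSum N (.inr false) =
      (theta (fun _ : Fin 1 => x) (Fin.elim0 : Fin 0 → L) c).stateCl N
        (1 : ThetaV ![1, 0, r] → ℤˣ) := by
    exact signSum_eq_single (fun _ _ => rfl) key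
  have hr := reads_theta_one (theta (fun _ : Fin 1 => x) (Fin.elim0 : Fin 0 → L) c).label
    (m := ![1, 0, r]) Nat.one_pos rfl rfl
  have hs : signProd (1 : ThetaV ![1, 0, r] → ℤˣ) = 1 := finprod_one
  refine hsum.trans ((stateCl_theta ..).trans ?_)
  refine (congrArg _ hr.readCl_eq).trans ?_
  rw [hs]
  exact one_smul _ _

end JacobiDiagram

namespace ConnDiagram

open JacobiDiagram

variable {L : Type} {n : ℕ}

/-! ### The inverse of the blow-up map -/

open Classical in
/-- The state sum with respect to some trivalent vertex. -/
noncomputable def stateClass (N : ℕ) (J : ConnDiagram L n 2) : JacobiModule L N 1 :=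
  if h : Nonempty J.1.V then J.1.stateSum N h.some else 0

theorem stateClass_eq (hn : 2 ≤ n) (J : ConnDiagram L n 2) (v : J.1.V) :
    J.stateClass (n - 2) = J.1.stateSum (n - 2) v := by
  have h : Nonempty J.1.V := ⟨v⟩
  rw [stateClass, dif_pos h]
  refine stateSum_eq _ ?_ _ _
  have hV : Nat.card J.1.V = n := J.2.2.1
  rw [hV]
  -- The vertices and the target degree add up to `n + (n - 2) = 2 (n - 1)`.
  exact ⟨n - 1, by omega⟩

/-- An IHX relation involves two vertices, and the base vertex of the state sum has to avoid both.
-/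
theorem exists_ne_ne (hn : 3 ≤ n) (J : ConnDiagram L n 2) (v w : J.1.V) :
    ∃ x : J.1.V, v ≠ x ∧ w ≠ x := by
  classical
  have : Fintype J.1.V := Fintype.ofFinite _
  have hV : Fintype.card J.1.V = n := Nat.card_eq_fintype_card.symm.trans J.2.2.1
  obtain ⟨x, hx⟩ := Finset.exists_mem_notMem_of_card_lt_card
    (s := {v, w}) (t := Finset.univ) (Finset.card_le_two.trans_lt (by rw [Finset.card_univ]; omega))
  refine ⟨x, ?_, ?_⟩ <;> rintro rfl <;> simp at hx

/-- The map given by the state sums. -/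
noncomputable def stateMap (L : Type) (n : ℕ) (hn : 3 ≤ n) :
    JacobiModule L n 2 →ₗ[ℤ] JacobiModule L (n - 2) 1 :=
  Submodule.liftQ _ (Finsupp.linearCombination ℤ (stateClass (n - 2))) <| by
    have h2 : 2 ≤ n := by omega
    have hne : ∀ J : ConnDiagram L n 2, Nonempty J.1.V := fun J => by
      have h : Nat.card J.1.V = n := J.2.2.1
      have : Nat.card J.1.V ≠ 0 := by omega
      exact (Nat.card_ne_zero.1 this).1
    rw [Submodule.span_le]
    rintro x hx
    simp only [SetLike.mem_coe, LinearMap.mem_ker]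
    induction hx with
    | iso J K e =>
      obtain ⟨v⟩ := hne J
      simp only [map_sub, linearCombination_single, one_smul]
      rw [stateClass_eq h2 J v, stateClass_eq h2 K (e.eV v), stateSum_iso, sub_self]
    | as J v =>
      obtain ⟨w, hw, -⟩ := exists_ne_ne hn J v v
      simp only [map_add, linearCombination_single, one_smul]
      rw [stateClass_eq h2 J w, stateClass_eq h2 (J.flip v) w]
      exact stateSum_flip _ hw
    | ihx J v w i j hvw he =>
      obtain ⟨x, hv, hw⟩ := exists_ne_ne hn J v w
      simp only [map_add, linearCombination_single, one_smul]
      rw [stateClass_eq h2 J x, stateClass_eq h2 (J.ihx₁ hvw he) x,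
        stateClass_eq h2 (J.ihx₂ hvw he) x]
      exact stateSum_ihx hvw hv hw he
    | selfLoop J v i j he =>
      obtain ⟨w, hw, -⟩ := exists_ne_ne hn J v v
      simp only [linearCombination_single, one_smul]
      rw [stateClass_eq h2 J w]
      exact stateSum_selfLoop _ hw he

theorem stateMap_cls (hn : 3 ≤ n) (J : ConnDiagram L n 2) (v : J.1.V) :
    stateMap L n hn J.cls = J.1.stateSum (n - 2) v := by
  rw [← stateClass_eq (by omega)]
  change Finsupp.linearCombination ℤ (stateClass (n - 2)) (single J 1) = _
  simp

theorem thetaSubmodule_le_ker (hn : 3 ≤ n) :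
    thetaSubmodule L n ≤ LinearMap.ker (stateMap L n hn) := by
  refine Submodule.span_le.2 ?_
  rintro _ ⟨p, q, r, a, b, c, h, hp, hq, hr, rfl⟩
  exact (stateMap_cls hn (ConnDiagram.theta a b c h) (.inr false)).trans
    (stateSum_theta a b c hp hq hr)

theorem wheelCl_singleton (N : ℕ) (x : L) : wheelCl N [x] = 0 :=
  cl_selfLoop (JacobiDiagram.wheel [x].get) (v := (0 : Fin 1)) (i := 1) (j := 2) rfl

theorem wheelCl_nil (N : ℕ) (hN : 0 < N) : wheelCl N ([] : List L) = 0 :=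
  wheelCl_of_length (by simpa using hN.ne)

theorem blowUpMap_wheelCl {N : ℕ} (hN : 0 < N) (hn : N + 2 = n) (x : L) (a : List L) :
    blowUpMap L N n hN (wheelCl N (x :: a)) = thetaCl n [x] [] a.reverse := by
  by_cases ha : (x :: a).length = N
  · obtain ⟨m, y, v, hy, h⟩ := exists_cl_blowUp_wheel x a
    have hm : m = N := by rw [← ha, ← hy, List.length_ofFn]
    rw [← h, ← hy, ← cl_wheel, cl_of_isConn (hm ▸ wheel_isConn y (hm ▸ hN))]
    exact blowUpMap_cls hN ⟨JacobiDiagram.wheel y, _⟩ v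
  · rw [wheelCl_of_length ha, map_zero, thetaCl_of_length]
    simp only [List.length_cons, List.length_nil, List.length_reverse] at ha ⊢
    omega

theorem stateMap_thetaCl (hn : 3 ≤ n) (x : L) (c : List L) (hc : c ≠ []) :
    stateMap L n hn (thetaCl n [x] [] c) = wheelCl (n - 2) (x :: c.reverse) := by
  by_cases h : c.length + 1 = n - 2
  · have hT : thetaCl n [x] [] c =
        (ConnDiagram.theta (n := n) (fun _ : Fin 1 => x) (Fin.elim0 : Fin 0 → L) c.get
          (by omega)).cls := by
      refine Eq.trans ?_ ((cl_theta (n := n) (fun _ : Fin 1 => x) (Fin.elim0 : Fin 0 → L) c.get).symm.trans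
        (cl_of_isConn _))
      simp [List.ofFn_get]
    rw [hT]
    refine (stateMap_cls hn (ConnDiagram.theta _ _ _ _) (.inr false)).trans ?_
    refine (stateSum_theta_one (List.length_pos_iff.2 hc) x c.get).trans ?_
    rw [List.ofFn_get]
  · rw [thetaCl_of_length, map_zero, wheelCl_of_length]
    · simpa using h
    · simp only [List.length_cons, List.length_nil]
      omega

/-- It suffices to treat wheels. With at least two labels, the blow-up is a theta graph with one
upper leg and a non-empty lower strand, on which the state sum is known; with fewer labels the wheel
has class `0`. -/
theorem stateMap_blowUpMap (hn : 3 ≤ n) (hN : 0 < n - 2) (w : JacobiModule L (n - 2) 1) :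
    stateMap L n hn (blowUpMap L (n - 2) n hN w) = w := by
  have hid : (stateMap L n hn).comp (blowUpMap L (n - 2) n hN) = LinearMap.id := by
    refine LinearMap.ext_on (span_wheelCl (L := L) (n := n - 2) hN) ?_
    rintro _ ⟨a, rfl⟩
    rw [LinearMap.comp_apply, LinearMap.id_apply]
    rcases a with _ | ⟨x, _ | ⟨y, a⟩⟩
    · rw [wheelCl_nil _ hN, map_zero, map_zero]
    · rw [wheelCl_singleton, map_zero, map_zero]
    · rw [blowUpMap_wheelCl hN (by omega), stateMap_thetaCl hn _ _ (by simp), List.reverse_reverse]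
  exact LinearMap.congr_fun hid w

/-- In `thetaCl_move` the leg that goes to the middle strand leaves all three strands non-empty. -/
theorem thetaCl_cons_sub_mem {a c : List L} (x : L) (ha : a ≠ []) (hc : c ≠ []) :
    thetaCl n (x :: a) [] c - thetaCl n a [] (x :: c) ∈ thetaSubmodule L n := by
  rw [thetaCl_move, sub_sub_cancel_left]
  exact neg_mem (thetaCl_mem_thetaSubmodule ha (by simp) hc)

/-- Upper legs are moved to the lower strand until one is left and the theta graph is a blow-up.
Each move changes the word `a ++ c.reverse` by a rotation only. -/
theorem mkQ_thetaCl (hn : 3 ≤ n) (hN : 0 < n - 2) {a c : List L} (ha : a ≠ []) (hc : c ≠ []) :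
    (thetaSubmodule L n).mkQ (thetaCl n a [] c) =
      (thetaSubmodule L n).mkQ (blowUpMap L (n - 2) n hN (wheelCl (n - 2) (a ++ c.reverse))) := by
  induction a generalizing c with
  | nil => exact absurd rfl ha
  | cons x a ih =>
    by_cases h : a = []
    · subst h
      rw [List.singleton_append, blowUpMap_wheelCl hN (by omega), List.reverse_reverse]
    · have h1 : (thetaSubmodule L n).mkQ (thetaCl n (x :: a) [] c) =
          (thetaSubmodule L n).mkQ (thetaCl n a [] (x :: c)) :=
        (Submodule.Quotient.eq _).2 (thetaCl_cons_sub_mem x h hc)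
      rw [h1, ih h (by simp), List.reverse_cons, ← List.append_assoc, List.cons_append]
      rw [wheelCl_append_comm]
      rfl

/-- When the lower and middle strands are empty, the two terms of `thetaCl_move` are equal by
`thetaCl_swap`, whence the factor 2. A single leg is treated apart: its wheel has a self-loop, and
the theta graph is the blow-up of that wheel, so both sides vanish. -/
theorem mkQ_thetaCl_two (hn : 3 ≤ n) (hN : 0 < n - 2) {a : List L} (ha : a ≠ []) :
    (thetaSubmodule L n).mkQ (thetaCl n a [] []) =
      (thetaSubmodule L n).mkQ (blowUpMap L (n - 2) n hN ((2 : ℤ) • wheelCl (n - 2) a)) := by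
  rcases a with _ | ⟨x, a⟩
  · exact absurd rfl ha
  by_cases h : a = []
  · subst h
    have h0 := blowUpMap_wheelCl (n := n) hN (by omega) x []
    rw [wheelCl_singleton, map_zero, List.reverse_nil] at h0
    rw [wheelCl_singleton, smul_zero, map_zero, ← h0]
  · rw [thetaCl_move, thetaCl_swap, sub_neg_eq_add, ← two_smul ℤ, map_smul,
      mkQ_thetaCl hn hN h (by simp), map_smul, map_smul, List.reverse_singleton,
      wheelCl_append_comm, List.singleton_append]

end ConnDiagram

/-! ### The isomorphism and its inverse -/

theorem theorem1p3 (g n : ℕ) (hn : 3 ≤ n) :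
    ∃ bu : JacobiModule (SurfaceLabel g) (n - 2) 1 →ₗ[ℤ] JacobiModule (SurfaceLabel g) n 2,
      -- blowing up any trivalent vertex of any diagram gives the same well-defined map
      (∀ (J : ConnDiagram (SurfaceLabel g) (n - 2) 1) (v : J.1.V),
        bu J.cls = (J.blowUp v (Nat.sub_add_cancel (Nat.le_of_succ_le hn)) one_add_one_eq_two).cls) ∧
      -- the induced map to the quotient is an isomorphism
      ∃ e : JacobiModule (SurfaceLabel g) (n - 2) 1 ≃ₗ[ℤ]
          JacobiModule (SurfaceLabel g) n 2 ⧸ thetaSubmodule (SurfaceLabel g) n,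
        (∀ x, e x = (thetaSubmodule (SurfaceLabel g) n).mkQ (bu x)) ∧
        -- the inverse on theta diagrams with empty middle strand: both outer strands non-empty
        (∀ (p r : ℕ) (a : Fin p → SurfaceLabel g) (c : Fin r → SurfaceLabel g) (hp : 0 < p)
          (_ : 0 < r) (h : p + 0 + r + 2 = n),
          e.symm ((thetaSubmodule (SurfaceLabel g) n).mkQ
              (ConnDiagram.theta a Fin.elim0 c h).cls) =
            (ConnDiagram.wheel (Fin.append a (c ∘ Fin.rev)) (Nat.add_pos_left hp r)
              (by omega)).cls) ∧
        -- the inverse on theta diagrams with empty middle and lower strands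
        (∀ (p : ℕ) (a : Fin p → SurfaceLabel g) (hp : 0 < p) (h : p + 0 + 0 + 2 = n),
          e.symm ((thetaSubmodule (SurfaceLabel g) n).mkQ
              (ConnDiagram.theta a Fin.elim0 Fin.elim0 h).cls) =
            (2 : ℤ) • (ConnDiagram.wheel a hp (by omega)).cls) := by
  have hN : 0 < n - 2 := by omega
  have hT : ∀ {p q r : ℕ} (a : Fin p → SurfaceLabel g) (b : Fin q → SurfaceLabel g)
      (c : Fin r → SurfaceLabel g) (h : p + q + r + 2 = n), (ConnDiagram.theta a b c h).cls =
        JacobiDiagram.thetaCl n (List.ofFn a) (List.ofFn b) (List.ofFn c) := fun a b c h => by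
    rw [← JacobiDiagram.cl_theta]
    exact (JacobiDiagram.cl_of_isConn _).symm
  have hW : ∀ {m : ℕ} (x : Fin m → SurfaceLabel g) (hm : 0 < m) (h : m = n - 2),
      (ConnDiagram.wheel x hm h).cls = JacobiDiagram.wheelCl (n - 2) (List.ofFn x) := fun x hm h => by
    rw [← JacobiDiagram.cl_wheel]
    exact (JacobiDiagram.cl_of_isConn _).symm
  have hne : ∀ {m : ℕ} (x : Fin m → SurfaceLabel g), 0 < m → List.ofFn x ≠ [] := fun x hm h => by
    rw [List.ofFn_eq_nil_iff] at h
    omega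
  have hinj : Function.Injective
      ((thetaSubmodule (SurfaceLabel g) n).mkQ.comp (ConnDiagram.blowUpMap _ (n - 2) n hN)) := by
    -- The state sum kills `thetaSubmodule`, so it descends to the quotient and is a left inverse of
    -- the induced map there.
    refine Function.LeftInverse.injective
      (g := Submodule.liftQ _ (ConnDiagram.stateMap _ n hn) (ConnDiagram.thetaSubmodule_le_ker hn)) fun w => ?_
    exact ConnDiagram.stateMap_blowUpMap hn hN w
  have hsurj : Function.Surjective
      ((thetaSubmodule (SurfaceLabel g) n).mkQ.comp (ConnDiagram.blowUpMap _ (n - 2) n hN)) := by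
    rw [← LinearMap.range_eq_top, LinearMap.range_comp,
      Submodule.map_mkQ_eq_top, sup_comm]
    exact JacobiDiagram.range_blowUpMap_sup hn hN
  refine ⟨ConnDiagram.blowUpMap _ (n - 2) n hN, fun J v => ?_, LinearEquiv.ofBijective _ ⟨hinj, hsurj⟩,
    fun x => rfl, fun p r a c hp hr h => ?_, fun p a hp h => ?_⟩
  · rw [ConnDiagram.blowUpMap_cls hN J v]
    exact JacobiDiagram.cl_of_isConn _
  -- The values of the inverse are checked by applying the forward map to the wheels.
  · rw [LinearEquiv.symm_apply_eq, hT, hW, List.ofFn_fin_append]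
    refine (ConnDiagram.mkQ_thetaCl hn hN (hne a hp) (hne c hr)).trans ?_
    have : (List.ofFn c).reverse = List.ofFn (c ∘ Fin.rev) := by
      refine List.ext_getElem (by simp) fun i h₁ h₂ => ?_
      simp only [List.getElem_reverse, List.getElem_ofFn, Function.comp_apply]
      congr 1
      ext
      simp only [List.length_ofFn, Fin.val_rev]
      omega
    rw [this]
    rfl
  · rw [LinearEquiv.symm_apply_eq, hT, hW]
    exact ConnDiagram.mkQ_thetaCl_two hn hN (hne a hp)
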